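/- Let $\mathbf A\in\mathbb C^{p\times p}$, $\mathbf B\in\mathbb C^{q\times q}$ be positive semidefinite Hermitian with $\operatorname{rank}\mathbf B=r_b$. For each noise level $\sigma>0$ let the training data be target-free snapshots $\mathbf n_m=\tau_m\mathbf c_m+\mathbf z_m\in\mathbb C^{pq}$, $m=1,2,\dots$, that are independent and identically distributed, where the texture $\tau_m>0$ has an arbitrary law with $E[\tau_m^2]<\infty$, the speckle $\mathbf c_m$ is zero-mean circular complex Gaussian with covariance $\mathbf A\otimes\mathbf B$, the noise $\mathbf z_m$ is zero-mean circular complex Gaussian with covariance $\sigma^2\mathbf I$, and $\tau_m,\mathbf c_m,\mathbf z_m$ are independent (SIRV model). Put $\mathbf\Sigma=E[\tau_1^2]\,\mathbf A\otimes\mathbf B+\sigma^2\mathbf I$. Fix $\tilde{\mathbf h}\in\mathbb C^p$ with $\|\tilde{\mathbf h}\|_2=1$ and $\tilde{\mathbf h}^H\mathbf A\tilde{\mathbf h}\neq0$, an amplitude $\alpha\ne 0$, and a steering vector $\mathbf d=\mathbf d_A\otimes\mathbf d_B$ with $(\mathbf I-\tilde{\mathbf h}\tilde{\mathbf h}^H)\mathbf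 d_A\neq0$ and $\mathbf d_B\notin\operatorname{range}\mathbf B$. Define $\mathrm{SINR}(\mathbf w)=|\alpha|^2|\mathbf w^H\mathbf d|^2/(\mathbf w^H\mathbf\Sigma\mathbf w)$ (with value $0$ at $\mathbf w=0$), and for $\mathbf F_B\in\mathbb C^{q\times q}$ let $\mathbf w(\mathbf F_B)=\big((\mathbf I-\tilde{\mathbf h}\tilde{\mathbf h}^H)\otimes\mathbf I\big)(\mathbf I\otimes\mathbf F_B)\,\mathbf d$. With $\mathbf S=\frac1n\sum_{m\le n}\mathbf n_m\mathbf n_m^H$ and $\hat{\mathbf A}=\tilde{\mathbf h}\tilde{\mathbf h}^H$, let $\hat{\mathbf U}_B$ be any (measurable) choice of the first $r_b$ principal components (orthonormal eigenvectors for the $r_b$ largest eigenvalues) of the $q\times q$ matrix $\mathbf R_B$ with entries $(\mathbf R_B)_{kl}=\|\hat{\mathbf A}\|_F^{-2}\sum_{i,j=1}^p \hat A_{ij}^*\,S_{(i,k),(j,l)}$. The SINR loss of the temporal stage is $$\rho_t=\frac{\mathrm{SINR}\big(\mathbf w(\mathbf I-\hat{\mathbf U}_B\hat{\mathbf U}_B^H)\big)}{\sup_{\mathbf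 F_B\in\mathbb C^{q\times q}}\mathrm{SINR}\big(\mathbf w(\mathbf F_B)\big)} .$$ Let $$\kappa=\frac{\tilde{\mathbf d}_A^H\mathbf A\tilde{\mathbf d}_A}{\tilde{\mathbf h}^H\mathbf A\tilde{\mathbf h}},\qquad \tilde{\mathbf d}_A=\frac{(\mathbf I-\tilde{\mathbf h}\tilde{\mathbf h}^H)\mathbf d_A}{\|(\mathbf I-\tilde{\mathbf h}\tilde{\mathbf h}^H)\mathbf d_A\|_2}.$$ Then $\rho_t$ is integrable for all $n$ and $\sigma>0$, and $E[\rho_t\mid\tilde{\mathbf h}]\approx1-\kappa r_b/n$ for large $n$ and small $\sigma$ in the following sense. 1. If $\mathbf d_B$ is orthogonal to $\operatorname{range}\mathbf B$, then $n\,(1-E[\rho_t\mid\tilde{\mathbf h}])\to\kappa r_b$ as $n\to\infty$ and $\sigma\to0^+$ jointly (in any relative manner). 2. If $\mathbf d_B\notin\operatorname{range}\mathbf B$ is otherwise arbitrary and $\kappa>0$, there is a constant $C$ such that for every $\varepsilon>0$ there are $N$ and $\sigma_0>0$ with $$\Big|E[\rho_t\mid\tilde{\mathbf h}]-\Big(1-\frac{\kappa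 r_b}{n}\Big)\Big|\le\frac{\varepsilon}{n}+C\sigma^2\qquad\text{for all }n\ge N,\ 0<\sigma<\sigma_0 .$$ -/

import Mathlib

open MeasureTheory ProbabilityTheory Filter Topology Matrix
open scoped Kronecker ComplexOrder

noncomputable section

/-- The (real) value `vᴴ M v` of a Hermitian form. -/
def hermForm {ι : Type*} [Fintype ι] (M : Matrix ι ι ℂ) (v : ι → ℂ) : ℝ :=
  (star v ⬝ᵥ M *ᵥ v).re

/-- `X` is a zero-mean circularly symmetric complex Gaussian vector with covariance
`E[X Xᴴ] = S`: for every `w` the real variable `Re (wᴴ X)` is centred Gaussian with variance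
`wᴴ S w / 2`.  (Replacing `w` by `I • w` covers the imaginary parts, so this determines the
law of `X`, and it forces `E[X Xᵀ] = 0`.) -/
structure IsCircularGaussian {Ω ι : Type*} [MeasurableSpace Ω] [Fintype ι]
    (X : Ω → ι → ℂ) (S : Matrix ι ι ℂ) (P : Measure Ω) : Prop where
  aemeasurable : AEMeasurable X P
  map_eq : ∀ w : ι → ℂ,
    P.map (fun ω => (star w ⬝ᵥ X ω).re) = gaussianReal 0 (hermForm S w / 2).toNNReal

/-- The target-free SIRV model for a sequence of i.i.d. snapshots
`n_m = τ_m c_m + z_m`: positive texture `τ_m` of arbitrary law with finite second moment,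
complex Gaussian speckle `c_m` of covariance `Sc`, complex Gaussian sensor noise `z_m` of
covariance `σ² I`, all independent. -/
structure IsSIRV {Ω ι : Type*} [MeasurableSpace Ω] [Fintype ι] [DecidableEq ι]
    (τ : ℕ → Ω → ℝ) (c z : ℕ → Ω → ι → ℂ) (Sc : Matrix ι ι ℂ) (σ : ℝ) (P : Measure Ω) :
    Prop where
  texture_pos : ∀ m, ∀ᵐ ω ∂P, 0 < τ m ω
  texture_memLp : ∀ m, MemLp (τ m) 2 P
  texture_identDistrib : ∀ m, IdentDistrib (τ m) (τ 0) P P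
  speckle : ∀ m, IsCircularGaussian (c m) Sc P
  noise : ∀ m, IsCircularGaussian (z m) ((σ : ℂ) ^ 2 • (1 : Matrix ι ι ℂ)) P
  indep_texture_speckle : ∀ m, IndepFun (τ m) (c m) P
  indep_clutter_noise : ∀ m, IndepFun (fun ω => (τ m ω, c m ω)) (z m) P
  indep_snapshots : iIndepFun (fun m ω => (τ m ω, c m ω, z m ω)) P

/-- The snapshot `n = τ c + z` (clutter plus noise). -/
def snapshot {ι : Type*} (t : ℝ) (c z : ι → ℂ) : ι → ℂ := fun i => (t : ℂ) * c i + z i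

/-- The sample covariance `(1/n) ∑_{m < n} x_m x_mᴴ`. -/
def sampleCov {ι : Type*} (n : ℕ) (x : ℕ → ι → ℂ) : Matrix ι ι ℂ :=
  (n : ℂ)⁻¹ • ∑ m ∈ Finset.range n, vecMulVec (x m) (star (x m))

/-- The clutter-plus-noise covariance `E[τ²] Sc + σ² I`. -/
def clutterNoiseCov {ι : Type*} [DecidableEq ι] (Eτ2 : ℝ) (Sc : Matrix ι ι ℂ) (σ : ℝ) :
    Matrix ι ι ℂ :=
  (Eτ2 : ℂ) • Sc + (σ : ℂ) ^ 2 • (1 : Matrix ι ι ℂ)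

/-- The temporal covariance fit for a fixed spatial factor `A`:
`R_B = (∑_{i,j} conj(A_ij) S_{(i,·),(j,·)}) / ‖A‖_F²`. -/
def temporalFit {p q : ℕ} (S : Matrix (Fin p × Fin q) (Fin p × Fin q) ℂ)
    (A : Matrix (Fin p) (Fin p) ℂ) : Matrix (Fin q) (Fin q) ℂ :=
  fun k l => (∑ i, ∑ j, star (A i j) * S (i, k) (j, l)) / ((∑ i, ∑ j, ‖A i j‖ ^ 2 : ℝ) : ℂ)

/-- The columns of `U` are the first `r` principal components of the Hermitian matrix `M`: the
first `r` columns of `V` in an eigendecomposition `M = V diag(l) Vᴴ` with `V` unitary and the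
eigenvalues `l` in decreasing order. -/
def IsPrincipalComponents {q r : ℕ} (M : Matrix (Fin q) (Fin q) ℂ)
    (U : Matrix (Fin q) (Fin r) ℂ) : Prop :=
  ∃ hr : r ≤ q, ∃ V ∈ Matrix.unitaryGroup (Fin q) ℂ, ∃ l : Fin q → ℝ, Antitone l ∧
    M = V * Matrix.diagonal (fun i => (l i : ℂ)) * Vᴴ ∧
    ∀ k i, U k i = V k (Fin.castLE hr i)

/-- The orthogonal projection `I - h hᴴ` (for a unit vector `h`). -/
def spatialProj {p : ℕ} (h : Fin p → ℂ) : Matrix (Fin p) (Fin p) ℂ := 1 - vecMulVec h (star h)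

/-- The steering vector `d_A ⊗ d_B`. -/
def kronVec {p q : ℕ} (dA : Fin p → ℂ) (dB : Fin q → ℂ) : Fin p × Fin q → ℂ :=
  fun x => dA x.1 * dB x.2

/-- The two-stage filter vector `w = F_spatial F_temp d`, with `F_spatial = (I - h hᴴ) ⊗ I` and
`F_temp = I ⊗ F_B`. -/
def twoStageFilter {p q : ℕ} (h : Fin p → ℂ) (FB : Matrix (Fin q) (Fin q) ℂ)
    (d : Fin p × Fin q → ℂ) : Fin p × Fin q → ℂ :=
  ((spatialProj h ⊗ₖ (1 : Matrix (Fin q) (Fin q) ℂ)) *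
    ((1 : Matrix (Fin p) (Fin p) ℂ) ⊗ₖ FB)) *ᵥ d

/-- Output SINR of the filter `w` for the target return `α d` in clutter plus noise of
covariance `S`: `|α|² |wᴴ d|² / (wᴴ S w)`. -/
def sinr {ι : Type*} [Fintype ι] (α : ℂ) (S : Matrix ι ι ℂ) (d w : ι → ℂ) : ℝ :=
  ‖α‖ ^ 2 * ‖star w ⬝ᵥ d‖ ^ 2 / hermForm S w

/-- The maximum SINR over all temporal filters `F_B`, the spatial filter `(I - h hᴴ) ⊗ I`
being fixed. -/
def sinrMax {p q : ℕ} (α : ℂ) (S : Matrix (Fin p × Fin q) (Fin p × Fin q) ℂ)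
    (h : Fin p → ℂ) (d : Fin p × Fin q → ℂ) : ℝ :=
  ⨆ FB : Matrix (Fin q) (Fin q) ℂ, sinr α S d (twoStageFilter h FB d)

/-- SINR loss of the temporal stage `F_B = I - U Uᴴ`. -/
def sinrLoss {p q r : ℕ} (α : ℂ) (S : Matrix (Fin p × Fin q) (Fin p × Fin q) ℂ)
    (h : Fin p → ℂ) (d : Fin p × Fin q → ℂ) (U : Matrix (Fin q) (Fin r) ℂ) : ℝ :=
  sinr α S d (twoStageFilter h (1 - U * Uᴴ) d) / sinrMax α S h d

/-- `(I - h hᴴ) d_A / ‖(I - h hᴴ) d_A‖₂`. -/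
def normalizedResidual {p : ℕ} (h dA : Fin p → ℂ) : Fin p → ℂ :=
  ((‖WithLp.toLp 2 (spatialProj h *ᵥ dA)‖⁻¹ : ℝ) : ℂ) • (spatialProj h *ᵥ dA)

/-- `κ = (d̃_Aᴴ A d̃_A) / (hᴴ A h)`. -/
def kappa {p : ℕ} (A : Matrix (Fin p) (Fin p) ℂ) (h dA : Fin p → ℂ) : ℝ :=
  hermForm A (normalizedResidual h dA) / hermForm A h

end

/-! ### Frobenius norm, sesquilinear forms, and perturbation of an invariant projection. -/

noncomputable section

section Deterministic

open scoped Matrix.Norms.Frobenius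

variable {q : ℕ}

/-! Contracting the data with `h` turns `R_B` into the sample covariance `R` of a `q`-dimensional
SIRV sequence with speckle covariance `a B`, `a = hᴴ A h`, and noise `σ² I`. Write `E = E[τ²]`, `d =
d_B`, `Q` for the projection onto the range of `B`, `V = U Uᴴ`, `t = dᴴ (1 - Q) d > 0` and `η = E *
(d̃_Aᴴ A d̃_A)`. All filters have the form `g ⊗ u` with the same spatial factor `g`, so only a
`q`-dimensional problem remains. By Cauchy–Schwarz the optimal SINR is, up to a common factor,
between `t / σ²` and `t / σ² + O(1)`, with no `O(1)` term when `Q d = 0`. Hence `ρ` equals `1 +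
O(σ²)` times `lossRatio`, which is `s² / ((η β / σ² + s) t)` with `s = dᴴ (1 - V) d` and `β = dᴴ (1
- V) B (1 - V) d` (`sinrLoss_eq_mul`).

The block `Q (1 - V)` measures how far the estimated subspace is off. Put `G = (Q R Q + 1 - Q)⁻¹`.
Commutation of `R` and `V` gives `Q (1 - V) = -J (1 - V) + G (Q (1 - V)) (R (1 - V))` with `J = G Q
R (1 - Q)`. By Ky Fan's inequality `‖R (1 - V)‖` is at most the mean noise energy outside the range,
which is `O(σ²)` with high probability. So `Q (1 - V) = -J` to first order
(`projection_perturbation`), and the loss is `(2 Re dᴴ J d + (η / σ²) dᴴ Jᴴ B J d) / t` up to `‖J‖²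
+ ‖J‖⁴ / σ⁴`, plus `O(σ²)` if `Q d ≠ 0` (`lossRatio_expansion`).

The clutter lies in the range of `B` almost surely, so `J` is the regression of the outer noise `(1
- Q) z` on the inner data `Q (τ c + z)`. Complementary projections of white Gaussian noise are
independent, so the two are independent and Fubini conditions on the inner data. Given them, `J` is
a linear combination of centred Gaussian vectors: the linear term has mean zero, the quadratic one
has mean `(σ² t / n) tr (G B)`, and the fourth moment of `‖J‖` is `O(σ⁴ / n²)`. Thus the mean loss
is `(η / n) E[tr (G B)]` up to `O(σ² / n + 1 / n²)` and the term above. By the law of large numbers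
`G` approaches the inverse of `a E B + 1 - Q`, so the trace tends to `r_b / (a E)`, and `η r_b / (a
E) = κ r_b`.

These bounds require the smallest eigenvalue of `G⁻¹` to stay away from zero. A texture with only
two moments gives no concentration of the sample covariance, but a lower bound needs only the
bounded matrices `x xᴴ / (1 + ‖x‖²)`, for which a fourth-moment Chebyshev inequality yields failure
probability `O(1 / n²)`. On the bad event the loss is bounded, so its contribution is `O(1 / n²)`,
negligible against `1 / n`. -/

theorem frobenius_sq (M : Matrix (Fin q) (Fin q) ℂ) : ‖M‖ ^ 2 = ∑ i, ∑ j, ‖M i j‖ ^ 2 := by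
  rw [frobenius_norm_def, ← Real.sqrt_eq_rpow, Real.sq_sqrt (by positivity)]
  simp

theorem frobenius_sq_eq_trace (M : Matrix (Fin q) (Fin q) ℂ) :
    ((‖M‖ ^ 2 : ℝ) : ℂ) = (M * Mᴴ).trace := by
  rw [frobenius_sq]
  simp [Matrix.trace, Matrix.mul_apply, Complex.mul_conj, Complex.normSq_eq_norm_sq]

theorem frobenius_eq_of_trace {M N : Matrix (Fin q) (Fin q) ℂ}
    (h : (M * Mᴴ).trace = (N * Nᴴ).trace) : ‖M‖ = ‖N‖ := by
  rw [← frobenius_sq_eq_trace, ← frobenius_sq_eq_trace] at h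
  have h' : ‖M‖ ^ 2 = ‖N‖ ^ 2 := by exact_mod_cast h
  exact (pow_left_inj₀ (norm_nonneg _) (norm_nonneg _) two_ne_zero).1 h'

/-- The complex value `vᴴ M v` of a sesquilinear form. -/
def quadForm (M : Matrix (Fin q) (Fin q) ℂ) (v : Fin q → ℂ) : ℂ := star v ⬝ᵥ M *ᵥ v

theorem hermForm_eq_re_quadForm (M : Matrix (Fin q) (Fin q) ℂ) (v : Fin q → ℂ) :
    hermForm M v = (quadForm M v).re := rfl

theorem quadForm_add (M N : Matrix (Fin q) (Fin q) ℂ) (v : Fin q → ℂ) :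
    quadForm (M + N) v = quadForm M v + quadForm N v := by
  simp [quadForm, add_mulVec, dotProduct_add]

theorem quadForm_neg (M : Matrix (Fin q) (Fin q) ℂ) (v : Fin q → ℂ) :
    quadForm (-M) v = -quadForm M v := by
  simp [quadForm, neg_mulVec]

theorem quadForm_sub (M N : Matrix (Fin q) (Fin q) ℂ) (v : Fin q → ℂ) :
    quadForm (M - N) v = quadForm M v - quadForm N v := by
  rw [sub_eq_add_neg, quadForm_add, quadForm_neg, sub_eq_add_neg]

theorem quadForm_conjTranspose (M : Matrix (Fin q) (Fin q) ℂ) (v : Fin q → ℂ) :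
    quadForm Mᴴ v = star (quadForm M v) := by
  rw [quadForm, quadForm, ← star_dotProduct_star, star_star, star_mulVec, dotProduct_mulVec]

theorem quadForm_conjTranspose_mul (M N : Matrix (Fin q) (Fin q) ℂ) (v : Fin q → ℂ) :
    quadForm (Mᴴ * N) v = star (M *ᵥ v) ⬝ᵥ N *ᵥ v := by
  rw [quadForm, ← mulVec_mulVec, dotProduct_mulVec, star_mulVec]

theorem quadForm_mul_eq_zero {P : Matrix (Fin q) (Fin q) ℂ} (hP : Pᴴ = P) {v : Fin q → ℂ}
    (hv : P *ᵥ v = 0) (M : Matrix (Fin q) (Fin q) ℂ) : quadForm (P * M) v = 0 := by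
  rw [← hP, quadForm_conjTranspose_mul, hv]; simp

/-- The squared Euclidean length of a vector. -/
def sqLen {ι : Type*} [Fintype ι] (v : ι → ℂ) : ℝ := ∑ i, ‖v i‖ ^ 2

theorem sqLen_nonneg {ι : Type*} [Fintype ι] (v : ι → ℂ) : 0 ≤ sqLen v := by
  unfold sqLen; positivity

theorem star_dotProduct_self_eq_sqLen {ι : Type*} [Fintype ι] (v : ι → ℂ) :
    star v ⬝ᵥ v = (sqLen v : ℂ) := by
  simp [dotProduct, sqLen, Complex.conj_mul']

theorem norm_star_dotProduct_sq_le {ι : Type*} [Fintype ι] (v w : ι → ℂ) :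
    ‖star v ⬝ᵥ w‖ ^ 2 ≤ sqLen v * sqLen w := by
  have h1 : ‖star v ⬝ᵥ w‖ ≤ ∑ i, ‖v i‖ * ‖w i‖ := by
    refine (norm_sum_le _ _).trans (le_of_eq ?_)
    simp
  calc _ ≤ (∑ i, ‖v i‖ * ‖w i‖) ^ 2 := by gcongr
    _ ≤ _ := Finset.sum_mul_sq_le_sq_mul_sq _ _ _

theorem sqLen_mulVec_le (M : Matrix (Fin q) (Fin q) ℂ) (v : Fin q → ℂ) :
    sqLen (M *ᵥ v) ≤ ‖M‖ ^ 2 * sqLen v := by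
  rw [frobenius_sq, Finset.sum_mul, sqLen]
  refine Finset.sum_le_sum fun i _ => ?_
  have := norm_star_dotProduct_sq_le (star (M i)) v
  rw [star_star] at this
  simpa [sqLen, mulVec] using this

theorem norm_quadForm_le (M : Matrix (Fin q) (Fin q) ℂ) (v : Fin q → ℂ) :
    ‖quadForm M v‖ ≤ sqLen v * ‖M‖ := by
  have h := norm_star_dotProduct_sq_le v (M *ᵥ v)
  have h2 := sqLen_mulVec_le M v
  have h0 := sqLen_nonneg v
  refine abs_le_of_sq_le_sq' ?_ (by positivity) |>.2
  calc _ ≤ sqLen v * sqLen (M *ᵥ v) := h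
    _ ≤ sqLen v * (‖M‖ ^ 2 * sqLen v) := by gcongr
    _ = _ := by ring

theorem norm_one_sub_eq_of_trace_eq {P Q : Matrix (Fin q) (Fin q) ℂ} (hP : Pᴴ = P)
    (hPP : P * P = P) (hQ : Qᴴ = Q) (hQQ : Q * Q = Q) (htr : P.trace = Q.trace) :
    ‖1 - Q‖ = ‖1 - P‖ := by
  refine frobenius_eq_of_trace ?_
  simp [sub_mul, mul_sub, hP, hQ, hPP, hQQ, htr]

/-- Both squared norms equal the common trace minus `tr (P Q)`. So one number controls both
off-diagonal blocks of the difference of the projections. -/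
theorem norm_one_sub_mul_eq {P Q : Matrix (Fin q) (Fin q) ℂ} (hP : Pᴴ = P)
    (hPP : P * P = P) (hQ : Qᴴ = Q) (hQQ : Q * Q = Q) (htr : P.trace = Q.trace) :
    ‖(1 - P) * Q‖ = ‖P * (1 - Q)‖ := by
  refine frobenius_eq_of_trace ?_
  have h1 : ((1 - P) * Q) * ((1 - P) * Q)ᴴ = (1 - P) * Q * (1 - P) := by
    simp only [conjTranspose_mul, conjTranspose_sub, conjTranspose_one, hP, hQ]
    rw [Matrix.mul_assoc, ← Matrix.mul_assoc Q Q, hQQ, Matrix.mul_assoc]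
  have h2 : (P * (1 - Q)) * (P * (1 - Q))ᴴ = P * (1 - Q) * P := by
    simp only [conjTranspose_mul, conjTranspose_sub, conjTranspose_one, hP, hQ]
    have : (1 - Q) * (1 - Q) = 1 - Q := by simp [sub_mul, mul_sub, hQQ]
    rw [Matrix.mul_assoc, ← Matrix.mul_assoc (1 - Q) (1 - Q), this, Matrix.mul_assoc]
  have : (1 - P) * (1 - P) = 1 - P := by simp [sub_mul, mul_sub, hPP]
  rw [h1, h2, Matrix.trace_mul_comm, Matrix.trace_mul_comm (P * (1 - Q)), ← Matrix.mul_assoc,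
    ← Matrix.mul_assoc, hPP, this]
  simp [sub_mul, mul_sub, htr]

/-- First-order expansion of an invariant projection `Q` of `R` around the projection `P`. -/
theorem projection_perturbation {P Q R G : Matrix (Fin q) (Fin q) ℂ} (hP : Pᴴ = P)
    (hPP : P * P = P) (hQ : Qᴴ = Q) (hQQ : Q * Q = Q) (htr : P.trace = Q.trace)
    (hRQ : R * Q = Q * R) (hG : G * (P * R * P + (1 - P)) = 1) {k K : ℝ}
    (hk : ‖R * (1 - Q)‖ ≤ k) (hK : ‖G‖ ≤ K) (hkK : K * k ≤ 1 / 2) :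
    ‖P * (1 - Q)‖ ≤ 2 * ‖1 - P‖ * ‖G * P * R * (1 - P)‖ ∧
    ‖P * (1 - Q) + G * P * R * (1 - P)‖ ≤
      ‖G * P * R * (1 - P)‖ * ‖P * (1 - Q)‖ + K * k * ‖P * (1 - Q)‖ := by
  set J := G * P * R * (1 - P) with hJ
  -- `G` inverts a block-diagonal matrix, so on the block of `P` it inverts `P R P`.
  have hGP : G * (P * R * P) = P := by
    have := congrArg (· * P) hG
    simp only [Matrix.mul_assoc, add_mul, sub_mul, hPP, one_mul, sub_self, add_zero] at this
    simpa [Matrix.mul_assoc] using this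
  have hQ1 : (1 - Q) * (1 - Q) = 1 - Q := by simp [sub_mul, mul_sub, hQQ]
  have hRQ1 : R * (1 - Q) = (1 - Q) * (R * (1 - Q)) := by
    have : R * (1 - Q) = (1 - Q) * R := by simp [sub_mul, mul_sub, hRQ]
    calc R * (1 - Q) = R * ((1 - Q) * (1 - Q)) := by rw [hQ1]
      _ = (R * (1 - Q)) * (1 - Q) := by rw [Matrix.mul_assoc]
      _ = ((1 - Q) * R) * (1 - Q) := by rw [this]
      _ = _ := by rw [Matrix.mul_assoc]
  -- Expand `P (1 - Q) = G P R P (1 - Q)` by writing the second `P` as `1 - (1 - P)`. The part with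
  -- `1 - P` is `-J (1 - Q)`; in the other, invariance of the complement of `Q` under `R` produces a
  -- second copy of `1 - Q`.
  have key : P * (1 - Q) = -(J * (1 - Q)) + G * (P * (1 - Q)) * (R * (1 - Q)) := by
    have e1 : G * (P * (1 - Q)) * (R * (1 - Q)) = G * P * R * (1 - Q) := by
      conv_rhs => rw [Matrix.mul_assoc _ R, hRQ1]
      simp only [Matrix.mul_assoc]
    have e2 : P * (1 - Q) = G * P * R * P * (1 - Q) := by
      conv_lhs => rw [← hGP]
      simp only [Matrix.mul_assoc]
    rw [e1, e2, hJ]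
    noncomm_ring
  have hE : ‖G * (P * (1 - Q)) * (R * (1 - Q))‖ ≤ K * k * ‖P * (1 - Q)‖ := by
    have hk0 : 0 ≤ k := (norm_nonneg _).trans hk
    calc _ ≤ ‖G * (P * (1 - Q))‖ * ‖R * (1 - Q)‖ := frobenius_norm_mul _ _
      _ ≤ (‖G‖ * ‖P * (1 - Q)‖) * ‖R * (1 - Q)‖ := by gcongr; exact frobenius_norm_mul _ _
      _ ≤ (K * ‖P * (1 - Q)‖) * k := by
          have := (norm_nonneg _).trans hK
          gcongr
      _ = _ := by ring
  constructor
  · have h1 : ‖P * (1 - Q)‖ ≤ ‖J‖ * ‖1 - P‖ + K * k * ‖P * (1 - Q)‖ := by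
      calc ‖P * (1 - Q)‖ = ‖-(J * (1 - Q)) + G * (P * (1 - Q)) * (R * (1 - Q))‖ := by rw [← key]
        _ ≤ ‖J * (1 - Q)‖ + ‖G * (P * (1 - Q)) * (R * (1 - Q))‖ := by
            refine (norm_add_le _ _).trans ?_
            rw [norm_neg]
        _ ≤ ‖J‖ * ‖1 - P‖ + _ := by
            rw [← norm_one_sub_eq_of_trace_eq hP hPP hQ hQQ htr]
            gcongr
            exact frobenius_norm_mul _ _
    -- The smallness `K k ≤ 1 / 2` allows this term to be absorbed into the left side.
    have h2 : K * k * ‖P * (1 - Q)‖ ≤ 1 / 2 * ‖P * (1 - Q)‖ := by gcongr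
    linarith
  · have hJQ : J * Q = J * ((1 - P) * Q) := by
      have : (1 - P) * (1 - P) = 1 - P := by simp [sub_mul, mul_sub, hPP]
      rw [hJ]
      conv_lhs => rw [← this]
      simp only [Matrix.mul_assoc]
    have e : P * (1 - Q) + J = J * ((1 - P) * Q) + G * (P * (1 - Q)) * (R * (1 - Q)) := by
      rw [← hJQ]
      conv_lhs => rw [key]
      noncomm_ring
    rw [e]
    refine (norm_add_le _ _).trans ?_
    gcongr
    refine (frobenius_norm_mul _ _).trans ?_
    rw [norm_one_sub_mul_eq hP hPP hQ hQQ htr]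

end Deterministic

end

/-! ### Second-order expansion of the loss for a fixed sample. -/

noncomputable section

/-- In these scalar lemmas `Ψ` stands for `‖J‖ / σ`, `θ` for `‖P (1 - Q)‖` and `e` for `‖P (1 - Q) +
J‖`. Substituting the first-order bound on `θ` into the recursive bound on `e` makes `e` quadratic.
Since `Ψ` is typically of size `n^(-1/2)`, the target scales are `σ² Ψ²` and `Ψ⁴`. -/
theorem remainder_le {c₁ c₂ σ Ψ θ e : ℝ} (h₁ : 0 ≤ c₁) (h₂ : 0 ≤ c₂) (hσ : 0 < σ) (hΨ : 0 ≤ Ψ)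
    (hθ1 : θ ≤ c₁ * (σ * Ψ)) (he1 : e ≤ σ * Ψ * θ + c₂ * σ ^ 2 * θ) :
    e ≤ c₁ * (1 + c₂) * σ ^ 2 * (Ψ ^ 2 + σ * Ψ) := by
  have a1 : σ * Ψ * θ ≤ σ * Ψ * (c₁ * (σ * Ψ)) := by gcongr
  have a2 : c₂ * σ ^ 2 * θ ≤ c₂ * σ ^ 2 * (c₁ * (σ * Ψ)) := by gcongr
  have a3 : 0 ≤ c₁ * c₂ * σ ^ 2 * Ψ ^ 2 := by positivity
  have a4 : 0 ≤ c₁ * σ ^ 2 * (σ * Ψ) := by positivity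
  linear_combination he1 + a1 + a2 + a3 + a4

/-- The part `σ³ Ψ` of `e` is only `O(σ³ / √n)`, which is not within the target scales. It is
bounded by `σ² + σ⁴ Ψ²`, and this is the origin of the residual `m σ²`, absent when `m = 0`. -/
theorem signal_estimate {D c₁ c₃ c₄ σ Ψ θ e m x : ℝ} (hD : 0 ≤ D) (h₃ : 0 ≤ c₃)
    (h₄ : 0 ≤ c₄) (hσ : 0 < σ) (hσ1 : σ ≤ 1) (hΨ : 0 ≤ Ψ) (hθ : 0 ≤ θ)
    (hθ1 : θ ≤ c₁ * (σ * Ψ)) (hm : 0 ≤ m) (hm1 : m ≤ 1)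
    (e1 : e ≤ c₄ * σ ^ 2 * (Ψ ^ 2 + σ * Ψ)) (H1 : x ≤ D * (2 * θ ^ 2 + 2 * c₃ * e * m)) :
    x ≤ D * (2 * c₁ ^ 2 + 4 * c₃ * c₄) * (σ ^ 2 * Ψ ^ 2) + 2 * D * c₃ * c₄ * m * σ ^ 2 := by
  have hσ2 : σ ^ 2 ≤ 1 := pow_le_one₀ hσ.le hσ1
  have e2 : e ≤ c₄ * (2 * (σ ^ 2 * Ψ ^ 2) + σ ^ 2) := by
    refine e1.trans ?_
    rw [mul_assoc]
    refine mul_le_mul_of_nonneg_left ?_ h₄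
    have : σ * Ψ ≤ 1 + σ ^ 2 * Ψ ^ 2 := by nlinarith [sq_nonneg (σ * Ψ - 1), mul_nonneg hσ.le hΨ]
    have b1 : σ ^ 2 * (σ * Ψ) ≤ σ ^ 2 * (1 + σ ^ 2 * Ψ ^ 2) := by gcongr
    have b2 : σ ^ 2 * (σ ^ 2 * Ψ ^ 2) ≤ 1 * (σ ^ 2 * Ψ ^ 2) := by gcongr
    linarith
  have b1 : θ ^ 2 ≤ (c₁ * (σ * Ψ)) ^ 2 := by gcongr
  have b2 : e * m ≤ c₄ * (2 * (σ ^ 2 * Ψ ^ 2) + σ ^ 2) * m := by gcongr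
  have b3 : c₄ * (2 * (σ ^ 2 * Ψ ^ 2)) * m ≤ c₄ * (2 * (σ ^ 2 * Ψ ^ 2)) :=
    mul_le_of_le_one_right (by positivity) hm1
  calc x ≤ D * (2 * θ ^ 2 + 2 * c₃ * (e * m)) := by rw [← mul_assoc (2 * c₃)]; exact H1
    _ ≤ D * (2 * (c₁ * (σ * Ψ)) ^ 2 +
        2 * c₃ * (c₄ * (2 * (σ ^ 2 * Ψ ^ 2)) + c₄ * σ ^ 2 * m)) := by
        gcongr; linarith
    _ = _ := by ring

/-- The factor `1 / σ²` is cancelled because `e` carries `σ²`. The mixed terms `σ Ψ³` left over are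
split by `2 σ Ψ³ ≤ σ² Ψ² + Ψ⁴`. -/
theorem leakage_estimate {D N η c₄ σ Ψ e x : ℝ} (hD : 0 ≤ D) (hN : 0 ≤ N) (hη : 0 ≤ η)
    (h₄ : 0 ≤ c₄) (hσ : 0 < σ) (hσ1 : σ ≤ 1) (hΨ : 0 ≤ Ψ) (he : 0 ≤ e)
    (e1 : e ≤ c₄ * σ ^ 2 * (Ψ ^ 2 + σ * Ψ)) (hx : x ≤ D * N * (e ^ 2 + 2 * e * (σ * Ψ))) :
    η / σ ^ 2 * x ≤ η * (D * N) * (2 * c₄ ^ 2 + 4 * c₄) * (σ ^ 2 * Ψ ^ 2 + Ψ ^ 4) := by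
  have hσ2 : σ ^ 2 ≤ 1 := pow_le_one₀ hσ.le hσ1
  have f1 : e * (σ * Ψ) ≤ σ ^ 2 * (2 * c₄ * (σ ^ 2 * Ψ ^ 2 + Ψ ^ 4)) := by
    have : e * (σ * Ψ) ≤ c₄ * σ ^ 2 * (Ψ ^ 2 + σ * Ψ) * (σ * Ψ) := by gcongr
    refine this.trans ?_
    have g : (Ψ ^ 2 + σ * Ψ) * (σ * Ψ) ≤ 2 * (σ ^ 2 * Ψ ^ 2 + Ψ ^ 4) := by
      have := sq_nonneg (Ψ ^ 2 - σ * Ψ)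
      have : 0 ≤ Ψ ^ 4 := by positivity
      nlinarith
    calc _ = c₄ * σ ^ 2 * ((Ψ ^ 2 + σ * Ψ) * (σ * Ψ)) := by ring
      _ ≤ c₄ * σ ^ 2 * (2 * (σ ^ 2 * Ψ ^ 2 + Ψ ^ 4)) := by gcongr
      _ = _ := by ring
  have f2 : e ^ 2 ≤ σ ^ 2 * (2 * c₄ ^ 2 * (σ ^ 2 * Ψ ^ 2 + Ψ ^ 4)) := by
    have : e ^ 2 ≤ (c₄ * σ ^ 2 * (Ψ ^ 2 + σ * Ψ)) ^ 2 := by gcongr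
    refine this.trans ?_
    have g : (Ψ ^ 2 + σ * Ψ) ^ 2 ≤ 2 * (σ ^ 2 * Ψ ^ 2 + Ψ ^ 4) := by
      have := sq_nonneg (Ψ ^ 2 - σ * Ψ)
      linarith
    calc _ = c₄ ^ 2 * σ ^ 2 * (σ ^ 2 * (Ψ ^ 2 + σ * Ψ) ^ 2) := by ring
      _ ≤ c₄ ^ 2 * σ ^ 2 * (1 * (2 * (σ ^ 2 * Ψ ^ 2 + Ψ ^ 4))) := by gcongr
      _ = _ := by ring
  have f3 : e ^ 2 + 2 * e * (σ * Ψ) ≤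
      σ ^ 2 * ((2 * c₄ ^ 2 + 4 * c₄) * (σ ^ 2 * Ψ ^ 2 + Ψ ^ 4)) := by linarith
  calc η / σ ^ 2 * x ≤ η / σ ^ 2 * (D * N * (e ^ 2 + 2 * e * (σ * Ψ))) := by gcongr
    _ ≤ η / σ ^ 2 * (D * N * (σ ^ 2 * ((2 * c₄ ^ 2 + 4 * c₄) * (σ ^ 2 * Ψ ^ 2 + Ψ ^ 4)))) := by
        gcongr
    _ = _ := by field_simp

/-- If `s ≥ t / 2` the denominator is bounded below and the bound is direct. Otherwise the signal
has moved by `t / 2`, which forces `Ψ²` to be bounded below; then `b² / (b + s) ≤ b ≤ c₆ Ψ²` is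
itself at most a constant times `Ψ⁴`. -/
theorem ratio_remainder_le {t D c₁ c₆ σ Ψ θ s b : ℝ} (ht : 0 < t) (hD : 0 ≤ D) (h₁ : 0 ≤ c₁)
    (h₆ : 0 ≤ c₆) (hσ1 : σ ≤ 1) (hΨ : 0 ≤ Ψ) (hθ1 : θ ≤ c₁ * (σ * Ψ)) (hs : 0 ≤ s) (hb0 : 0 ≤ b)
    (H0 : |s - t| ≤ D * (2 * θ)) (hb1 : b ≤ c₆ * Ψ ^ 2) :
    b ^ 2 / (b + s) ≤ (2 * c₆ ^ 2 / t + c₆ * (4 * D * c₁ / t) ^ 2) * Ψ ^ 4 := by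
  rcases le_or_gt (t / 2) s with hst | hst
  · calc b ^ 2 / (b + s) ≤ (c₆ * Ψ ^ 2) ^ 2 / (t / 2) := by gcongr; linarith
      _ = 2 * c₆ ^ 2 / t * Ψ ^ 4 := by field_simp
      _ ≤ _ := by
        gcongr
        linarith [show 0 ≤ c₆ * (4 * D * c₁ / t) ^ 2 by positivity]
  · have g1 : t / 2 ≤ D * (2 * (c₁ * Ψ)) := by
      have : |s - t| = t - s := by rw [abs_sub_comm, abs_of_pos]; linarith
      have g2 : c₁ * (σ * Ψ) ≤ c₁ * (1 * Ψ) := by gcongr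
      have g3 : D * (2 * θ) ≤ D * (2 * (c₁ * Ψ)) := by gcongr; linarith
      linarith
    have g2 : 1 ≤ (4 * D * c₁ / t) ^ 2 * Ψ ^ 2 := by
      rw [← mul_pow]
      refine one_le_pow₀ ?_
      rw [div_mul_eq_mul_div, le_div_iff₀ ht]; linarith
    have g3 : b ^ 2 / (b + s) ≤ b := by
      rcases eq_or_lt_of_le (add_nonneg hb0 hs) with h | h
      · rw [← h]; simpa using hb0
      · rw [div_le_iff₀ h]; nlinarith
    calc b ^ 2 / (b + s) ≤ c₆ * Ψ ^ 2 * 1 := by linarith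
      _ ≤ c₆ * Ψ ^ 2 * ((4 * D * c₁ / t) ^ 2 * Ψ ^ 2) := by gcongr
      _ = c₆ * (4 * D * c₁ / t) ^ 2 * Ψ ^ 4 := by ring
      _ ≤ _ := by
        gcongr
        linarith [show 0 ≤ 2 * c₆ ^ 2 / t by positivity]

/-- This is `s² / (b + s) = s - b + b² / (b + s)`. When `b + s = 0` both variables vanish and
division by zero keeps the identity true. -/
theorem lossRatio_eq {s b t l b₀ : ℝ} (ht : t ≠ 0) (hb0 : 0 ≤ b) (hs : 0 ≤ s) :
    s ^ 2 / ((b + s) * t) - 1 + (2 * l + b₀) / t =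
      ((s - t + 2 * l) - (b - b₀) + b ^ 2 / (b + s)) / t := by
  rcases eq_or_lt_of_le (add_nonneg hb0 hs) with h | h
  · have hs0 : s = 0 := by linarith
    have hb0 : b = 0 := by linarith
    rw [hs0, hb0]; field_simp; ring
  · field_simp; ring

theorem lossRatio_real_estimate {t D N η c₁ c₂ c₃ : ℝ} (ht : 0 < t) (hD : 0 ≤ D) (hN : 0 ≤ N)
    (hη : 0 ≤ η) (h₁ : 0 ≤ c₁) (h₂ : 0 ≤ c₂) (h₃ : 0 ≤ c₃) :
    ∃ C, 0 ≤ C ∧ ∀ σ Ψ θ e s β l β₀ m : ℝ, 0 < σ → σ ≤ 1 → 0 ≤ Ψ → 0 ≤ θ → θ ≤ c₁ * (σ * Ψ) →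
      0 ≤ e → e ≤ σ * Ψ * θ + c₂ * σ ^ 2 * θ → 0 ≤ s → 0 ≤ β → 0 ≤ m → m ≤ 1 →
      |s - t| ≤ D * (2 * θ) → |s - t + 2 * l| ≤ D * (2 * θ ^ 2 + 2 * c₃ * e * m) →
      |β - β₀| ≤ D * N * (e ^ 2 + 2 * e * (σ * Ψ)) → β ≤ D * N * θ ^ 2 →
      |s ^ 2 / ((η / σ ^ 2 * β + s) * t) - 1 + (2 * l + η / σ ^ 2 * β₀) / t| ≤
        C * (σ ^ 2 * Ψ ^ 2 + Ψ ^ 4) + C * m * σ ^ 2 := by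
  have h₄ : 0 ≤ c₁ * (1 + c₂) := by positivity
  have h₆ : 0 ≤ η * (D * N * c₁ ^ 2) := by positivity
  obtain ⟨c₇, hc₇⟩ : ∃ x, x = 2 * (η * (D * N * c₁ ^ 2)) ^ 2 / t +
    η * (D * N * c₁ ^ 2) * (4 * D * c₁ / t) ^ 2 := ⟨_, rfl⟩
  have h₇ : 0 ≤ c₇ := by rw [hc₇]; positivity
  obtain ⟨A₁, hA₁⟩ : ∃ x, x = D * (2 * c₁ ^ 2 + 4 * c₃ * (c₁ * (1 + c₂))) := ⟨_, rfl⟩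
  obtain ⟨A₂, hA₂⟩ : ∃ x, x = η * (D * N) * (2 * (c₁ * (1 + c₂)) ^ 2 + 4 * (c₁ * (1 + c₂))) :=
    ⟨_, rfl⟩
  obtain ⟨A₃, hA₃⟩ : ∃ x, x = 2 * D * c₃ * (c₁ * (1 + c₂)) := ⟨_, rfl⟩
  have hA₁' : 0 ≤ A₁ := by rw [hA₁]; positivity
  have hA₂' : 0 ≤ A₂ := by rw [hA₂]; positivity
  have hA₃' : 0 ≤ A₃ := by rw [hA₃]; positivity
  refine ⟨(A₁ + A₂ + A₃ + c₇) / t, by positivity, ?_⟩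
  intro σ Ψ θ e s β l β₀ m hσ hσ1 hΨ hθ hθ1 he he1 hs hβ hm hm1 H0 H1 H2 H3
  have e1 := remainder_le h₁ h₂ hσ hΨ hθ1 he1
  have B1 := signal_estimate hD h₃ h₄ hσ hσ1 hΨ hθ hθ1 hm hm1 e1 H1
  have B2 := leakage_estimate hD hN hη h₄ hσ hσ1 hΨ he e1 H2
  have hb0 : 0 ≤ η / σ ^ 2 * β := by positivity
  have hb1 : η / σ ^ 2 * β ≤ η * (D * N * c₁ ^ 2) * Ψ ^ 2 := by
    calc η / σ ^ 2 * β ≤ η / σ ^ 2 * (D * N * (c₁ * (σ * Ψ)) ^ 2) := by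
          gcongr; refine H3.trans ?_; gcongr
      _ = _ := by field_simp
  have B3 := ratio_remainder_le ht hD h₁ h₆ hσ1 hΨ hθ1 hs hb0 H0 hb1
  have B4 : 0 ≤ (η / σ ^ 2 * β) ^ 2 / (η / σ ^ 2 * β + s) := by positivity
  have B2' : |η / σ ^ 2 * β - η / σ ^ 2 * β₀| ≤ A₂ * (σ ^ 2 * Ψ ^ 2 + Ψ ^ 4) := by
    rw [← mul_sub, abs_mul, abs_of_nonneg (by positivity), hA₂]
    exact B2
  rw [← hA₁, ← hA₃] at B1
  rw [← hc₇] at B3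
  rw [lossRatio_eq ht.ne' hb0 hs, abs_div, abs_of_pos ht, div_le_iff₀ ht]
  clear e1 B2 hA₁ hA₂ hA₃ hc₇ H0 H1 H2 H3 hb1
  generalize η / σ ^ 2 * β = b at *
  generalize η / σ ^ 2 * β₀ = b₀ at *
  obtain ⟨u, hu⟩ : ∃ u, u = σ ^ 2 * Ψ ^ 2 := ⟨_, rfl⟩
  obtain ⟨v, hv⟩ : ∃ v, v = Ψ ^ 4 := ⟨_, rfl⟩
  have hu0 : 0 ≤ u := by rw [hu]; positivity
  have hv0 : 0 ≤ v := by rw [hv]; positivity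
  rw [← hu] at B1 B2' ⊢
  rw [← hv] at B2' B3 ⊢
  have fin : |(s - t + 2 * l) - (b - b₀) + b ^ 2 / (b + s)| ≤
      A₁ * u + A₃ * m * σ ^ 2 + A₂ * (u + v) + c₇ * v := by
    rw [abs_le] at B1 B2' ⊢
    constructor <;> linarith [B1.1, B1.2, B2'.1, B2'.2]
  refine fin.trans ?_
  have : ((A₁ + A₂ + A₃ + c₇) / t * (u + v) + (A₁ + A₂ + A₃ + c₇) / t * m * σ ^ 2) * t =
    (A₁ + A₂ + A₃ + c₇) * (u + v) + (A₁ + A₂ + A₃ + c₇) * (m * σ ^ 2) := by field_simp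
  rw [this]
  have r1 : 0 ≤ (A₁ + A₂ + c₇) * (m * σ ^ 2) := by positivity
  have r2 : 0 ≤ (A₃ + c₇) * u + (A₁ + A₃) * v := by positivity
  linarith

section

open scoped Matrix.Norms.Frobenius

variable {q : ℕ}

theorem sqLen_mulVec_of_projection {P : Matrix (Fin q) (Fin q) ℂ} (hP : Pᴴ = P)
    (hPP : P * P = P) (v : Fin q → ℂ) :
    quadForm P v = ((sqLen (P *ᵥ v) : ℝ) : ℂ) := by
  rw [← star_dotProduct_self_eq_sqLen (P *ᵥ v), ← quadForm_conjTranspose_mul, hP, hPP]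

theorem re_quadForm_projection_nonneg {P : Matrix (Fin q) (Fin q) ℂ} (hP : Pᴴ = P)
    (hPP : P * P = P) (v : Fin q → ℂ) : 0 ≤ (quadForm P v).re := by
  rw [sqLen_mulVec_of_projection hP hPP]; exact sqLen_nonneg (P *ᵥ v)

theorem abs_re_quadForm_le (M : Matrix (Fin q) (Fin q) ℂ) (v : Fin q → ℂ) :
    |(quadForm M v).re| ≤ sqLen v * ‖M‖ :=
  (Complex.abs_re_le_norm _).trans (norm_quadForm_le M v)

/-- Second-order expansion of the normalized signal loss of the projection `1 - Q` around
`1 - P`. -/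
theorem lossRatio_expansion {P B : Matrix (Fin q) (Fin q) ℂ} (hP : Pᴴ = P)
    (hPP : P * P = P) (hB : B.PosSemidef) (hPB : P * B = B) (hBP : B * P = B) {d : Fin q → ℂ}
    (hd : 0 < (quadForm (1 - P) d).re) {η K K₁ : ℝ} (hη : 0 ≤ η) (hK0 : 0 ≤ K) (hK₁0 : 0 ≤ K₁) :
    ∃ C, 0 ≤ C ∧ ∀ σ : ℝ, 0 < σ → σ ≤ 1 → K₁ * (K * σ ^ 2) ≤ 1 / 2 →
      ∀ Q R G : Matrix (Fin q) (Fin q) ℂ, Qᴴ = Q → Q * Q = Q → P.trace = Q.trace →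
      R * Q = Q * R → G * (P * R * P + (1 - P)) = 1 → ‖R * (1 - Q)‖ ≤ K * σ ^ 2 → ‖G‖ ≤ K₁ →
      ∀ J, J = G * P * R * (1 - P) →
      |(quadForm (1 - Q) d).re ^ 2 / ((η / σ ^ 2 * (quadForm ((1 - Q) * B * (1 - Q)) d).re +
          (quadForm (1 - Q) d).re) * (quadForm (1 - P) d).re) - 1 +
          (2 * (quadForm J d).re + η / σ ^ 2 * (quadForm (Jᴴ * B * J) d).re) /
            (quadForm (1 - P) d).re| ≤
        C * (‖J‖ ^ 2 + ‖J‖ ^ 4 / σ ^ 4) + C * (if P *ᵥ d = 0 then 0 else 1) * σ ^ 2 := by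
  obtain ⟨C, hC, H⟩ := lossRatio_real_estimate hd (sqLen_nonneg d) (norm_nonneg B) hη
    (show 0 ≤ 2 * ‖1 - P‖ by positivity) (mul_nonneg hK₁0 hK0) (norm_nonneg (1 - P))
  refine ⟨C, hC, ?_⟩
  intro σ hσ hσ1 hKσ Q R G hQ hQQ htr hRQ hG hk hGK J hJ
  obtain ⟨p1, p2⟩ := projection_perturbation hP hPP hQ hQQ htr hRQ hG hk hGK hKσ
  have hpq := norm_one_sub_mul_eq hP hPP hQ hQQ htr
  rw [← hJ] at p1 p2
  set θ := ‖P * (1 - Q)‖ with hθ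
  set E := P * (1 - Q) + J with hE
  have hσ' : σ ≠ 0 := hσ.ne'
  have hΦ : ‖J‖ = σ * (‖J‖ / σ) := by field_simp
  have hP1 : (1 - P) * (1 - P) = 1 - P := by simp [sub_mul, mul_sub, hPP]
  have hQ1 : (1 - Q) * (1 - Q) = 1 - Q := by simp [sub_mul, mul_sub, hQQ]
  have hP1' : (1 - P)ᴴ = 1 - P := by simp [hP]
  have hQ1' : (1 - Q)ᴴ = 1 - Q := by simp [hQ]
  have hJ1 : J * (1 - P) = J := by rw [hJ, Matrix.mul_assoc, hP1]
  have hG' : (P * R * P + (1 - P)) * G = 1 := mul_eq_one_comm.1 hG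
  have hGP1 : G * (1 - P) = 1 - P := by
    have := congrArg (· * (1 - P)) hG
    simp only [Matrix.mul_assoc, add_mul, hP1, one_mul] at this
    rwa [show P * (1 - P) = 0 by simp [mul_sub, hPP], Matrix.mul_zero, Matrix.mul_zero,
      zero_add] at this
  have hGP2 : (1 - P) * G = 1 - P := by
    have := congrArg ((1 - P) * ·) hG'
    simp only [← Matrix.mul_assoc, mul_add, hP1, mul_one] at this
    rwa [show (1 - P) * P = 0 by simp [sub_mul, hPP], Matrix.zero_mul, Matrix.zero_mul,
      zero_add] at this
  -- The inverse of a block-diagonal matrix is block diagonal; hence `J` takes values in the range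
  -- of `P`.
  have hPG : P * G = G * P := by
    have h1 : G - G * P = 1 - P := by rw [← hGP1]; noncomm_ring
    have h2 : G - P * G = 1 - P := by rw [← hGP2]; noncomm_ring
    have : G - P * G = G - G * P := by rw [h1, h2]
    exact sub_right_injective this
  have hPJ : P * J = J := by
    rw [hJ]
    simp only [← Matrix.mul_assoc]
    rw [hPG, Matrix.mul_assoc G P P, hPP]
  have hPE : P * E = E := by rw [hE, mul_add, hPJ, ← Matrix.mul_assoc, hPP]
  have hA : P * (1 - Q) = E - J := by rw [hE]; abel
  -- the quadratic form of `P - Q`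
  have d1 : (1 - Q) - (1 - P) = P * (1 - Q) * (P * (1 - Q))ᴴ + E * (1 - P) + (E * (1 - P))ᴴ
      - J - Jᴴ - ((1 - P) * Q) * ((1 - P) * Q)ᴴ := by
    have x1 : P * (1 - Q) * (P * (1 - Q))ᴴ = P * (1 - Q) * P := by
      rw [conjTranspose_mul, hQ1', hP, ← Matrix.mul_assoc, Matrix.mul_assoc P, hQ1]
    have x2 : ((1 - P) * Q) * ((1 - P) * Q)ᴴ = (1 - P) * Q * (1 - P) := by
      rw [conjTranspose_mul, hP1', hQ, ← Matrix.mul_assoc, Matrix.mul_assoc (1 - P), hQQ]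
    have x3 : E * (1 - P) = P * (1 - Q) * (1 - P) + J := by rw [hE, add_mul, hJ1]
    have x4 : (E * (1 - P))ᴴ = (1 - P) * (1 - Q) * P + Jᴴ := by
      rw [x3, conjTranspose_add, conjTranspose_mul, conjTranspose_mul, hP1', hQ1', hP,
        Matrix.mul_assoc]
    rw [x1, x2, x4, x3]
    noncomm_ring
    rw [hPP]
    abel
  have nA : ‖P * (1 - Q) * (P * (1 - Q))ᴴ‖ ≤ θ ^ 2 := by
    refine (frobenius_norm_mul _ _).trans (le_of_eq ?_)
    rw [frobenius_norm_conjTranspose, sq]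
  have nB : ‖((1 - P) * Q) * ((1 - P) * Q)ᴴ‖ ≤ θ ^ 2 := by
    refine (frobenius_norm_mul _ _).trans (le_of_eq ?_)
    rw [frobenius_norm_conjTranspose, hpq, sq]
  have := H σ (‖J‖ / σ) θ ‖E‖ (quadForm (1 - Q) d).re (quadForm ((1 - Q) * B * (1 - Q)) d).re
    (quadForm J d).re (quadForm (Jᴴ * B * J) d).re (if P *ᵥ d = 0 then 0 else 1) hσ hσ1
    (by positivity) (norm_nonneg _) (by rw [← hΦ]; exact p1) (norm_nonneg _)
    (by rw [← hΦ, mul_assoc K₁]; exact p2) (re_quadForm_projection_nonneg hQ1' hQ1 d)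
    ?_ (by split_ifs <;> simp) (by split_ifs <;> simp) ?_ ?_ ?_ ?_
  · refine this.trans (le_of_eq ?_)
    congr 2
    field_simp
  · have : ((1 - Q) * B * (1 - Q)).PosSemidef := by
      have := hB.conjTranspose_mul_mul_same (1 - Q)
      rwa [hQ1'] at this
    have := this.dotProduct_mulVec_nonneg d
    exact (Complex.le_def.1 this).1
  · rw [← Complex.sub_re, ← quadForm_sub]
    refine (abs_re_quadForm_le _ _).trans ?_
    refine mul_le_mul_of_nonneg_left ?_ (sqLen_nonneg d)
    have : (1 - Q) - (1 - P) = P * (1 - Q) - (1 - P) * Q := by noncomm_ring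
    rw [this]
    refine (norm_sub_le _ _).trans ?_
    rw [hpq]; linarith
  -- As `P E = E`, this remainder disappears when `P d = 0`. It is the only error term that is first
  -- order in `E`, and the reason for the indicator in the statement.
  · have hm : |(quadForm (E * (1 - P)) d).re| ≤
        sqLen d * (‖1 - P‖ * ‖E‖ * (if P *ᵥ d = 0 then 0 else 1)) := by
      split_ifs with h0
      · rw [← hPE, Matrix.mul_assoc, quadForm_mul_eq_zero hP h0]; simp
      · refine (abs_re_quadForm_le _ _).trans ?_
        refine mul_le_mul_of_nonneg_left ?_ (sqLen_nonneg d)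
        refine (frobenius_norm_mul _ _).trans ?_
        rw [mul_one, mul_comm]
    have e1 : (quadForm (1 - Q) d).re - (quadForm (1 - P) d).re + 2 * (quadForm J d).re =
        (quadForm (P * (1 - Q) * (P * (1 - Q))ᴴ) d).re + 2 * (quadForm (E * (1 - P)) d).re -
        (quadForm (((1 - P) * Q) * ((1 - P) * Q)ᴴ) d).re := by
      rw [← Complex.sub_re, ← quadForm_sub, d1]
      simp only [quadForm_sub, quadForm_add, quadForm_conjTranspose, Complex.sub_re,
        Complex.add_re, Complex.star_def, Complex.conj_re]
      ring
    have b1 := (abs_re_quadForm_le (P * (1 - Q) * (P * (1 - Q))ᴴ) d).trans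
      (mul_le_mul_of_nonneg_left nA (sqLen_nonneg d))
    have b2 := (abs_re_quadForm_le (((1 - P) * Q) * ((1 - P) * Q)ᴴ) d).trans
      (mul_le_mul_of_nonneg_left nB (sqLen_nonneg d))
    rw [e1]
    rw [abs_le] at b1 b2 hm ⊢
    constructor <;> nlinarith [b1.1, b1.2, b2.1, b2.2, hm.1, hm.2]
  · rw [← Complex.sub_re, ← quadForm_sub]
    refine (abs_re_quadForm_le _ _).trans ?_
    rw [mul_assoc (sqLen d)]
    refine mul_le_mul_of_nonneg_left ?_ (sqLen_nonneg d)
    -- `B = P B P`, so only the block `P (1 - Q) = E - J` contributes to the leaked clutter.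
    have x1 : (1 - Q) * B * (1 - Q) = (E - J)ᴴ * B * (E - J) := by
      rw [← hA, conjTranspose_mul, hQ1', hP]
      conv_lhs => rw [← hBP, ← hPB]
      simp only [Matrix.mul_assoc]
    have x2 : (1 - Q) * B * (1 - Q) - Jᴴ * B * J = Eᴴ * B * E - (Eᴴ * B * J + Jᴴ * B * E) := by
      rw [x1, conjTranspose_sub]; noncomm_ring
    have n3 : ∀ X Y : Matrix (Fin q) (Fin q) ℂ, ‖Xᴴ * B * Y‖ ≤ ‖X‖ * ‖B‖ * ‖Y‖ := fun X Y => by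
      refine (frobenius_norm_mul _ _).trans ?_
      gcongr
      refine (frobenius_norm_mul _ _).trans (le_of_eq ?_)
      rw [frobenius_norm_conjTranspose]
    rw [x2, ← hΦ]
    refine (norm_sub_le _ _).trans ?_
    have := norm_add_le (Eᴴ * B * J) (Jᴴ * B * E)
    linarith [n3 E E, n3 E J, n3 J E]
  · have x1 : (1 - Q) * B * (1 - Q) = (P * (1 - Q))ᴴ * B * (P * (1 - Q)) := by
      rw [conjTranspose_mul, hQ1', hP]
      conv_lhs => rw [← hBP, ← hPB]
      simp only [Matrix.mul_assoc]
    refine (le_abs_self _).trans ((abs_re_quadForm_le _ _).trans ?_)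
    rw [mul_assoc (sqLen d)]
    refine mul_le_mul_of_nonneg_left ?_ (sqLen_nonneg d)
    rw [x1]
    refine (frobenius_norm_mul _ _).trans ?_
    refine (mul_le_mul_of_nonneg_right (frobenius_norm_mul _ _) (norm_nonneg _)).trans
      (le_of_eq ?_)
    rw [frobenius_norm_conjTranspose]; ring

end

end

/-! ### Range projections and the extremal property of principal components. -/

noncomputable section

section

open scoped Matrix.Norms.Frobenius

variable {q : ℕ}

theorem posSemidef_of_projection {P : Matrix (Fin q) (Fin q) ℂ} (hP : Pᴴ = P)
    (hPP : P * P = P) : P.PosSemidef := by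
  have := Matrix.posSemidef_conjTranspose_mul_self P
  rwa [hP, hPP] at this

theorem conj_unitary_mul {V X Y : Matrix (Fin q) (Fin q) ℂ} (hV : Vᴴ * V = 1) :
    (V * X * Vᴴ) * (V * Y * Vᴴ) = V * (X * Y) * Vᴴ := by
  calc _ = V * X * (Vᴴ * V) * Y * Vᴴ := by simp only [Matrix.mul_assoc]
    _ = _ := by rw [hV]; simp only [Matrix.mul_assoc, Matrix.mul_one]

/-- The orthogonal projection onto the range of a positive semidefinite matrix, together with a
generalized inverse. -/
theorem exists_rangeProjection {B : Matrix (Fin q) (Fin q) ℂ} (hB : B.PosSemidef) :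
    ∃ P Bi : Matrix (Fin q) (Fin q) ℂ, Pᴴ = P ∧ P * P = P ∧ P * B = B ∧ B * P = B ∧
      B * Bi = P ∧ P.trace = B.rank := by
  classical
  set V : Matrix (Fin q) (Fin q) ℂ := ↑(hB.1.eigenvectorUnitary) with hV
  set l := hB.1.eigenvalues with hl
  have hVV : Vᴴ * V = 1 := by
    have := (mem_unitaryGroup_iff' (A := V)).1 hB.1.eigenvectorUnitary.2
    simpa [star_eq_conjTranspose] using this
  have hBV : B = V * diagonal (fun i => (l i : ℂ)) * Vᴴ := by
    have := hB.1.spectral_theorem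
    rw [Unitary.conjStarAlgAut_apply] at this
    simpa [star_eq_conjTranspose, Function.comp_def] using this
  set e : Fin q → ℂ := fun i => if l i = 0 then 0 else 1 with he
  -- With `0⁻¹ = 0` on the kernel, inverting the eigenvalues gives the pseudo-inverse.
  refine ⟨V * diagonal e * Vᴴ, V * diagonal (fun i => ((l i)⁻¹ : ℂ)) * Vᴴ, ?_, ?_, ?_, ?_, ?_, ?_⟩
  · simp only [conjTranspose_mul, conjTranspose_conjTranspose, diagonal_conjTranspose,
      Matrix.mul_assoc]
    congr 3
    ext i; simp only [he, Pi.star_apply]; split_ifs <;> simp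
  · rw [conj_unitary_mul hVV, diagonal_mul_diagonal]
    congr 3; ext i; simp only [he]; split_ifs <;> simp
  · conv_lhs => rw [hBV]
    conv_rhs => rw [hBV]
    rw [conj_unitary_mul hVV, diagonal_mul_diagonal]
    congr 3; ext i; simp only [he]; split_ifs with h <;> simp [h]
  · conv_lhs => rw [hBV]
    conv_rhs => rw [hBV]
    rw [conj_unitary_mul hVV, diagonal_mul_diagonal]
    congr 3; ext i; simp only [he]; split_ifs with h <;> simp [h]
  · conv_lhs => rw [hBV]
    rw [conj_unitary_mul hVV, diagonal_mul_diagonal]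
    congr 3; ext i; simp only [he]; split_ifs with h <;> simp [h]
  · rw [Matrix.trace_mul_comm, ← Matrix.mul_assoc, hVV, Matrix.one_mul, trace_diagonal,
      hB.1.rank_eq_card_non_zero_eigs, Fintype.card_subtype]
    simp only [he, ← hl]
    rw [Finset.sum_ite]
    simp

/-- Ky Fan's inequality in scalar form. Against the threshold `μ = l r`, moving weight from the last
indices to the first can only increase the sum; the threshold itself drops out because the total
weights agree. -/
theorem sum_tail_le {q r : ℕ} (hr : r ≤ q) {l w : Fin q → ℝ} (hl : Antitone l)
    (hw0 : ∀ i, 0 ≤ w i) (hw1 : ∀ i, w i ≤ 1) (hw : ∑ i, w i = q - r) :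
    ∑ i : Fin q, (if (i : ℕ) < r then 0 else l i) ≤ ∑ i, l i * w i := by
  have hcard : ∑ i : Fin q, (if (i : ℕ) < r then (0 : ℝ) else 1) = q - r := by
    rw [Fin.sum_univ_eq_sum_range (fun i => if i < r then (0 : ℝ) else 1) q, Finset.sum_ite]
    have : (Finset.range q).filter (fun x => ¬ x < r) = Finset.Ico r q := by
      ext; simp [and_comm]
    rw [this]; simp [Nat.cast_sub hr]
  rcases hr.eq_or_lt with h | h
  · have hw0' : ∀ i, w i = 0 := by
      have : ∑ i, w i = 0 := by rw [hw, h]; ring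
      rw [Finset.sum_eq_zero_iff_of_nonneg (fun i _ => hw0 i)] at this
      exact fun i => this i (Finset.mem_univ i)
    refine le_of_eq (Finset.sum_congr rfl fun i _ => ?_)
    rw [hw0', if_pos (by have := i.2; omega)]; ring
  · set μ := l ⟨r, h⟩
    have key : ∀ i : Fin q, 0 ≤ (l i - μ) * (w i - if (i : ℕ) < r then 0 else 1) := by
      intro i
      split_ifs with hi
      · refine mul_nonneg ?_ (by simpa using hw0 i)
        have : i ≤ ⟨r, h⟩ := hi.le
        linarith [hl this]
      · refine mul_nonneg_of_nonpos_of_nonpos ?_ (by linarith [hw1 i])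
        have : (⟨r, h⟩ : Fin q) ≤ i := by simpa [Fin.le_def] using hi
        linarith [hl this]
    have hsum := Finset.sum_nonneg (fun i (_ : i ∈ Finset.univ) => key i)
    have e : ∑ i : Fin q, (l i - μ) * (w i - if (i : ℕ) < r then 0 else 1) =
        ∑ i, l i * w i - ∑ i : Fin q, (if (i : ℕ) < r then 0 else l i) -
        μ * (∑ i, w i - ∑ i : Fin q, (if (i : ℕ) < r then (0 : ℝ) else 1)) := by
      rw [← Finset.sum_sub_distrib, ← Finset.sum_sub_distrib, Finset.mul_sum,
        ← Finset.sum_sub_distrib]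
      refine Finset.sum_congr rfl fun i _ => ?_
      split_ifs <;> ring
    rw [e, hw, hcard] at hsum
    linarith

/-- The projection onto the first principal components of a positive semidefinite matrix, and the
extremal property of the trace of its complement. -/
theorem IsPrincipalComponents.projection {r : ℕ} {M : Matrix (Fin q) (Fin q) ℂ}
    {U : Matrix (Fin q) (Fin r) ℂ} (hU : IsPrincipalComponents M U) (hM : M.PosSemidef) :
    (U * Uᴴ)ᴴ = U * Uᴴ ∧ U * Uᴴ * (U * Uᴴ) = U * Uᴴ ∧ (U * Uᴴ).trace = r ∧
    M * (U * Uᴴ) = U * Uᴴ * M ∧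
    ∀ P : Matrix (Fin q) (Fin q) ℂ, Pᴴ = P → P * P = P → P.trace = r →
      ‖M * (1 - U * Uᴴ)‖ ≤ (M * (1 - P)).trace.re := by
  obtain ⟨hr, V, hV, l, hl, hMV, hUV⟩ := hU
  have hVV : Vᴴ * V = 1 := by
    simpa [star_eq_conjTranspose] using (mem_unitaryGroup_iff' (A := V)).1 hV
  have hVV' : V * Vᴴ = 1 := by
    simpa [star_eq_conjTranspose] using (mem_unitaryGroup_iff (A := V)).1 hV
  set e : Fin q → ℂ := fun i => if (i : ℕ) < r then 1 else 0 with he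
  have hsum : ∀ f : Fin q → ℂ, ∑ i : Fin q, (if (i : ℕ) < r then f i else 0) =
      ∑ j : Fin r, f (Fin.castLE hr j) := by
    intro f
    rw [← Finset.sum_filter]
    symm
    refine Finset.sum_nbij (Fin.castLE hr) (by simp) ((Fin.castLE_injective hr).injOn) ?_
      (by simp)
    intro i hi
    have hi' : (i : ℕ) < r := by simpa using hi
    exact ⟨⟨i, hi'⟩, by simp, rfl⟩
  have hQ : U * Uᴴ = V * diagonal e * Vᴴ := by
    ext a b
    rw [Matrix.mul_apply, Matrix.mul_apply]
    simp only [mul_diagonal, conjTranspose_apply, hUV, he]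
    rw [← hsum (fun i => V a i * star (V b i))]
    refine Finset.sum_congr rfl fun i _ => ?_
    split_ifs <;> simp
  have h1Q : 1 - U * Uᴴ = V * diagonal (fun i : Fin q => if (i : ℕ) < r then (0 : ℂ) else 1) * Vᴴ := by
    rw [hQ]
    have : (1 : Matrix (Fin q) (Fin q) ℂ) = V * 1 * Vᴴ := by rw [Matrix.mul_one, hVV']
    conv_lhs => rw [this]
    rw [← Matrix.sub_mul, ← Matrix.mul_sub, ← diagonal_one, diagonal_sub]
    congr 3; ext i; simp only [he]; split_ifs <;> simp
  have hl0 : ∀ i, 0 ≤ l i := by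
    intro i
    have h1 : (Vᴴ * M * V).PosSemidef := hM.conjTranspose_mul_mul_same V
    have h2 : Vᴴ * M * V = diagonal (fun i => (l i : ℂ)) := by
      rw [hMV]
      calc _ = (Vᴴ * V) * diagonal (fun i => (l i : ℂ)) * (Vᴴ * V) := by
            simp only [Matrix.mul_assoc]
        _ = _ := by rw [hVV]; simp
    rw [h2] at h1
    have := h1.diag_nonneg (i := i)
    simpa using this
  refine ⟨by simp, ?_, ?_, ?_, ?_⟩
  · rw [hQ, conj_unitary_mul hVV, diagonal_mul_diagonal]
    congr 3; ext i; simp only [he]; split_ifs <;> simp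
  · rw [hQ, Matrix.trace_mul_comm, ← Matrix.mul_assoc, hVV, Matrix.one_mul, trace_diagonal]
    simp only [he]
    rw [hsum (fun _ => 1)]; simp
  · rw [hQ, hMV, conj_unitary_mul hVV, conj_unitary_mul hVV, diagonal_mul_diagonal,
      diagonal_mul_diagonal]
    congr 3; ext i; ring
  · intro P hP hPP hPr
    -- In the eigenbasis of `M` a complementary projection has diagonal entries in `[0, 1]` with sum
    -- `q - r`, exactly the weights of `sum_tail_le`.
    set W := Vᴴ * (1 - P) * V with hW
    have hP1 : (1 - P)ᴴ = 1 - P := by simp [hP]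
    have hPP1 : (1 - P) * (1 - P) = 1 - P := by simp [sub_mul, mul_sub, hPP]
    have hW0 : W.PosSemidef := (posSemidef_of_projection hP1 hPP1).conjTranspose_mul_mul_same V
    have hW1 : (1 - W).PosSemidef := by
      have := (posSemidef_of_projection hP hPP).conjTranspose_mul_mul_same V
      have e1 : 1 - W = Vᴴ * P * V := by
        rw [hW, Matrix.mul_sub, Matrix.sub_mul, Matrix.mul_one, hVV]; abel
      rwa [e1]
    have hd : ∀ i, 0 ≤ (W i i).re := fun i => (Complex.le_def.1 (hW0.diag_nonneg (i := i))).1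
    have hd1 : ∀ i, (W i i).re ≤ 1 := fun i => by
      have := (Complex.le_def.1 (hW1.diag_nonneg (i := i))).1
      simp at this
      linarith
    have htr : ∑ i, (W i i).re = q - r := by
      have : W.trace = q - r := by
        rw [hW, Matrix.trace_mul_comm, ← Matrix.mul_assoc, hVV', Matrix.one_mul, trace_sub, hPr]
        simp
      have := congrArg Complex.re this
      rw [Matrix.trace, Complex.re_sum] at this
      simpa using this
    have hT : (M * (1 - P)).trace.re = ∑ i, l i * (W i i).re := by
      have : (M * (1 - P)).trace = (diagonal (fun i => (l i : ℂ)) * W).trace := by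
        rw [hMV, hW, Matrix.mul_assoc, Matrix.mul_assoc, Matrix.trace_mul_comm]
        simp only [Matrix.mul_assoc]
      rw [this, Matrix.trace, Complex.re_sum]
      simp
    rw [hT]
    refine le_trans ?_ (sum_tail_le hr hl hd hd1 htr)
    set f : Fin q → ℝ := fun i => if (i : ℕ) < r then 0 else l i with hf
    have hf0 : ∀ i, 0 ≤ f i := fun i => by simp only [hf]; split_ifs; exacts [le_rfl, hl0 i]
    have hMQ : M * (1 - U * Uᴴ) = V * diagonal (fun i => (f i : ℂ)) * Vᴴ := by
      rw [h1Q, hMV, conj_unitary_mul hVV, diagonal_mul_diagonal]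
      congr 3; ext i; simp only [hf]; split_ifs <;> simp
    have hn : ‖M * (1 - U * Uᴴ)‖ = ‖diagonal (fun i => (f i : ℂ))‖ := by
      refine frobenius_eq_of_trace ?_
      have : (V * diagonal (fun i => (f i : ℂ)) * Vᴴ)ᴴ =
          V * (diagonal (fun i => (f i : ℂ)))ᴴ * Vᴴ := by
        simp only [conjTranspose_mul, conjTranspose_conjTranspose, Matrix.mul_assoc]
      rw [hMQ, this, conj_unitary_mul hVV, Matrix.trace_mul_comm, ← Matrix.mul_assoc, hVV,
        Matrix.one_mul]
    rw [hn]
    -- For nonnegative eigenvalues the Frobenius norm is at most the trace.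
    refine abs_le_of_sq_le_sq' ?_ (Finset.sum_nonneg fun i _ => hf0 i) |>.2
    rw [frobenius_sq]
    have : ∀ i, ∑ j, ‖diagonal (fun i => (f i : ℂ)) i j‖ ^ 2 = f i ^ 2 := by
      intro i
      rw [Finset.sum_eq_single i]
      · simp
      · intro j _ hj; simp [diagonal_apply_ne' _ hj]
      · simp
    simp only [this]
    exact Finset.sum_sq_le_sq_sum_of_nonneg fun i _ => hf0 i

end

end

/-! ### Kronecker structure and the SINR as a temporal problem. -/

noncomputable section

section

variable {p q : ℕ}

theorem kronecker_mulVec_kronVec (M : Matrix (Fin p) (Fin p) ℂ) (N : Matrix (Fin q) (Fin q) ℂ)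
    (a : Fin p → ℂ) (b : Fin q → ℂ) :
    (M ⊗ₖ N) *ᵥ kronVec a b = kronVec (M *ᵥ a) (N *ᵥ b) := by
  ext x
  simp only [mulVec, dotProduct, kronVec, kroneckerMap_apply, Fintype.sum_prod_type,
    Finset.sum_mul_sum]
  refine Finset.sum_congr rfl fun i _ => Finset.sum_congr rfl fun j _ => by ring

theorem star_kronVec_dotProduct (a a' : Fin p → ℂ) (b b' : Fin q → ℂ) :
    star (kronVec a b) ⬝ᵥ kronVec a' b' = (star a ⬝ᵥ a') * (star b ⬝ᵥ b') := by
  simp only [dotProduct, kronVec, Fintype.sum_prod_type, Finset.sum_mul_sum, Pi.star_apply,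
    star_mul']
  refine Finset.sum_congr rfl fun i _ => Finset.sum_congr rfl fun j _ => by ring

theorem sqLen_kronVec (a : Fin p → ℂ) (b : Fin q → ℂ) :
    sqLen (kronVec a b) = sqLen a * sqLen b := by
  simp only [sqLen, kronVec, Fintype.sum_prod_type, Finset.sum_mul_sum, norm_mul, mul_pow]

theorem quadForm_im_of_isHermitian {M : Matrix (Fin q) (Fin q) ℂ} (hM : M.IsHermitian)
    (v : Fin q → ℂ) : (quadForm M v).im = 0 := by
  have := quadForm_conjTranspose M v
  rw [hM.eq] at this
  exact Complex.conj_eq_iff_im.1 this.symm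

theorem hermForm_nonneg {M : Matrix (Fin q) (Fin q) ℂ} (hM : M.PosSemidef)
    (v : Fin q → ℂ) : 0 ≤ hermForm M v :=
  (Complex.le_def.1 (hM.dotProduct_mulVec_nonneg v)).1

theorem hermForm_kronecker {A : Matrix (Fin p) (Fin p) ℂ} {B : Matrix (Fin q) (Fin q) ℂ}
    (hA : A.PosSemidef) (a : Fin p → ℂ) (b : Fin q → ℂ) :
    hermForm (A ⊗ₖ B) (kronVec a b) = hermForm A a * hermForm B b := by
  rw [hermForm, kronecker_mulVec_kronVec, star_kronVec_dotProduct]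
  have : (star a ⬝ᵥ A *ᵥ a).im = 0 := quadForm_im_of_isHermitian hA.1 a
  rw [Complex.mul_re, this]; simp [hermForm]

theorem hermForm_clutterNoiseCov {A : Matrix (Fin p) (Fin p) ℂ} {B : Matrix (Fin q) (Fin q) ℂ}
    (hA : A.PosSemidef) (E σ : ℝ) (a : Fin p → ℂ) (b : Fin q → ℂ) :
    hermForm (clutterNoiseCov E (A ⊗ₖ B) σ) (kronVec a b) =
      E * (hermForm A a * hermForm B b) + σ ^ 2 * (sqLen a * sqLen b) := by
  rw [← hermForm_kronecker hA, ← sqLen_kronVec]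
  simp only [hermForm, clutterNoiseCov, add_mulVec, smul_mulVec, one_mulVec, dotProduct_add,
    dotProduct_smul, star_dotProduct_self_eq_sqLen, smul_eq_mul]
  rw [Complex.add_re, Complex.re_ofReal_mul, ← Complex.ofReal_pow, ← Complex.ofReal_mul,
    Complex.ofReal_re]

theorem twoStageFilter_kronVec (h : Fin p → ℂ) (F : Matrix (Fin q) (Fin q) ℂ) (dA : Fin p → ℂ)
    (dB : Fin q → ℂ) :
    twoStageFilter h F (kronVec dA dB) = kronVec (spatialProj h *ᵥ dA) (F *ᵥ dB) := by
  rw [twoStageFilter, ← mulVec_mulVec, kronecker_mulVec_kronVec, kronecker_mulVec_kronVec]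
  simp

theorem sqLen_eq_norm_sq {ι : Type*} [Fintype ι] (v : ι → ℂ) : sqLen v = ‖WithLp.toLp 2 v‖ ^ 2 := by
  rw [EuclideanSpace.norm_sq_eq]; rfl

theorem sqLen_pos {ι : Type*} [Fintype ι] {v : ι → ℂ} (hv : v ≠ 0) : 0 < sqLen v := by
  rw [sqLen_eq_norm_sq]
  have : WithLp.toLp 2 v ≠ 0 := by simpa using hv
  positivity

theorem spatialProj_conjTranspose (h : Fin p → ℂ) : (spatialProj h)ᴴ = spatialProj h := by
  simp [spatialProj, conjTranspose_vecMulVec]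

theorem spatialProj_mul_self {h : Fin p → ℂ} (hh : sqLen h = 1) :
    spatialProj h * spatialProj h = spatialProj h := by
  have : vecMulVec h (star h) * vecMulVec h (star h) = vecMulVec h (star h) := by
    rw [vecMulVec_mul_vecMulVec, star_dotProduct_self_eq_sqLen, hh]; simp
  simp [spatialProj, sub_mul, mul_sub, this]

theorem hermForm_normalizedResidual (A : Matrix (Fin p) (Fin p) ℂ) (h dA : Fin p → ℂ) :
    hermForm A (normalizedResidual h dA) =
      hermForm A (spatialProj h *ᵥ dA) / sqLen (spatialProj h *ᵥ dA) := by
  rw [sqLen_eq_norm_sq, normalizedResidual, hermForm, mulVec_smul, dotProduct_smul, star_smul,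
    smul_dotProduct, smul_eq_mul, smul_eq_mul, Complex.star_def, Complex.conj_ofReal,
    ← mul_assoc, ← Complex.ofReal_mul, Complex.re_ofReal_mul, hermForm]
  field_simp

/-- The signal-to-noise ratio of the temporal weight `u`, up to a constant factor. -/
def temporalSinr (η σ : ℝ) (B : Matrix (Fin q) (Fin q) ℂ) (d u : Fin q → ℂ) : ℝ :=
  ‖star u ⬝ᵥ d‖ ^ 2 / (η * hermForm B u + σ ^ 2 * sqLen u)

/-- The filter is `g ⊗ F d_B` with `g = (I - h hᴴ) d_A`, and `gᴴ d_A = ‖g‖²`. Dividing numerator and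
denominator by `‖g‖²` leaves the clutter power seen through the unit vector along `g`. -/
theorem sinr_twoStageFilter {A : Matrix (Fin p) (Fin p) ℂ} {B : Matrix (Fin q) (Fin q) ℂ}
    (hA : A.PosSemidef) {h : Fin p → ℂ} (hh : sqLen h = 1) {dA : Fin p → ℂ}
    (hdA : spatialProj h *ᵥ dA ≠ 0) (dB : Fin q → ℂ) (α : ℂ) (E σ : ℝ)
    (F : Matrix (Fin q) (Fin q) ℂ) :
    sinr α (clutterNoiseCov E (A ⊗ₖ B) σ) (kronVec dA dB) (twoStageFilter h F (kronVec dA dB)) =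
      ‖α‖ ^ 2 * sqLen (spatialProj h *ᵥ dA) *
        temporalSinr (E * hermForm A (normalizedResidual h dA)) σ B dB (F *ᵥ dB) := by
  have hg := sqLen_pos hdA
  have e1 : star (spatialProj h *ᵥ dA) ⬝ᵥ dA = (sqLen (spatialProj h *ᵥ dA) : ℂ) := by
    rw [← star_dotProduct_self_eq_sqLen (spatialProj h *ᵥ dA), ← quadForm_conjTranspose_mul,
      spatialProj_conjTranspose, spatialProj_mul_self hh, quadForm, star_mulVec,
      spatialProj_conjTranspose, ← dotProduct_mulVec]
  rw [sinr, twoStageFilter_kronVec, star_kronVec_dotProduct, hermForm_clutterNoiseCov hA, e1,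
    temporalSinr, hermForm_normalizedResidual, norm_mul, Complex.norm_real,
    Real.norm_of_nonneg hg.le]
  generalize sqLen (spatialProj h *ᵥ dA) = g at *
  have : E * (hermForm A (spatialProj h *ᵥ dA) * hermForm B (F *ᵥ dB)) +
      σ ^ 2 * (g * sqLen (F *ᵥ dB)) = g * (E * (hermForm A (spatialProj h *ᵥ dA) / g) *
        hermForm B (F *ᵥ dB) + σ ^ 2 * sqLen (F *ᵥ dB)) := by field_simp
  rw [this, mul_pow, sq g]
  field_simp

theorem temporalSinr_nonneg {B : Matrix (Fin q) (Fin q) ℂ} (hB : B.PosSemidef) {η : ℝ}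
    (hη : 0 ≤ η) (σ : ℝ) (d u : Fin q → ℂ) : 0 ≤ temporalSinr η σ B d u := by
  have := hermForm_nonneg hB u
  have := sqLen_nonneg u
  unfold temporalSinr; positivity

theorem temporalSinr_le {B : Matrix (Fin q) (Fin q) ℂ} (hB : B.PosSemidef) {η : ℝ}
    (hη : 0 ≤ η) {σ : ℝ} (hσ : 0 < σ) (d u : Fin q → ℂ) :
    temporalSinr η σ B d u ≤ sqLen d / σ ^ 2 := by
  have := hermForm_nonneg hB u
  have h1 := sqLen_nonneg u
  have h2 := sqLen_nonneg d
  refine div_le_of_le_mul₀ (by positivity) (by positivity) ?_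
  refine (norm_star_dotProduct_sq_le u d).trans ?_
  calc sqLen u * sqLen d = sqLen d / σ ^ 2 * (0 + σ ^ 2 * sqLen u) := by field_simp; ring
    _ ≤ _ := by gcongr; positivity

/-- Needed to compare with the supremum, because a real supremum over an unbounded set is `0` by
convention. -/
theorem bddAbove_temporalSinr {B : Matrix (Fin q) (Fin q) ℂ} (hB : B.PosSemidef) {η : ℝ}
    (hη : 0 ≤ η) {σ : ℝ} (hσ : 0 < σ) (d : Fin q → ℂ) :
    BddAbove (Set.range fun F : Matrix (Fin q) (Fin q) ℂ => temporalSinr η σ B d (F *ᵥ d)) :=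
  ⟨_, by rintro _ ⟨F, rfl⟩; exact temporalSinr_le hB hη hσ d _⟩

theorem sinrLoss_eq_div {r : ℕ} {A : Matrix (Fin p) (Fin p) ℂ} {B : Matrix (Fin q) (Fin q) ℂ}
    (hA : A.PosSemidef) {h : Fin p → ℂ} (hh : sqLen h = 1) {dA : Fin p → ℂ}
    (hdA : spatialProj h *ᵥ dA ≠ 0) (dB : Fin q → ℂ) {α : ℂ} (hα : α ≠ 0) (E σ : ℝ)
    (U : Matrix (Fin q) (Fin r) ℂ) :
    sinrLoss α (clutterNoiseCov E (A ⊗ₖ B) σ) h (kronVec dA dB) U =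
      temporalSinr (E * hermForm A (normalizedResidual h dA)) σ B dB ((1 - U * Uᴴ) *ᵥ dB) /
      ⨆ F : Matrix (Fin q) (Fin q) ℂ,
        temporalSinr (E * hermForm A (normalizedResidual h dA)) σ B dB (F *ᵥ dB) := by
  have hg := sqLen_pos hdA
  have hα' : 0 < ‖α‖ := norm_pos_iff.2 hα
  rw [sinrLoss, sinrMax]
  simp only [sinr_twoStageFilter hA hh hdA]
  rw [← Real.mul_iSup_of_nonneg (by positivity), mul_div_mul_left _ _ (by positivity)]

theorem sinrLoss_mem_Icc {r : ℕ} {A : Matrix (Fin p) (Fin p) ℂ} {B : Matrix (Fin q) (Fin q) ℂ}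
    (hA : A.PosSemidef) (hB : B.PosSemidef) {h : Fin p → ℂ} (hh : sqLen h = 1) {dA : Fin p → ℂ}
    (hdA : spatialProj h *ᵥ dA ≠ 0) (dB : Fin q → ℂ) {α : ℂ} (hα : α ≠ 0) {E σ : ℝ}
    (hE : 0 ≤ E) (hσ : 0 < σ) (U : Matrix (Fin q) (Fin r) ℂ) :
    sinrLoss α (clutterNoiseCov E (A ⊗ₖ B) σ) h (kronVec dA dB) U ∈ Set.Icc 0 1 := by
  have hη : 0 ≤ E * hermForm A (normalizedResidual h dA) :=
    mul_nonneg hE (hermForm_nonneg hA _)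
  rw [sinrLoss_eq_div hA hh hdA dB hα]
  have h1 := le_ciSup (bddAbove_temporalSinr hB hη hσ dB) (1 - U * Uᴴ)
  have h0 := temporalSinr_nonneg hB hη σ dB ((1 - U * Uᴴ) *ᵥ dB)
  exact ⟨div_nonneg h0 (h0.trans h1), div_le_one_of_le₀ h1 (h0.trans h1)⟩

/-- Cauchy–Schwarz for two summands bounded separately; the cross term is handled by the
arithmetic–geometric mean inequality. -/
theorem mul_sq_cauchy {x y p₁ p₂ q₁ q₂ : ℝ} (hp₁ : 0 ≤ p₁) (hp₂ : 0 ≤ p₂)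
    (hq₁ : 0 ≤ q₁) (hq₂ : 0 ≤ q₂) (hx : x ^ 2 ≤ p₁ * q₁) (hy : y ^ 2 ≤ p₂ * q₂) :
    (x + y) ^ 2 ≤ (p₁ + p₂) * (q₁ + q₂) := by
  have h1 : (x * y) ^ 2 ≤ (p₁ * q₂) * (p₂ * q₁) := by
    calc (x * y) ^ 2 = x ^ 2 * y ^ 2 := by ring
      _ ≤ (p₁ * q₁) * (p₂ * q₂) := by gcongr
      _ = _ := by ring
  have a1 : 0 ≤ p₁ * q₂ := by positivity
  have a2 : 0 ≤ p₂ * q₁ := by positivity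
  have h2 : 2 * (x * y) ≤ p₁ * q₂ + p₂ * q₁ := by
    refine (abs_le_of_sq_le_sq' ?_ (by positivity)).2
    nlinarith [sq_nonneg (p₁ * q₂ - p₂ * q₁)]
  nlinarith

/-- Split `d` into its parts outside and inside the range of `B`. The outer part is paired with the
noise energy of `u`; the inner part is `B Bi d`, hence is paired with the clutter energy. The inner
part costs only a constant independent of `σ`. If `P d = 0` the case `η = 0` is admitted, since
division by zero then meets the factor `0`. -/
theorem temporalSinr_le_of_projection {P B Bi : Matrix (Fin q) (Fin q) ℂ} (hP : Pᴴ = P)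
    (hPP : P * P = P) (hB : B.PosSemidef) (hBi : B * Bi = P) (d : Fin q → ℂ) {η : ℝ}
    (hη : 0 ≤ η) (hd : 0 < η ∨ P *ᵥ d = 0) :
    ∃ c, 0 ≤ c ∧ ∀ σ, 0 < σ → ∀ u, temporalSinr η σ B d u ≤
      (quadForm (1 - P) d).re / σ ^ 2 + c * (if P *ᵥ d = 0 then 0 else 1) := by
  obtain ⟨C₀, hC₀⟩ : ∃ C₀ : Matrix (Fin q) (Fin q) ℂ, B = C₀ᴴ * C₀ := by
    open scoped MatrixOrder Matrix.Norms.L2Operator in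
    obtain ⟨C₀, hC₀⟩ := CStarAlgebra.nonneg_iff_eq_star_mul_self.1 (nonneg_iff_posSemidef.2 hB)
    exact ⟨C₀, hC₀⟩
  have hP1 : (1 - P)ᴴ = 1 - P := by simp [hP]
  have hPP1 : (1 - P) * (1 - P) = 1 - P := by simp [sub_mul, mul_sub, hPP]
  have ht : (quadForm (1 - P) d).re = sqLen ((1 - P) *ᵥ d) := by
    rw [sqLen_mulVec_of_projection hP1 hPP1]; simp
  have hsplit : ∀ u, star u ⬝ᵥ d = star u ⬝ᵥ ((1 - P) *ᵥ d) + star u ⬝ᵥ (P *ᵥ d) := by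
    intro u; rw [← dotProduct_add, ← add_mulVec]; simp
  have hx : ∀ u, ‖star u ⬝ᵥ ((1 - P) *ᵥ d)‖ ^ 2 ≤ sqLen u * sqLen ((1 - P) *ᵥ d) :=
    fun u => norm_star_dotProduct_sq_le _ _
  have hc0 := sqLen_nonneg (C₀ *ᵥ Bi *ᵥ d)
  have ht0 := sqLen_nonneg ((1 - P) *ᵥ d)
  refine ⟨sqLen (C₀ *ᵥ Bi *ᵥ d) / η, by positivity, fun σ hσ u => ?_⟩
  have hBu := hermForm_nonneg hB u
  have hu := sqLen_nonneg u
  have hBu' : hermForm B u = sqLen (C₀ *ᵥ u) := by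
    rw [hermForm_eq_re_quadForm, hC₀, quadForm_conjTranspose_mul, star_dotProduct_self_eq_sqLen]
    simp
  rw [ht]
  by_cases h0 : P *ᵥ d = 0
  · rw [if_pos h0, mul_zero, add_zero]
    refine div_le_of_le_mul₀ (by positivity) (by positivity) ?_
    rw [hsplit, h0, dotProduct_zero, add_zero]
    refine (hx u).trans ?_
    calc _ = sqLen ((1 - P) *ᵥ d) / σ ^ 2 * (0 + σ ^ 2 * sqLen u) := by field_simp; ring
      _ ≤ _ := by gcongr; positivity
  · rw [if_neg h0, mul_one]
    have hη' : 0 < η := hd.resolve_right h0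
    refine div_le_of_le_mul₀ (by positivity) (by positivity) ?_
    have hy : ‖star u ⬝ᵥ (P *ᵥ d)‖ ^ 2 ≤ sqLen (C₀ *ᵥ u) * sqLen (C₀ *ᵥ Bi *ᵥ d) := by
      have : star u ⬝ᵥ (P *ᵥ d) = star (C₀ *ᵥ u) ⬝ᵥ (C₀ *ᵥ Bi *ᵥ d) := by
        rw [star_mulVec, ← dotProduct_mulVec, mulVec_mulVec, mulVec_mulVec, ← hBi, hC₀,
          Matrix.mul_assoc]
      rw [this]; exact norm_star_dotProduct_sq_le _ _
    rw [hsplit]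
    calc _ ≤ (‖star u ⬝ᵥ ((1 - P) *ᵥ d)‖ + ‖star u ⬝ᵥ (P *ᵥ d)‖) ^ 2 := by
          gcongr; exact norm_add_le _ _
      _ ≤ (σ ^ 2 * sqLen u + η * hermForm B u) *
          (sqLen ((1 - P) *ᵥ d) / σ ^ 2 + sqLen (C₀ *ᵥ Bi *ᵥ d) / η) := by
          refine mul_sq_cauchy (by positivity) (by positivity) (by positivity) (by positivity)
            ((hx u).trans (le_of_eq ?_)) (hy.trans (le_of_eq ?_))
          · field_simp
          · rw [hBu']; field_simp
      _ = _ := by ring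

theorem hermForm_projection_mulVec {Q : Matrix (Fin q) (Fin q) ℂ} (hQ : Qᴴ = Q)
    (B : Matrix (Fin q) (Fin q) ℂ) (d : Fin q → ℂ) :
    hermForm B (Q *ᵥ d) = (quadForm (Q * B * Q) d).re := by
  rw [hermForm, star_mulVec, ← dotProduct_mulVec, mulVec_mulVec, mulVec_mulVec, hQ, quadForm,
    Matrix.mul_assoc]

theorem temporalSinr_projection {Q : Matrix (Fin q) (Fin q) ℂ} (hQ : Qᴴ = Q) (hQQ : Q * Q = Q)
    (B : Matrix (Fin q) (Fin q) ℂ) (d : Fin q → ℂ) (η σ : ℝ) :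
    temporalSinr η σ B d (Q *ᵥ d) = (quadForm Q d).re ^ 2 /
      (η * (quadForm (Q * B * Q) d).re + σ ^ 2 * (quadForm Q d).re) := by
  have h1 : star (Q *ᵥ d) ⬝ᵥ d = quadForm Q d := by
    rw [star_mulVec, ← dotProduct_mulVec, hQ, quadForm]
  have h2 := sqLen_mulVec_of_projection hQ hQQ d
  have h3 : sqLen (Q *ᵥ d) = (quadForm Q d).re := by rw [h2]; simp
  have h4 : ‖quadForm Q d‖ = |(quadForm Q d).re| := by
    rw [h2, Complex.norm_real, Complex.ofReal_re, Real.norm_eq_abs]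
  rw [temporalSinr, h1, hermForm_projection_mulVec hQ, h3, h4, sq_abs]

/-- The SINR loss of a projection is, up to a factor that is `1 + O(σ²)`, its normalized signal
loss. -/
theorem sinrLoss_eq_mul {r : ℕ} {A : Matrix (Fin p) (Fin p) ℂ} {P B Bi : Matrix (Fin q) (Fin q) ℂ}
    (hA : A.PosSemidef) (hB : B.PosSemidef) (hP : Pᴴ = P)
    (hPP : P * P = P) (hBi : B * Bi = P) (hBP : B * P = B) {h : Fin p → ℂ} (hh : sqLen h = 1)
    {dA : Fin p → ℂ} (hdA : spatialProj h *ᵥ dA ≠ 0) {d : Fin q → ℂ}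
    (hd : 0 < (quadForm (1 - P) d).re) {α : ℂ} (hα : α ≠ 0) {E η : ℝ} (hη : 0 ≤ η)
    (hηd : 0 < η ∨ P *ᵥ d = 0) (hηE : E * hermForm A (normalizedResidual h dA) = η) :
    ∃ C, 0 ≤ C ∧ ∀ σ, 0 < σ → ∃ γ, 0 ≤ γ ∧ γ ≤ 1 ∧
      1 - γ ≤ C * (if P *ᵥ d = 0 then 0 else 1) * σ ^ 2 ∧
      ∀ U : Matrix (Fin q) (Fin r) ℂ, U * Uᴴ * (U * Uᴴ) = U * Uᴴ →
        sinrLoss α (clutterNoiseCov E (A ⊗ₖ B) σ) h (kronVec dA d) U =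
          γ * ((quadForm (1 - U * Uᴴ) d).re ^ 2 /
            ((η / σ ^ 2 * (quadForm ((1 - U * Uᴴ) * B * (1 - U * Uᴴ)) d).re +
              (quadForm (1 - U * Uᴴ) d).re) * (quadForm (1 - P) d).re)) := by
  obtain ⟨c, hc, H⟩ := temporalSinr_le_of_projection hP hPP hB hBi d hη hηd
  have hP1 : (1 - P)ᴴ = 1 - P := by simp [hP]
  have hPP1 : (1 - P) * (1 - P) = 1 - P := by simp [sub_mul, mul_sub, hPP]
  refine ⟨c / (quadForm (1 - P) d).re, by positivity, fun σ hσ => ?_⟩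
  set t := (quadForm (1 - P) d).re with ht
  set D := ⨆ F : Matrix (Fin q) (Fin q) ℂ, temporalSinr η σ B d (F *ᵥ d) with hD
  set m : ℝ := if P *ᵥ d = 0 then 0 else 1 with hm
  have hm0 : 0 ≤ m := by rw [hm]; split_ifs <;> simp
  -- The ideal filter `1 - P` annihilates the clutter and bounds the optimum from below.
  have hD1 : t / σ ^ 2 ≤ D := by
    refine le_trans (le_of_eq ?_) (le_ciSup (bddAbove_temporalSinr hB hη hσ d) (1 - P))
    rw [temporalSinr_projection hP1 hPP1, mul_assoc (1 - P), show B * (1 - P) = 0 by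
      rw [mul_sub, hBP, mul_one, sub_self], mul_zero, ← ht]
    simp only [quadForm, zero_mulVec, dotProduct_zero, Complex.zero_re, mul_zero, zero_add]
    field_simp
  have hD2 : D ≤ t / σ ^ 2 + c * m := ciSup_le fun F => H σ hσ _
  have hDpos : 0 < D := lt_of_lt_of_le (by positivity) hD1
  -- `γ` is the SINR of the ideal filter `1 - P` divided by the optimal one.
  refine ⟨t / σ ^ 2 / D, by positivity, div_le_one_of_le₀ hD1 hDpos.le, ?_, ?_⟩
  · rw [one_sub_div hDpos.ne', div_le_iff₀ hDpos]
    calc D - t / σ ^ 2 ≤ c * m := by linarith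
      _ = c / t * m * σ ^ 2 * (t / σ ^ 2) := by field_simp
      _ ≤ _ := by gcongr
  · intro U hU
    have hQ1 : (1 - U * Uᴴ)ᴴ = 1 - U * Uᴴ := by simp
    have hQQ1 : (1 - U * Uᴴ) * (1 - U * Uᴴ) = 1 - U * Uᴴ := by simp [sub_mul, mul_sub, hU]
    rw [sinrLoss_eq_div hA hh hdA d hα, hηE, ← hD, temporalSinr_projection hQ1 hQQ1]
    generalize (quadForm (1 - U * Uᴴ) d).re = s
    generalize (quadForm ((1 - U * Uᴴ) * B * (1 - U * Uᴴ)) d).re = β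
    have : η * β + σ ^ 2 * s = σ ^ 2 * (η / σ ^ 2 * β + s) := by field_simp
    rw [this]
    field_simp

end

end

/-! ### Moments of sums of independent centred variables. -/

noncomputable section

section

variable {Ω : Type*} [MeasurableSpace Ω] {P : Measure Ω}

theorem integral_conj_mul_of_indep {W : ℕ → Ω → ℂ} (hind : iIndepFun W P)
    (hmeas : ∀ m, Measurable (W m)) (h0 : ∀ m, ∫ ω, W m ω ∂P = 0) {m l : ℕ} (hml : m ≠ l) :
    ∫ ω, star (W m ω) * W l ω ∂P = 0 := by
  have h : IndepFun (fun ω => star (W m ω)) (W l) P :=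
    (hind.indepFun hml).comp (φ := star) (ψ := id) (by fun_prop) measurable_id
  rw [h.integral_fun_mul_eq_mul_integral (by fun_prop) (hmeas l).aestronglyMeasurable, h0 l,
    mul_zero]

variable [IsProbabilityMeasure P]

theorem integrable_pow_of_memLp_four {X : Ω → ℝ} (hX : MemLp X 4 P) {k : ℕ} (hk : k ≤ 4) :
    Integrable (fun ω => X ω ^ k) P := by
  have h : MemLp X (k : ENNReal) P := hX.mono_exponent (by exact_mod_cast hk)
  have := h.integrable_norm_pow'
  refine (integrable_norm_iff (hX.1.pow k)).1 ?_
  simpa [norm_pow] using this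

/-- The variance of `X ^ 2` is nonnegative. -/
theorem integral_sq_le_of_integral_pow_four_le {X : Ω → ℝ} (hX : MemLp X 4 P) {v : ℝ} (hv : 0 ≤ v)
    (h : ∫ ω, X ω ^ 4 ∂P ≤ v ^ 2) : ∫ ω, X ω ^ 2 ∂P ≤ v := by
  set m := ∫ ω, X ω ^ 2 ∂P with hm
  have h2 := integrable_pow_of_memLp_four hX (k := 2) (by norm_num)
  have h4 := integrable_pow_of_memLp_four hX (k := 4) le_rfl
  have : 0 ≤ ∫ ω, (X ω ^ 2 - m) ^ 2 ∂P := integral_nonneg fun ω => sq_nonneg _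
  have e : ∀ ω, (X ω ^ 2 - m) ^ 2 = X ω ^ 4 + (-2 * m * X ω ^ 2 + m ^ 2) := fun ω => by ring
  simp only [e] at this
  have j1 := (h2.const_mul (-2 * m)).add (integrable_const (μ := P) (m ^ 2))
  have e1 := integral_add h4 j1
  have e2 := integral_add (h2.const_mul (-2 * m)) (integrable_const (μ := P) (m ^ 2))
  simp only [Pi.add_apply] at e1 e2
  rw [e1, e2, integral_const_mul, ← hm] at this
  simp at this
  exact (abs_le_of_sq_le_sq' (by nlinarith) hv).2

/-- In the induction the terms with a single power of `X n` or of the earlier sum vanish. What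
remains is at most `3 V² + 6 V v + v²`, which is below `3 (V + v)²`. -/
theorem integral_sum_pow_four_le {X : ℕ → Ω → ℝ} (hind : iIndepFun X P)
    (hmeas : ∀ m, Measurable (X m)) (hX : ∀ m, MemLp (X m) 4 P) (hX0 : ∀ m, ∫ ω, X m ω ∂P = 0)
    {v : ℕ → ℝ} (hv : ∀ m, 0 ≤ v m) (hXv : ∀ m, ∫ ω, X m ω ^ 4 ∂P ≤ v m ^ 2) (n : ℕ) :
    MemLp (fun ω => ∑ m ∈ Finset.range n, X m ω) 4 P ∧
    ∫ ω, (∑ m ∈ Finset.range n, X m ω) ∂P = 0 ∧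
    ∫ ω, (∑ m ∈ Finset.range n, X m ω) ^ 2 ∂P ≤ ∑ m ∈ Finset.range n, v m ∧
    ∫ ω, (∑ m ∈ Finset.range n, X m ω) ^ 4 ∂P ≤ 3 * (∑ m ∈ Finset.range n, v m) ^ 2 := by
  induction n with
  | zero => simp
  | succ n ih =>
    obtain ⟨i1, i2, i3, i4⟩ := ih
    set S : Ω → ℝ := fun ω => ∑ m ∈ Finset.range n, X m ω with hS
    set V := ∑ m ∈ Finset.range n, v m with hV
    have hV0 : 0 ≤ V := Finset.sum_nonneg fun m _ => hv m
    have hSX : IndepFun S (X n) P := by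
      have := hind.indepFun_sum_range_succ hmeas n
      convert this using 1
      ext ω; simp [hS]
    simp only [Finset.sum_range_succ]
    change MemLp (fun ω => S ω + X n ω) 4 P ∧ ∫ ω, S ω + X n ω ∂P = 0 ∧
      ∫ ω, (S ω + X n ω) ^ 2 ∂P ≤ V + v n ∧ ∫ ω, (S ω + X n ω) ^ 4 ∂P ≤ 3 * (V + v n) ^ 2
    have iS := fun k (hk : k ≤ 4) => integrable_pow_of_memLp_four i1 hk
    have iX := fun k (hk : k ≤ 4) => integrable_pow_of_memLp_four (hX n) hk
    have hp : ∀ j k, IndepFun (fun ω => S ω ^ j) (fun ω => X n ω ^ k) P := fun j k =>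
      hSX.comp (measurable_id.pow_const j) (measurable_id.pow_const k)
    have im : ∀ j k, j ≤ 4 → k ≤ 4 → Integrable (fun ω => S ω ^ j * X n ω ^ k) P :=
      fun j k hj hk => (hp j k).integrable_mul (iS j hj) (iX k hk)
    have em : ∀ j k, j ≤ 4 → k ≤ 4 →
        ∫ ω, S ω ^ j * X n ω ^ k ∂P = (∫ ω, S ω ^ j ∂P) * ∫ ω, X n ω ^ k ∂P :=
      fun j k hj hk => (hp j k).integral_fun_mul_eq_mul_integral (iS j hj).1 (iX k hk).1
    have x2 := integral_sq_le_of_integral_pow_four_le (hX n) (hv n) (hXv n)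
    have s2 : 0 ≤ ∫ ω, S ω ^ 2 ∂P := integral_nonneg fun ω => sq_nonneg _
    have hS1 : ∫ ω, S ω ^ 1 ∂P = 0 := by simpa using i2
    have hX1 : ∫ ω, X n ω ^ 1 ∂P = 0 := by simpa using hX0 n
    refine ⟨i1.add (hX n), ?_, ?_, ?_⟩
    · have a := iS 1 (by norm_num)
      have b := iX 1 (by norm_num)
      simp only [pow_one] at a b
      rw [integral_add a b, hX0]; simpa using i2
    · have e : ∀ ω, (S ω + X n ω) ^ 2 = S ω ^ 2 + (2 * (S ω ^ 1 * X n ω ^ 1) + X n ω ^ 2) :=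
        fun ω => by ring
      simp only [e]
      have j1 := (im 1 1 (by norm_num) (by norm_num)).const_mul 2
      have j2 := j1.add (iX 2 (by norm_num))
      have e1 := integral_add (iS 2 (by norm_num)) j2
      have e2 := integral_add j1 (iX 2 (by norm_num))
      simp only [Pi.add_apply] at e1 e2
      rw [e1, e2, integral_const_mul,
        em 1 1 (by norm_num) (by norm_num), hS1]
      linarith
    · have e : ∀ ω, (S ω + X n ω) ^ 4 = S ω ^ 4 + (4 * (S ω ^ 3 * X n ω ^ 1) +
          (6 * (S ω ^ 2 * X n ω ^ 2) + (4 * (S ω ^ 1 * X n ω ^ 3) + X n ω ^ 4))) :=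
        fun ω => by ring
      simp only [e]
      have j1 := iX 4 le_rfl
      have j2 := ((im 1 3 (by norm_num) (by norm_num)).const_mul 4).add j1
      have j3 := ((im 2 2 (by norm_num) (by norm_num)).const_mul 6).add j2
      have j4 := ((im 3 1 (by norm_num) (by norm_num)).const_mul 4).add j3
      have e1 := integral_add (iS 4 le_rfl) j4
      have e2 := integral_add ((im 3 1 (by norm_num) (by norm_num)).const_mul 4) j3
      have e3 := integral_add ((im 2 2 (by norm_num) (by norm_num)).const_mul 6) j2
      have e4 := integral_add ((im 1 3 (by norm_num) (by norm_num)).const_mul 4) j1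
      simp only [Pi.add_apply] at e1 e2 e3 e4
      rw [e1, e2, e3, e4, integral_const_mul, integral_const_mul, integral_const_mul,
        em 3 1 (by norm_num) (by norm_num), em 2 2 (by norm_num) (by norm_num),
        em 1 3 (by norm_num) (by norm_num), hS1, hX1]
      have q : (∫ ω, S ω ^ 2 ∂P) * ∫ ω, X n ω ^ 2 ∂P ≤ V * v n :=
        mul_le_mul i3 x2 (integral_nonneg fun ω => sq_nonneg _) hV0
      have := hXv n
      have := sq_nonneg (v n)
      nlinarith

/-- A fourth-moment Chebyshev inequality for sample means. -/
theorem measure_sum_ge_le {X : ℕ → Ω → ℝ} (hind : iIndepFun X P)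
    (hmeas : ∀ m, Measurable (X m)) (hX : ∀ m, MemLp (X m) 4 P) (hX0 : ∀ m, ∫ ω, X m ω ∂P = 0)
    {v : ℝ} (hv : 0 ≤ v) (hXv : ∀ m, ∫ ω, X m ω ^ 4 ∂P ≤ v ^ 2) {ε : ℝ} (hε : 0 < ε) {n : ℕ}
    (hn : 0 < n) :
    P.real {ω | ε ≤ |(n : ℝ)⁻¹ * ∑ m ∈ Finset.range n, X m ω|} ≤ 3 * v ^ 2 / ε ^ 4 / n ^ 2 := by
  obtain ⟨h1, -, -, h4⟩ := integral_sum_pow_four_le hind hmeas hX hX0 (fun _ => hv) hXv n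
  have hn' : (0 : ℝ) < n := by exact_mod_cast hn
  have hset : {ω | ε ≤ |(n : ℝ)⁻¹ * ∑ m ∈ Finset.range n, X m ω|} ⊆
      {ω | (ε * n) ^ 4 ≤ (∑ m ∈ Finset.range n, X m ω) ^ 4} := by
    intro ω hω
    simp only [Set.mem_ofPred_eq, abs_mul, abs_inv, Nat.abs_cast] at hω ⊢
    rw [inv_mul_eq_div, le_div_iff₀ hn'] at hω
    calc (ε * n) ^ 4 ≤ |∑ m ∈ Finset.range n, X m ω| ^ 4 := by gcongr
      _ = _ := by rw [Even.pow_abs (by decide)]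
  have h := mul_meas_ge_le_integral_of_nonneg (μ := P)
    (f := fun ω => (∑ m ∈ Finset.range n, X m ω) ^ 4)
    (Eventually.of_forall fun ω => by positivity) (integrable_pow_of_memLp_four h1 le_rfl)
    ((ε * n) ^ 4)
  refine (measureReal_mono hset).trans ?_
  have h5 := h.trans h4
  simp only [Finset.sum_const, Finset.card_range, nsmul_eq_mul] at h5
  rw [← le_div_iff₀' (by positivity)] at h5
  refine h5.trans (le_of_eq ?_)
  field_simp

/-- Moments of linear combinations of independent complex random variables. -/
theorem linearCombination_moments {W : ℕ → Ω → ℂ} (hind : iIndepFun W P)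
    (hmeas : ∀ m, Measurable (W m)) {v : ℝ} (hv : 0 ≤ v)
    (hL : ∀ m (a : ℂ), MemLp (fun ω => (a * W m ω).re) 4 P)
    (h0 : ∀ m (a : ℂ), ∫ ω, (a * W m ω).re ∂P = 0)
    (h4 : ∀ m (a : ℂ), ∫ ω, (a * W m ω).re ^ 4 ∂P ≤ (v * ‖a‖ ^ 2) ^ 2) (n : ℕ) (a : ℕ → ℂ) :
    Integrable (fun ω => ‖∑ m ∈ Finset.range n, a m * W m ω‖ ^ 4) P ∧
    ∫ ω, (∑ m ∈ Finset.range n, a m * W m ω).re ∂P = 0 ∧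
    ∫ ω, ‖∑ m ∈ Finset.range n, a m * W m ω‖ ^ 4 ∂P ≤
      12 * (v * ∑ m ∈ Finset.range n, ‖a m‖ ^ 2) ^ 2 := by
  have H : ∀ b : ℕ → ℂ, MemLp (fun ω => (∑ m ∈ Finset.range n, b m * W m ω).re) 4 P ∧
      ∫ ω, (∑ m ∈ Finset.range n, b m * W m ω).re ∂P = 0 ∧
      ∫ ω, (∑ m ∈ Finset.range n, b m * W m ω).re ^ 4 ∂P ≤
        3 * (v * ∑ m ∈ Finset.range n, ‖b m‖ ^ 2) ^ 2 := by
    intro b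
    have hi : iIndepFun (fun m ω => (b m * W m ω).re) P :=
      hind.comp (fun m w => (b m * w).re) fun m => by fun_prop
    have := integral_sum_pow_four_le hi (fun m => by fun_prop) (fun m => hL m (b m))
      (fun m => h0 m (b m)) (v := fun m => v * ‖b m‖ ^ 2) (fun m => by positivity)
      (fun m => h4 m (b m)) n
    simp only [Complex.re_sum]
    rw [Finset.mul_sum]
    exact ⟨this.1, this.2.1, this.2.2.2⟩
  obtain ⟨r1, r2, r3⟩ := H a
  -- Multiplying the coefficients by `-i` turns imaginary parts into real parts. With `‖Z‖⁴ ≤ 2 (re⁴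
  -- + im⁴)` the two bounds with constant `3` combine to `12`.
  obtain ⟨s1, s2, s3⟩ := H fun m => -Complex.I * a m
  have him : ∀ ω, (∑ m ∈ Finset.range n, -Complex.I * a m * W m ω).re =
      (∑ m ∈ Finset.range n, a m * W m ω).im := by
    intro ω
    simp only [mul_assoc, ← Finset.mul_sum]
    simp
  simp only [him, norm_mul, norm_neg, Complex.norm_I, one_mul] at s1 s3
  set Z : Ω → ℂ := fun ω => ∑ m ∈ Finset.range n, a m * W m ω with hZ
  have ir := integrable_pow_of_memLp_four r1 (k := 4) le_rfl
  have is := integrable_pow_of_memLp_four s1 (k := 4) le_rfl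
  have hle : ∀ ω, ‖Z ω‖ ^ 4 ≤ 2 * ((Z ω).re ^ 4 + (Z ω).im ^ 4) := by
    intro ω
    have : ‖Z ω‖ ^ 2 = (Z ω).re ^ 2 + (Z ω).im ^ 2 := by
      rw [← Complex.normSq_eq_norm_sq, Complex.normSq_apply]; ring
    rw [show ‖Z ω‖ ^ 4 = (‖Z ω‖ ^ 2) ^ 2 by ring, this]
    nlinarith [sq_nonneg ((Z ω).re ^ 2 - (Z ω).im ^ 2)]
  have hint : Integrable (fun ω => ‖Z ω‖ ^ 4) P := by
    refine ((ir.add is).const_mul 2).mono' ?_ (Eventually.of_forall fun ω => ?_)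
    · have : Measurable Z := by fun_prop
      exact (this.norm.pow_const 4).aestronglyMeasurable
    · rw [Real.norm_of_nonneg (by positivity)]; exact hle ω
  refine ⟨hint, r2, ?_⟩
  refine (integral_mono hint ((ir.add is).const_mul 2) hle).trans ?_
  rw [integral_const_mul]
  simp only [Pi.add_apply]
  rw [integral_add ir is]
  linarith

end

end

/-! ### Circular Gaussian vectors: moments, law, and independence of projections. -/

noncomputable section

section

variable {Ω : Type*} [MeasurableSpace Ω] {P : Measure Ω}

/-- The moments of the standard real Gaussian law. -/
def stdGaussianMoment (k : ℕ) : ℝ := ∫ x, x ^ k ∂gaussianReal 0 1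

/-- Scaling to unit variance isolates the dependence on `v`; the numerical values of the standard
moments play no role later. -/
theorem integral_pow_gaussianReal (v : NNReal) (k : ℕ) :
    ∫ x, x ^ k ∂gaussianReal 0 v = (√(v : ℝ)) ^ k * stdGaussianMoment k := by
  have h := gaussianReal_map_const_mul (μ := 0) (v := 1) (√(v : ℝ))
  have hv : NNReal.mk ((√(v : ℝ)) ^ 2) (sq_nonneg _) * 1 = v := by
    ext; simp
  rw [hv, mul_zero] at h
  rw [← h, integral_map (by fun_prop) (by fun_prop), stdGaussianMoment, ← integral_const_mul]
  simp only [mul_pow]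

theorem star_smul_dotProduct_re {ι : Type*} [Fintype ι] (a : ℂ) (w x : ι → ℂ) :
    (star (a • w) ⬝ᵥ x).re = (a * (star x ⬝ᵥ w)).re := by
  have : star (a • w) ⬝ᵥ x = star (a * (star x ⬝ᵥ w)) := by
    rw [star_mul', ← star_dotProduct_star, star_star, star_smul, smul_dotProduct, smul_eq_mul]
  rw [this]; simp

theorem hermForm_smul {ι : Type*} [Fintype ι] (S : Matrix ι ι ℂ) (a : ℂ) (w : ι → ℂ) :
    hermForm S (a • w) = ‖a‖ ^ 2 * hermForm S w := by
  rw [hermForm, mulVec_smul, dotProduct_smul, star_smul, smul_dotProduct, smul_eq_mul, smul_eq_mul,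
    ← mul_assoc, Complex.star_def, Complex.mul_conj, Complex.normSq_eq_norm_sq,
    Complex.re_ofReal_mul, hermForm]

namespace IsCircularGaussian

section

variable {ι : Type*} [Fintype ι] {X : Ω → ι → ℂ} {S : Matrix ι ι ℂ}

theorem aemeasurable_re (hX : IsCircularGaussian X S P) (w : ι → ℂ) :
    AEMeasurable (fun ω => (star w ⬝ᵥ X ω).re) P := by
  have := hX.aemeasurable
  exact Measurable.comp_aemeasurable (g := fun x : ι → ℂ => (star w ⬝ᵥ x).re)
    (by simp only [dotProduct]; fun_prop) this

theorem memLp_re (hX : IsCircularGaussian X S P) (w : ι → ℂ) (p : NNReal) :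
    MemLp (fun ω => (star w ⬝ᵥ X ω).re) p P := by
  have h : MemLp id p (P.map fun ω => (star w ⬝ᵥ X ω).re) := by
    rw [hX.map_eq]; exact memLp_id_gaussianReal p
  exact (memLp_map_measure_iff aestronglyMeasurable_id (hX.aemeasurable_re w)).1 h

theorem integral_re_pow (hX : IsCircularGaussian X S P) (w : ι → ℂ) (k : ℕ) :
    ∫ ω, (star w ⬝ᵥ X ω).re ^ k ∂P =
      (√((hermForm S w / 2).toNNReal : ℝ)) ^ k * stdGaussianMoment k := by
  rw [← integral_pow_gaussianReal, ← hX.map_eq, integral_map (hX.aemeasurable_re w) (by fun_prop)]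

theorem integral_re (hX : IsCircularGaussian X S P) (w : ι → ℂ) :
    ∫ ω, (star w ⬝ᵥ X ω).re ∂P = 0 := by
  have := integral_map (hX.aemeasurable_re w) (f := fun x => x) (by fun_prop)
  rw [← this, hX.map_eq, integral_id_gaussianReal]

theorem variance_re (hX : IsCircularGaussian X S P) (w : ι → ℂ) :
    Var[fun ω => (star w ⬝ᵥ X ω).re; P] = (hermForm S w / 2).toNNReal := by
  have := variance_map (X := id) (by fun_prop) (hX.aemeasurable_re w)
  rw [Function.id_comp] at this
  rw [← this, hX.map_eq, variance_id_gaussianReal]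

theorem integral_re_sq (hX : IsCircularGaussian X S P) {w : ι → ℂ} (hw : 0 ≤ hermForm S w) :
    ∫ ω, (star w ⬝ᵥ X ω).re ^ 2 ∂P = hermForm S w / 2 := by
  have := hX.variance_re w
  rw [variance_of_integral_eq_zero (hX.aemeasurable_re w) (hX.integral_re w)] at this
  rw [this, Real.coe_toNNReal _ (by positivity)]

theorem integral_re_pow_four (hX : IsCircularGaussian X S P) {w : ι → ℂ}
    (hw : 0 ≤ hermForm S w) :
    ∫ ω, (star w ⬝ᵥ X ω).re ^ 4 ∂P = (hermForm S w / 2) ^ 2 * stdGaussianMoment 4 := by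
  rw [hX.integral_re_pow, Real.coe_toNNReal _ (by positivity), show (4 : ℕ) = 2 * 2 from rfl,
    pow_mul, Real.sq_sqrt (by positivity)]

theorem integral_re_pow_eight (hX : IsCircularGaussian X S P) {w : ι → ℂ}
    (hw : 0 ≤ hermForm S w) :
    ∫ ω, (star w ⬝ᵥ X ω).re ^ 8 ∂P = (hermForm S w / 2) ^ 4 * stdGaussianMoment 8 := by
  rw [hX.integral_re_pow, Real.coe_toNNReal _ (by positivity), show (8 : ℕ) = 2 * 4 from rfl,
    pow_mul, Real.sq_sqrt (by positivity)]

/-- The real and imaginary parts are the real components along `w` and `i w`, each with half of the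
variance. -/
theorem integral_norm_sq (hX : IsCircularGaussian X S P) {w : ι → ℂ} (hw : 0 ≤ hermForm S w) :
    Integrable (fun ω => ‖star (X ω) ⬝ᵥ w‖ ^ 2) P ∧
      ∫ ω, ‖star (X ω) ⬝ᵥ w‖ ^ 2 ∂P = hermForm S w := by
  have e : ∀ ω, ‖star (X ω) ⬝ᵥ w‖ ^ 2 =
      (star ((1 : ℂ) • w) ⬝ᵥ X ω).re ^ 2 + (star (Complex.I • w) ⬝ᵥ X ω).re ^ 2 := by
    intro ω
    rw [star_smul_dotProduct_re, star_smul_dotProduct_re, ← Complex.normSq_eq_norm_sq,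
      Complex.normSq_apply]
    simp; ring
  have h1 : hermForm S ((1 : ℂ) • w) = hermForm S w := by rw [one_smul]
  have h2 : hermForm S (Complex.I • w) = hermForm S w := by rw [hermForm_smul]; simp
  have i1 := (hX.memLp_re ((1 : ℂ) • w) 2).integrable_sq
  have i2 := (hX.memLp_re (Complex.I • w) 2).integrable_sq
  simp only [e]
  refine ⟨i1.add i2, ?_⟩
  rw [integral_add i1 i2, hX.integral_re_sq (by rw [h1]; exact hw),
    hX.integral_re_sq (by rw [h2]; exact hw), h1, h2]
  ring

/-- A component of variance zero vanishes almost surely. This is what confines the clutter to the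
range of `B`. -/
theorem dotProduct_ae_eq_zero (hX : IsCircularGaussian X S P) {w : ι → ℂ}
    (hw : hermForm S w = 0) : ∀ᵐ ω ∂P, star (X ω) ⬝ᵥ w = 0 := by
  obtain ⟨i, h⟩ := hX.integral_norm_sq hw.ge
  rw [hw, integral_eq_zero_iff_of_nonneg (fun ω => by positivity) i] at h
  filter_upwards [h] with ω hω
  simpa using hω

end

section

variable {q : ℕ} {X Y : Ω → Fin q → ℂ} {S : Matrix (Fin q) (Fin q) ℂ}

/-- The components of `w` are read off from the values of `L` on `e_k` and `i e_k`. So the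
one-dimensional laws in `IsCircularGaussian` cover all real functionals and determine the law. -/
theorem exists_dual_eq (L : StrongDual ℝ (Fin q → ℂ)) :
    ∃ w : Fin q → ℂ, ∀ x, L x = (star w ⬝ᵥ x).re := by
  refine ⟨fun k => ⟨L (Pi.single k 1), L (Pi.single k Complex.I)⟩, fun x => ?_⟩
  have hx : x = ∑ k, ((x k).re • (Pi.single k (1 : ℂ) : Fin q → ℂ) +
      (x k).im • (Pi.single k Complex.I : Fin q → ℂ)) := by
    ext j
    simp only [Finset.sum_apply, Pi.add_apply, Pi.smul_apply, Pi.single_apply]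
    rw [Finset.sum_eq_single j]
    · simp only [if_true, Complex.real_smul, mul_one]; exact (Complex.re_add_im _).symm
    · intro b _ hb; simp [Ne.symm hb]
    · simp
  conv_lhs => rw [hx]
  simp only [map_sum, map_add, map_smul, dotProduct, Complex.re_sum, Pi.star_apply,
    Complex.mul_re, Complex.star_def, Complex.conj_re, Complex.conj_im, smul_eq_mul]
  refine Finset.sum_congr rfl fun k _ => by ring

theorem hasGaussianLaw (hX : IsCircularGaussian X S P) : HasGaussianLaw X P := by
  refine ⟨isGaussian_of_map_eq_gaussianReal fun L => ?_⟩
  obtain ⟨w, hw⟩ := exists_dual_eq L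
  refine ⟨0, (hermForm S w / 2).toNNReal, ?_⟩
  rw [AEMeasurable.map_map_of_aemeasurable (by fun_prop) hX.aemeasurable, ← hX.map_eq]
  congr 1
  ext ω; exact hw _

theorem identDistrib {Ω' : Type*} [MeasurableSpace Ω'] {P' : Measure Ω'} [IsFiniteMeasure P]
    [IsFiniteMeasure P'] {Y : Ω' → Fin q → ℂ}
    (hX : IsCircularGaussian X S P) (hY : IsCircularGaussian Y S P') : IdentDistrib X Y P P' := by
  refine ⟨hX.aemeasurable, hY.aemeasurable, ?_⟩
  refine Measure.ext_of_charFunDual ?_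
  ext L
  obtain ⟨w, hw⟩ := exists_dual_eq L
  rw [charFunDual_eq_charFun_map_one, charFunDual_eq_charFun_map_one,
    AEMeasurable.map_map_of_aemeasurable (by fun_prop) hX.aemeasurable,
    AEMeasurable.map_map_of_aemeasurable (by fun_prop) hY.aemeasurable]
  have h1 : (L ∘ X) = fun ω => (star w ⬝ᵥ X ω).re := by ext ω; exact hw _
  have h2 : (L ∘ Y) = fun ω => (star w ⬝ᵥ Y ω).re := by ext ω; exact hw _
  rw [h1, h2, hX.map_eq, hY.map_eq]

theorem memLp (hX : IsCircularGaussian X S P) {p : ENNReal} (hp : p ≠ ⊤) : MemLp X p P :=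
  hX.hasGaussianLaw.memLp hp

theorem memLp_apply (hX : IsCircularGaussian X S P) (k : Fin q) {p : ENNReal} (hp : p ≠ ⊤) :
    MemLp (fun ω => X ω k) p P :=
  (memLp_pi_iff.1 (hX.memLp hp)) k

theorem integrable_mul_star (hX : IsCircularGaussian X S P) (k l : Fin q) :
    Integrable (fun ω => X ω k * star (X ω l)) P :=
  (hX.memLp_apply k (by norm_num)).integrable_mul (p := 2) (q := 2)
    (hX.memLp_apply l (by norm_num)).star

/-- Complex polarization: over `ℂ` a matrix is determined by its quadratic form, so the variances
give every covariance entry. -/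
theorem eq_of_quadForm_eq {M N : Matrix (Fin q) (Fin q) ℂ}
    (h : ∀ v, quadForm M v = quadForm N v) : M = N := by
  rw [← sub_eq_zero]
  have h0 : ∀ v, quadForm (M - N) v = 0 := fun v => by rw [quadForm_sub, h, sub_self]
  have : Matrix.toEuclideanLin (M - N) = 0 := by
    rw [← inner_map_self_eq_zero]
    intro x
    rw [← inner_conj_symm, EuclideanSpace.inner_eq_star_dotProduct]
    have := h0 x.ofLp
    rw [quadForm, dotProduct_comm] at this
    rw [show (toEuclideanLin (M - N) x).ofLp = (M - N) *ᵥ x.ofLp from rfl, this, map_zero]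
  exact (LinearEquiv.map_eq_zero_iff _).1 this

/-- The entries of the covariance matrix. -/
theorem integral_mul_star (hX : IsCircularGaussian X S P) (hS : S.PosSemidef) (k l : Fin q) :
    ∫ ω, X ω k * star (X ω l) ∂P = S k l := by
  suffices h : (Matrix.of fun k l => ∫ ω, X ω k * star (X ω l) ∂P) = S by
    rw [← h, Matrix.of_apply]
  refine eq_of_quadForm_eq fun v => ?_
  have hv := hermForm_nonneg hS v
  have e : quadForm S v = (hermForm S v : ℂ) := by
    refine Complex.ext rfl ?_
    rw [quadForm_im_of_isHermitian hS.1]; simp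
  rw [e, ← (hX.integral_norm_sq hv).2, ← integral_complex_ofReal]
  have e2 : ∀ ω, ((‖star (X ω) ⬝ᵥ v‖ ^ 2 : ℝ) : ℂ) =
      ∑ k, ∑ l, star (v k) * (v l * (X ω k * star (X ω l))) := by
    intro ω
    have h1 : star (star (X ω) ⬝ᵥ v) = ∑ k, star (v k) * X ω k := by
      simp [dotProduct, mul_comm]
    rw [← Complex.normSq_eq_norm_sq, ← Complex.mul_conj, mul_comm, ← Complex.star_def, h1,
      dotProduct, Finset.sum_mul_sum]
    refine Finset.sum_congr rfl fun i _ => Finset.sum_congr rfl fun j _ => ?_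
    simp only [Pi.star_apply]; ring
  simp only [e2]
  have hi : ∀ k l, Integrable (fun ω => star (v k) * (v l * (X ω k * star (X ω l)))) P :=
    fun k l => ((hX.integrable_mul_star k l).const_mul _).const_mul _
  rw [integral_finsetSum _ fun k _ => integrable_finsetSum _ fun l _ => hi k l]
  simp only [quadForm, dotProduct, mulVec, Matrix.of_apply, Finset.mul_sum]
  refine Finset.sum_congr rfl fun i _ => ?_
  rw [integral_finsetSum _ fun l _ => hi i l]
  refine Finset.sum_congr rfl fun j _ => ?_
  rw [integral_const_mul, integral_const_mul, Pi.star_apply]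
  ring

theorem star_dotProduct_mulVec_of_projection {Q : Matrix (Fin q) (Fin q) ℂ} (hQ : Qᴴ = Q)
    (w x : Fin q → ℂ) : star w ⬝ᵥ Q *ᵥ x = star (Q *ᵥ w) ⬝ᵥ x := by
  rw [star_mulVec, hQ, dotProduct_mulVec]

theorem hermForm_smul_one (s : ℝ) (w : Fin q → ℂ) :
    hermForm ((s : ℂ) ^ 2 • (1 : Matrix (Fin q) (Fin q) ℂ)) w = s ^ 2 * sqLen w := by
  rw [hermForm, smul_mulVec, one_mulVec, dotProduct_smul, star_dotProduct_self_eq_sqLen,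
    smul_eq_mul, ← Complex.ofReal_pow, ← Complex.ofReal_mul, Complex.ofReal_re]

theorem sqLen_projection_add {Q : Matrix (Fin q) (Fin q) ℂ} (hQ : Qᴴ = Q) (hQQ : Q * Q = Q)
    (u v : Fin q → ℂ) : sqLen (Q *ᵥ u + (1 - Q) *ᵥ v) = sqLen (Q *ᵥ u) + sqLen ((1 - Q) *ᵥ v) := by
  have h1 : star (Q *ᵥ u) ⬝ᵥ (1 - Q) *ᵥ v = 0 := by
    rw [← star_dotProduct_mulVec_of_projection hQ, mulVec_mulVec, mul_sub, mul_one, hQQ, sub_self,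
      zero_mulVec, dotProduct_zero]
  have h2 : star ((1 - Q) *ᵥ v) ⬝ᵥ Q *ᵥ u = 0 := by
    rw [star_dotProduct_mulVec_of_projection hQ, mulVec_mulVec, mul_sub, mul_one, hQQ, sub_self,
      zero_mulVec, star_zero, zero_dotProduct]
  have := star_dotProduct_self_eq_sqLen (Q *ᵥ u + (1 - Q) *ᵥ v)
  rw [star_add, dotProduct_add, add_dotProduct, add_dotProduct, h1, h2,
    star_dotProduct_self_eq_sqLen, star_dotProduct_self_eq_sqLen] at this
  simp only [add_zero, zero_add] at this
  exact_mod_cast this.symm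

/-- Complementary projections of white circular Gaussian noise are independent. -/
theorem indepFun_projection [IsProbabilityMeasure P] {s : ℝ}
    (hX : IsCircularGaussian X ((s : ℂ) ^ 2 • (1 : Matrix (Fin q) (Fin q) ℂ)) P)
    {Q : Matrix (Fin q) (Fin q) ℂ} (hQ : Qᴴ = Q) (hQQ : Q * Q = Q) :
    IndepFun (fun ω => Q *ᵥ X ω) (fun ω => (1 - Q) *ᵥ X ω) P := by
  have hQ1 : (1 - Q)ᴴ = 1 - Q := by simp [hQ]
  set L : (Fin q → ℂ) →L[ℝ] (Fin q → ℂ) × (Fin q → ℂ) :=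
    LinearMap.toContinuousLinearMap
      (((mulVecLin Q).prod (mulVecLin (1 - Q))).restrictScalars ℝ) with hL
  have hG := hX.hasGaussianLaw.map_fun L
  refine HasGaussianLaw.indepFun_of_covariance_strongDual hG fun L₁ L₂ => ?_
  obtain ⟨w₁, hw₁⟩ := exists_dual_eq L₁
  obtain ⟨w₂, hw₂⟩ := exists_dual_eq L₂
  have e₁ : (L₁ ∘ fun ω => Q *ᵥ X ω) = fun ω => (star (Q *ᵥ w₁) ⬝ᵥ X ω).re := by
    ext ω; simp only [Function.comp, hw₁, star_dotProduct_mulVec_of_projection hQ]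
  have e₂ : (L₂ ∘ fun ω => (1 - Q) *ᵥ X ω) = fun ω => (star ((1 - Q) *ᵥ w₂) ⬝ᵥ X ω).re := by
    ext ω; simp only [Function.comp, hw₂, star_dotProduct_mulVec_of_projection hQ1]
  change cov[L₁ ∘ fun ω => Q *ᵥ X ω, L₂ ∘ fun ω => (1 - Q) *ᵥ X ω; P] = 0
  rw [e₁, e₂]
  -- The variance of the sum equals the sum of the variances by Pythagoras, so the covariance is
  -- zero. Jointly Gaussian and uncorrelated implies independent.
  have hadd := variance_add (hX.memLp_re (Q *ᵥ w₁) 2) (hX.memLp_re ((1 - Q) *ᵥ w₂) 2)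
  have e₃ : ((fun ω => (star (Q *ᵥ w₁) ⬝ᵥ X ω).re) + fun ω => (star ((1 - Q) *ᵥ w₂) ⬝ᵥ X ω).re) =
      fun ω => (star (Q *ᵥ w₁ + (1 - Q) *ᵥ w₂) ⬝ᵥ X ω).re := by
    ext ω; simp [star_add, add_dotProduct]
  rw [e₃, hX.variance_re, hX.variance_re, hX.variance_re, hermForm_smul_one, hermForm_smul_one,
    hermForm_smul_one, sqLen_projection_add hQ hQQ] at hadd
  have p1 := sqLen_nonneg (Q *ᵥ w₁)
  have p2 := sqLen_nonneg ((1 - Q) *ᵥ w₂)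
  rw [Real.coe_toNNReal _ (by positivity), Real.coe_toNNReal _ (by positivity),
    Real.coe_toNNReal _ (by positivity)] at hadd
  linarith

end

end IsCircularGaussian

end

end

/-! ### Independence and conditioning by Fubini. -/

noncomputable section

section Independence

variable {Ω : Type*} [MeasurableSpace Ω] {P : Measure Ω}

/-- Associativity of the product measure, once the joint law of the three variables is known to be a
product. -/
theorem indepFun_prodMk_of_indepFun [IsProbabilityMeasure P] {α β γ : Type*} [MeasurableSpace α]
    [MeasurableSpace β] [MeasurableSpace γ] {X : Ω → α} {Y : Ω → β} {Z : Ω → γ}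
    (hX : Measurable X) (hY : Measurable Y) (hZ : Measurable Z)
    (h : IndepFun X (fun ω => (Y ω, Z ω)) P) (h' : IndepFun Y Z P) :
    IndepFun (fun ω => (X ω, Y ω)) Z P := by
  have := Measure.isProbabilityMeasure_map (μ := P) hX.aemeasurable
  have := Measure.isProbabilityMeasure_map (μ := P) hY.aemeasurable
  have := Measure.isProbabilityMeasure_map (μ := P) hZ.aemeasurable
  have hXY : IndepFun X Y P := h.comp (φ := id) (ψ := Prod.fst) measurable_id measurable_fst
  rw [indepFun_iff_map_prod_eq_prod_map_map (by fun_prop) (by fun_prop)] at h h' hXY ⊢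
  rw [hXY]
  rw [h'] at h
  rw [← MeasurableEquiv.prodAssoc.map_measurableEquiv_injective.eq_iff, Measure.prodAssoc_prod,
    ← h, Measure.map_map (by fun_prop) (by fun_prop)]
  rfl

theorem iIndepFun_bool [IsProbabilityMeasure P] {α : Type*} [MeasurableSpace α] {X : Bool → Ω → α}
    (hX : ∀ b, Measurable (X b)) (h : IndepFun (X true) (X false) P) : iIndepFun X P := by
  have := fun b => Measure.isProbabilityMeasure_map (μ := P) (hX b).aemeasurable
  rw [iIndepFun_iff_map_fun_eq_pi_map (fun b => (hX b).aemeasurable)]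
  refine (Measure.pi_eq fun s hs => ?_).symm
  rw [Measure.map_apply (by fun_prop) (MeasurableSet.univ_pi hs), Fintype.prod_bool,
    Measure.map_apply (hX _) (hs _), Measure.map_apply (hX _) (hs _),
    ← h.measure_inter_preimage_eq_mul _ _ (hs _) (hs _)]
  congr 1
  ext ω; simp [and_comm]

/-- Disjoint index sets of an independent family generate independent `σ`-algebras. It passes from
independence of single snapshots to independence of the whole inner and outer sequences. -/
theorem indepFun_sequences {α : Type*} [MeasurableSpace α] {X : ℕ × Bool → Ω → α}
    (hX : ∀ i, Measurable (X i)) (h : iIndepFun X P) :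
    IndepFun (fun ω m => X (m, true) ω) (fun ω m => X (m, false) ω) P := by
  have hd : Disjoint {i : ℕ × Bool | i.2 = true} {i | i.2 = false} := by
    rw [Set.disjoint_left]; rintro ⟨m, b⟩ h1 h2; simp_all
  have := indep_iSup_of_disjoint (fun i => (hX i).comap_le) h.iIndep hd
  have key : ∀ b, MeasurableSpace.comap (fun ω (m : ℕ) => X (m, b) ω) inferInstance ≤
      ⨆ i ∈ {i : ℕ × Bool | i.2 = b}, MeasurableSpace.comap (X i) inferInstance := by
    intro b
    rw [MeasurableSpace.pi, MeasurableSpace.comap_iSup]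
    refine iSup_le fun m => ?_
    rw [MeasurableSpace.comap_comp]
    exact le_iSup₂_of_le (m, b) rfl le_rfl
  exact indep_of_indep_of_le_left (indep_of_indep_of_le_right this (key false)) (key true)

/-- This replaces conditional expectation: the first variable is frozen and the integral is taken
over the second alone. -/
theorem integral_eq_integral_integral_of_indepFun [IsProbabilityMeasure P] {α β : Type*}
    [MeasurableSpace α] [MeasurableSpace β] {X : Ω → α} {Y : Ω → β} (hX : Measurable X)
    (hY : Measurable Y) (h : IndepFun X Y P) {f : α × β → ℝ} (hf : Measurable f)
    (hi : Integrable (fun ω => f (X ω, Y ω)) P) :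
    ∫ ω, f (X ω, Y ω) ∂P = ∫ ω, ∫ ω', f (X ω, Y ω') ∂P ∂P := by
  have := Measure.isProbabilityMeasure_map (μ := P) hX.aemeasurable
  have := Measure.isProbabilityMeasure_map (μ := P) hY.aemeasurable
  rw [indepFun_iff_map_prod_eq_prod_map_map (by fun_prop) (by fun_prop)] at h
  have h1 : ∫ ω, f (X ω, Y ω) ∂P = ∫ p, f p ∂(P.map fun ω => (X ω, Y ω)) :=
    (integral_map (by fun_prop) hf.aestronglyMeasurable).symm
  have hi' : Integrable f ((P.map X).prod (P.map Y)) := by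
    rw [← h]
    exact (integrable_map_measure hf.aestronglyMeasurable (by fun_prop)).2 hi
  rw [h1, h, integral_prod _ hi', integral_map hX.aemeasurable
    (hf.stronglyMeasurable.integral_prod_right' (ν := P.map Y)).aestronglyMeasurable]
  refine integral_congr_ae (Eventually.of_forall fun ω => ?_)
  exact integral_map hY.aemeasurable (hf.comp measurable_prodMk_left).aestronglyMeasurable

/-- A conditional bound uniform in the frozen variable gives integrability by Tonelli. -/
theorem integrable_of_indepFun_of_integral_le [IsProbabilityMeasure P] {α β : Type*}
    [MeasurableSpace α] [MeasurableSpace β] {X : Ω → α} {Y : Ω → β} (hX : Measurable X)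
    (hY : Measurable Y) (h : IndepFun X Y P) {f : α × β → ℝ} (hf : Measurable f)
    (hf0 : ∀ p, 0 ≤ f p) {c : ℝ} (hc : ∀ x, Integrable (fun ω => f (x, Y ω)) P ∧
      ∫ ω, f (x, Y ω) ∂P ≤ c) :
    Integrable (fun ω => f (X ω, Y ω)) P ∧ ∫ ω, f (X ω, Y ω) ∂P ≤ c := by
  have := Measure.isProbabilityMeasure_map (μ := P) hX.aemeasurable
  have := Measure.isProbabilityMeasure_map (μ := P) hY.aemeasurable
  have h' := h
  rw [indepFun_iff_map_prod_eq_prod_map_map (by fun_prop) (by fun_prop)] at h'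
  have hY1 : ∀ x, Integrable (fun y => f (x, y)) (P.map Y) := fun x =>
    (integrable_map_measure (hf.comp measurable_prodMk_left).aestronglyMeasurable
      hY.aemeasurable).2 (hc x).1
  have hY2 : ∀ x, ∫ y, f (x, y) ∂(P.map Y) ≤ c := fun x => by
    have := integral_map (μ := P) hY.aemeasurable
      (hf.comp (measurable_prodMk_left (x := x))).aestronglyMeasurable
    exact this.trans_le (hc x).2
  have hi' : Integrable f ((P.map X).prod (P.map Y)) := by
    rw [integrable_prod_iff hf.aestronglyMeasurable]
    refine ⟨Eventually.of_forall hY1, ?_⟩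
    simp only [Real.norm_of_nonneg (hf0 _)]
    refine Integrable.mono' (integrable_const c)
      (hf.stronglyMeasurable.integral_prod_right' (ν := P.map Y)).aestronglyMeasurable
      (Eventually.of_forall fun x => ?_)
    rw [Real.norm_of_nonneg (integral_nonneg fun y => hf0 _)]
    exact hY2 x
  have hi : Integrable (fun ω => f (X ω, Y ω)) P := by
    rw [← h'] at hi'
    exact (integrable_map_measure hf.aestronglyMeasurable (by fun_prop)).1 hi'
  refine ⟨hi, ?_⟩
  rw [integral_eq_integral_integral_of_indepFun hX hY h hf hi]
  refine (integral_mono_of_nonneg (Eventually.of_forall fun ω => integral_nonneg fun _ => hf0 _)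
    (integrable_const c) (Eventually.of_forall fun ω => (hc _).2)).trans ?_
  simp

end Independence

/-! ### Reduction to spatially filtered temporal data. -/

section Reduction

variable {Ω : Type*} [MeasurableSpace Ω] {P : Measure Ω} {p q : ℕ}

/-- The temporal data seen by the spatial filter `h`. -/
def spatialFilter (h : Fin p → ℂ) (x : Fin p × Fin q → ℂ) : Fin q → ℂ :=
  fun k => ∑ i, star (h i) * x (i, k)

theorem measurable_spatialFilter (h : Fin p → ℂ) :
    Measurable (spatialFilter h : (Fin p × Fin q → ℂ) → Fin q → ℂ) := by
  unfold spatialFilter; fun_prop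

theorem star_dotProduct_spatialFilter (h : Fin p → ℂ) (w : Fin q → ℂ) (x : Fin p × Fin q → ℂ) :
    star w ⬝ᵥ spatialFilter h x = star (kronVec h w) ⬝ᵥ x := by
  simp only [dotProduct, spatialFilter, kronVec, Fintype.sum_prod_type, Pi.star_apply, star_mul',
    Finset.mul_sum]
  rw [Finset.sum_comm]
  refine Finset.sum_congr rfl fun i _ => Finset.sum_congr rfl fun j _ => by ring

theorem spatialFilter_snapshot (h : Fin p → ℂ) (t : ℝ) (c z : Fin p × Fin q → ℂ) :
    spatialFilter h (snapshot t c z) = snapshot t (spatialFilter h c) (spatialFilter h z) := by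
  ext k
  simp only [spatialFilter, snapshot, Finset.mul_sum, ← Finset.sum_add_distrib]
  refine Finset.sum_congr rfl fun i _ => by ring

/-- For `Â = h hᴴ` with `‖h‖ = 1` the normalizing factor is `1`, and summing against `conj Â`
contracts both spatial indices with `h`. -/
theorem temporalFit_sampleCov {h : Fin p → ℂ} (hh : sqLen h = 1) (n : ℕ)
    (x : ℕ → Fin p × Fin q → ℂ) :
    temporalFit (sampleCov n x) (vecMulVec h (star h)) =
      sampleCov n fun m => spatialFilter h (x m) := by
  have hn : ∑ i, ∑ j, ‖vecMulVec h (star h) i j‖ ^ 2 = 1 := by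
    have : ∑ i, ∑ j, ‖vecMulVec h (star h) i j‖ ^ 2 = sqLen h * sqLen h := by
      simp only [sqLen, Finset.sum_mul_sum, vecMulVec_apply, norm_mul, mul_pow, Pi.star_apply,
        norm_star]
    rw [this, hh, one_mul]
  ext k l
  rw [temporalFit, hn]
  simp only [sampleCov, Matrix.smul_apply, Matrix.sum_apply, vecMulVec_apply, Pi.star_apply, smul_eq_mul,
    spatialFilter, Complex.ofReal_one, div_one, Finset.mul_sum, star_sum, Finset.sum_mul]
  have e1 : ∀ i j, (∑ m ∈ Finset.range n, star (h i * star (h j)) *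
      ((n : ℂ)⁻¹ * (x m (i, k) * star (x m (j, l))))) = ∑ m ∈ Finset.range n,
      (n : ℂ)⁻¹ * (star (h i) * x m (i, k) * star (star (h j) * x m (j, l))) := by
    intro i j
    refine Finset.sum_congr rfl fun m _ => ?_
    simp only [star_mul', star_star]; ring
  simp only [e1]
  rw [Finset.sum_comm_cycle]
  refine Finset.sum_congr rfl fun m _ => ?_
  rw [Finset.sum_comm]

theorem IsCircularGaussian.spatialFilter {X : Ω → Fin p × Fin q → ℂ}
    {S : Matrix (Fin p × Fin q) (Fin p × Fin q) ℂ} {S' : Matrix (Fin q) (Fin q) ℂ}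
    (hX : IsCircularGaussian X S P) {h : Fin p → ℂ}
    (hS : ∀ w, hermForm S (kronVec h w) = hermForm S' w) :
    IsCircularGaussian (fun ω => spatialFilter h (X ω)) S' P where
  aemeasurable := (measurable_spatialFilter h).comp_aemeasurable hX.aemeasurable
  map_eq w := by
    simp only [star_dotProduct_spatialFilter]
    rw [hX.map_eq, hS]

theorem IsCircularGaussian.congr {ι : Type*} [Fintype ι] {X Y : Ω → ι → ℂ} {S : Matrix ι ι ℂ}
    (hX : IsCircularGaussian X S P) (h : X =ᵐ[P] Y) : IsCircularGaussian Y S P where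
  aemeasurable := hX.aemeasurable.congr h
  map_eq w := by
    rw [← hX.map_eq]
    refine Measure.map_congr ?_
    filter_upwards [h] with ω hω
    rw [hω]

theorem hermForm_ofReal_smul (r : ℝ) (B : Matrix (Fin q) (Fin q) ℂ) (w : Fin q → ℂ) :
    hermForm ((r : ℂ) • B) w = r * hermForm B w := by
  rw [hermForm, smul_mulVec, dotProduct_smul, smul_eq_mul, Complex.re_ofReal_mul, hermForm]

/-- On the vectors `h ⊗ w` the form of `A ⊗ B` factors as `(hᴴ A h) (wᴴ B w)`, and white noise stays
white because `h` is a unit vector. -/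
theorem IsSIRV.spatialFilter {τ : ℕ → Ω → ℝ} {c z : ℕ → Ω → Fin p × Fin q → ℂ}
    {A : Matrix (Fin p) (Fin p) ℂ} {B : Matrix (Fin q) (Fin q) ℂ} (hA : A.PosSemidef) {σ : ℝ}
    (H : IsSIRV τ c z (A ⊗ₖ B) σ P) {h : Fin p → ℂ} (hh : sqLen h = 1) :
    IsSIRV τ (fun m ω => spatialFilter h (c m ω)) (fun m ω => spatialFilter h (z m ω))
      ((hermForm A h : ℂ) • B) σ P where
  texture_pos := H.texture_pos
  texture_memLp := H.texture_memLp
  texture_identDistrib := H.texture_identDistrib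
  speckle m := (H.speckle m).spatialFilter fun w => by
    rw [hermForm_kronecker hA, hermForm_ofReal_smul]
  noise m := (H.noise m).spatialFilter fun w => by
    have : star (kronVec h w) ⬝ᵥ kronVec h w = (sqLen (kronVec h w) : ℂ) :=
      star_dotProduct_self_eq_sqLen _
    rw [IsCircularGaussian.hermForm_smul_one, hermForm, smul_mulVec, one_mulVec, dotProduct_smul,
      this, sqLen_kronVec, hh, one_mul, smul_eq_mul, ← Complex.ofReal_pow, ← Complex.ofReal_mul,
      Complex.ofReal_re]
  indep_texture_speckle m := (H.indep_texture_speckle m).comp (φ := id) measurable_id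
    (measurable_spatialFilter h)
  indep_clutter_noise m := (H.indep_clutter_noise m).comp
    (φ := fun x : ℝ × (Fin p × Fin q → ℂ) => (x.1, _root_.spatialFilter h x.2))
    (by have := measurable_spatialFilter (q := q) h; fun_prop) (measurable_spatialFilter h)
  indep_snapshots := H.indep_snapshots.comp
    (fun _ (x : ℝ × (Fin p × Fin q → ℂ) × (Fin p × Fin q → ℂ)) =>
      (x.1, _root_.spatialFilter h x.2.1, _root_.spatialFilter h x.2.2))
    (fun _ => by have := measurable_spatialFilter (q := q) h; fun_prop)

/-- Serves to replace the almost everywhere measurable data by measurable versions. -/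
theorem IsSIRV.congr {ι : Type*} [Fintype ι] [DecidableEq ι] {τ τ' : ℕ → Ω → ℝ}
    {c z c' z' : ℕ → Ω → ι → ℂ} {S : Matrix ι ι ℂ} {σ : ℝ} (H : IsSIRV τ c z S σ P)
    (hτ : ∀ m, τ m =ᵐ[P] τ' m) (hc : ∀ m, c m =ᵐ[P] c' m) (hz : ∀ m, z m =ᵐ[P] z' m) :
    IsSIRV τ' c' z' S σ P where
  texture_pos m := by filter_upwards [H.texture_pos m, hτ m] with ω h1 h2; rwa [← h2]
  texture_memLp m := (memLp_congr_ae (hτ m)).1 (H.texture_memLp m)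
  texture_identDistrib m := by
    have h0 := IdentDistrib.of_ae_eq (H.texture_memLp 0).1.aemeasurable (hτ 0)
    have h1 := IdentDistrib.of_ae_eq (H.texture_memLp m).1.aemeasurable (hτ m)
    exact (h1.symm.trans (H.texture_identDistrib m)).trans h0
  speckle m := (H.speckle m).congr (hc m)
  noise m := (H.noise m).congr (hz m)
  indep_texture_speckle m := (H.indep_texture_speckle m).congr (hτ m) (hc m)
  indep_clutter_noise m := (H.indep_clutter_noise m).congr
    (by filter_upwards [hτ m, hc m] with ω h1 h2; rw [h1, h2]) (hz m)
  indep_snapshots := (iIndepFun_congr fun m => by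
    filter_upwards [hτ m, hc m, hz m] with ω h1 h2 h3; rw [h1, h2, h3]).1 H.indep_snapshots

/-- The data seen inside the range of a projection are independent of the noise seen outside. -/
theorem IsSIRV.iIndepFun_projection [IsProbabilityMeasure P] {τ : ℕ → Ω → ℝ}
    {c z : ℕ → Ω → Fin q → ℂ} {S : Matrix (Fin q) (Fin q) ℂ} {σ : ℝ} (H : IsSIRV τ c z S σ P)
    (hτ : ∀ m, Measurable (τ m)) (hc : ∀ m, Measurable (c m)) (hz : ∀ m, Measurable (z m))
    {Q : Matrix (Fin q) (Fin q) ℂ} (hQ : Qᴴ = Q) (hQQ : Q * Q = Q) :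
    iIndepFun (fun (i : ℕ × Bool) ω => if i.2 then Q *ᵥ snapshot (τ i.1 ω) (c i.1 ω) (z i.1 ω)
      else (1 - Q) *ᵥ z i.1 ω) P := by
  have mQ : ∀ Q : Matrix (Fin q) (Fin q) ℂ, Measurable fun x => Q *ᵥ x := fun Q => by
    refine measurable_pi_iff.2 fun i => ?_
    simp only [mulVec, dotProduct]; fun_prop
  have ms : Measurable fun x : ℝ × (Fin q → ℂ) × (Fin q → ℂ) => snapshot x.1 x.2.1 x.2.2 := by
    unfold snapshot; fun_prop
  have m1 : ∀ m, Measurable fun ω => Q *ᵥ snapshot (τ m ω) (c m ω) (z m ω) := fun m =>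
    (mQ Q).comp (ms.comp ((hτ m).prodMk ((hc m).prodMk (hz m))))
  have m2 : ∀ m, Measurable fun ω => (1 - Q) *ᵥ z m ω := fun m => (mQ _).comp (hz m)
  refine iIndepFun_uncurry' (X := fun m (b : Bool) ω => if b then
    Q *ᵥ snapshot (τ m ω) (c m ω) (z m ω) else (1 - Q) *ᵥ z m ω) ?_ ?_ ?_
  · rintro m (b | b)
    · simpa using m2 m
    · simpa using m1 m
  · exact H.indep_snapshots.comp (fun _ (x : ℝ × (Fin q → ℂ) × (Fin q → ℂ)) (b : Bool) =>
      if b then Q *ᵥ snapshot x.1 x.2.1 x.2.2 else (1 - Q) *ᵥ x.2.2) fun _ => by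
        rw [measurable_pi_iff]
        rintro (b | b)
        · simpa using! (mQ (1 - Q)).comp (measurable_snd.comp measurable_snd)
        · simpa using! (mQ Q).comp ms
  · intro m
    refine iIndepFun_bool ?_ ?_
    · rintro (b | b)
      · simpa using m2 m
      · simpa using m1 m
    -- The noise is independent of the clutter, and its two projections are independent of each
    -- other. Hence the pair of clutter and inner noise is independent of the outer noise.
    · have h1 : IndepFun (fun ω => (τ m ω, c m ω)) (fun ω => (Q *ᵥ z m ω, (1 - Q) *ᵥ z m ω)) P :=
        (H.indep_clutter_noise m).comp (φ := id) (ψ := fun x => (Q *ᵥ x, (1 - Q) *ᵥ x))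
          measurable_id ((mQ _).prodMk (mQ _))
      have h2 := indepFun_prodMk_of_indepFun ((hτ m).prodMk (hc m)) ((mQ Q).comp (hz m)) (m2 m) h1
        ((H.noise m).indepFun_projection hQ hQQ)
      have h3 := h2.comp (φ := fun x : (ℝ × (Fin q → ℂ)) × (Fin q → ℂ) =>
        Q *ᵥ (fun k => (x.1.1 : ℂ) * x.1.2 k) + x.2) (ψ := id)
        (((mQ Q).comp (by fun_prop)).add measurable_snd) measurable_id
      convert h3 using 1
      · ext ω : 1
        simp only [if_true, Function.comp, ← mulVec_add]
        rfl
      · ext ω : 1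
        simp

end Reduction

end

/-! ### The leakage for fixed inner data. -/

noncomputable section

/-- The sample cross-covariance `(1/n) ∑_{m < n} x_m z_mᴴ`. -/
def sampleCrossCov {ι : Type*} (n : ℕ) (x z : ℕ → ι → ℂ) : Matrix ι ι ℂ :=
  (n : ℂ)⁻¹ • ∑ m ∈ Finset.range n, vecMulVec (x m) (star (z m))

/-- The sample covariance of the data in the range of `Q`, made invertible on the complement. -/
def regularizedCov {q : ℕ} (Q : Matrix (Fin q) (Fin q) ℂ) (n : ℕ) (x : ℕ → Fin q → ℂ) :
    Matrix (Fin q) (Fin q) ℂ :=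
  sampleCov n x + (1 - Q)

/-- The regression of the noise data `z` on the clutter data `x`: the first-order perturbation of
the principal subspace. -/
def subspaceLeakage {q : ℕ} (Q : Matrix (Fin q) (Fin q) ℂ) (n : ℕ) (x z : ℕ → Fin q → ℂ) :
    Matrix (Fin q) (Fin q) ℂ :=
  (regularizedCov Q n x)⁻¹ * sampleCrossCov n x z

/-- The data whose regularized sample covariance is bounded below by `δ`. -/
def wellConditioned {q : ℕ} (δ : ℝ) (Q : Matrix (Fin q) (Fin q) ℂ) (n : ℕ) :
    Set (ℕ → Fin q → ℂ) :=
  {x | ∀ v, δ * sqLen v ≤ (quadForm (regularizedCov Q n x) v).re}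

section

open scoped Matrix.Norms.Frobenius

variable {q : ℕ}

theorem norm_entry_le (M : Matrix (Fin q) (Fin q) ℂ) (k l : Fin q) : ‖M k l‖ ≤ ‖M‖ := by
  refine (abs_le_of_sq_le_sq' ?_ (norm_nonneg _)).2
  rw [frobenius_sq]
  refine le_trans ?_ (Finset.single_le_sum (f := fun i => ∑ j, ‖M i j‖ ^ 2)
    (fun i _ => by positivity) (Finset.mem_univ k))
  exact Finset.single_le_sum (f := fun j => ‖M k j‖ ^ 2) (fun i _ => by positivity)
    (Finset.mem_univ l)

theorem sqLen_eq_zero {v : Fin q → ℂ} (h : sqLen v = 0) : v = 0 := by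
  by_contra h0
  exact (sqLen_pos h0).ne' h

/-- Coercivity gives `δ ‖v‖ ≤ ‖G v‖`, so each of the `q` columns of the inverse has length at most
`1 / δ`; hence the factor `√q`. -/
theorem inv_of_coercive {G : Matrix (Fin q) (Fin q) ℂ} {δ : ℝ} (hδ : 0 < δ)
    (hG : ∀ v, δ * sqLen v ≤ (quadForm G v).re) : G⁻¹ * G = 1 ∧ ‖G⁻¹‖ ≤ √q / δ := by
  have hdet : IsUnit G.det := by
    rw [← isUnit_iff_isUnit_det, ← mulVec_injective_iff_isUnit]
    refine (injective_iff_map_eq_zero G.mulVecLin).2 fun v hv => ?_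
    have hv' : G *ᵥ v = 0 := hv
    have h1 := hG v
    rw [quadForm, hv', dotProduct_zero, Complex.zero_re] at h1
    have := sqLen_nonneg v
    exact sqLen_eq_zero (by nlinarith)
  have key : ∀ v, δ ^ 2 * sqLen v ≤ sqLen (G *ᵥ v) := by
    intro v
    have h0 := sqLen_nonneg v
    have h1 : (δ * sqLen v) ^ 2 ≤ sqLen v * sqLen (G *ᵥ v) := by
      calc (δ * sqLen v) ^ 2 ≤ ‖quadForm G v‖ ^ 2 := by
            gcongr; exact (hG v).trans (Complex.re_le_norm _)
        _ ≤ _ := norm_star_dotProduct_sq_le _ _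
    rcases h0.eq_or_lt with h | h
    · rw [← h, mul_zero]; exact sqLen_nonneg _
    · nlinarith
  refine ⟨nonsing_inv_mul G hdet, ?_⟩
  refine (abs_le_of_sq_le_sq' ?_ (by positivity)).2
  rw [frobenius_sq, Finset.sum_comm, div_pow, Real.sq_sqrt (by positivity), le_div_iff₀ (by positivity),
    Finset.sum_mul]
  calc ∑ j, (∑ i, ‖G⁻¹ i j‖ ^ 2) * δ ^ 2 ≤ ∑ _j : Fin q, (1 : ℝ) := by
        refine Finset.sum_le_sum fun j _ => ?_
        have h1 := key (G⁻¹ *ᵥ Pi.single j 1)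
        rw [mulVec_mulVec, mul_nonsing_inv G hdet, one_mulVec] at h1
        have h2 : sqLen (Pi.single j 1 : Fin q → ℂ) = 1 := by
          rw [sqLen, Finset.sum_eq_single j] <;> simp +contextual
        rw [h2, mul_comm] at h1
        simpa [sqLen] using h1
    _ = q := by simp

theorem continuous_regularizedCov (Q : Matrix (Fin q) (Fin q) ℂ) (n : ℕ) :
    Continuous (regularizedCov Q n) := by
  unfold regularizedCov sampleCov
  have h : ∀ m, Continuous fun x : ℕ → Fin q → ℂ => vecMulVec (x m) (star (x m)) := fun m =>
    Continuous.matrix_vecMulVec (continuous_apply m) (continuous_apply m).star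
  have h2 : Continuous fun x : ℕ → Fin q → ℂ =>
      ∑ m ∈ Finset.range n, vecMulVec (x m) (star (x m)) := continuous_finsetSum _ fun m _ => h m
  exact (h2.const_smul (n : ℂ)⁻¹).add continuous_const

theorem measurableSet_wellConditioned (δ : ℝ) (Q : Matrix (Fin q) (Fin q) ℂ) (n : ℕ) :
    MeasurableSet (wellConditioned δ Q n) := by
  refine IsClosed.measurableSet ?_
  rw [wellConditioned, Set.ofPred_forall]
  refine isClosed_iInter fun v => isClosed_le continuous_const ?_
  refine Complex.continuous_re.comp ?_
  unfold quadForm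
  exact Continuous.dotProduct continuous_const
    ((continuous_regularizedCov Q n).matrix_mulVec continuous_const)

/-- The inverse is the adjugate divided by the determinant, also for singular matrices, where it is
`0`. -/
theorem measurable_regularizedCov_inv (Q : Matrix (Fin q) (Fin q) ℂ) (n : ℕ) (k l : Fin q) :
    Measurable fun x => (regularizedCov Q n x)⁻¹ k l := by
  have hc := continuous_regularizedCov Q n
  simp only [Matrix.inv_def, Matrix.smul_apply, Ring.inverse_eq_inv', smul_eq_mul]
  have h1 : Measurable fun x => (regularizedCov Q n x).det := hc.matrix_det.measurable
  have h2 : Measurable fun x => (regularizedCov Q n x).adjugate k l :=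
    (hc.matrix_adjugate.matrix_elem k l).measurable
  exact h1.inv.mul h2

theorem measurable_subspaceLeakage (Q : Matrix (Fin q) (Fin q) ℂ) (n : ℕ) (k l : Fin q) :
    Measurable fun p : (ℕ → Fin q → ℂ) × (ℕ → Fin q → ℂ) => subspaceLeakage Q n p.1 p.2 k l := by
  simp only [subspaceLeakage, Matrix.mul_apply]
  refine Finset.measurable_sum _ fun j _ => ?_
  refine ((measurable_regularizedCov_inv Q n k j).comp measurable_fst).mul ?_
  simp only [sampleCrossCov, Matrix.smul_apply, Matrix.sum_apply, vecMulVec_apply, Pi.star_apply,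
    smul_eq_mul]
  have h1 : ∀ m j, Measurable fun p : (ℕ → Fin q → ℂ) × (ℕ → Fin q → ℂ) => p.1 m j :=
    fun m j => by fun_prop
  have h2 : ∀ m j, Measurable fun p : (ℕ → Fin q → ℂ) × (ℕ → Fin q → ℂ) => p.2 m j :=
    fun m j => by fun_prop
  refine Measurable.const_mul (Finset.measurable_sum _ fun m _ => ?_) _
  exact (h1 m j).mul (continuous_star.measurable.comp (h2 m l))

theorem measurable_norm_of_entries {α : Type*} [MeasurableSpace α]
    {M : α → Matrix (Fin q) (Fin q) ℂ} (hM : ∀ k l, Measurable fun x => M x k l) :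
    Measurable fun x => ‖M x‖ := by
  have : ∀ x, ‖M x‖ = √(∑ i, ∑ j, ‖M x i j‖ ^ 2) := fun x => by
    rw [← frobenius_sq, Real.sqrt_sq (norm_nonneg _)]
  simp only [this]
  fun_prop

theorem measurable_quadForm_of_entries {α : Type*} [MeasurableSpace α]
    {M : α → Matrix (Fin q) (Fin q) ℂ} (hM : ∀ k l, Measurable fun x => M x k l)
    (v : Fin q → ℂ) : Measurable fun x => quadForm (M x) v := by
  simp only [quadForm, dotProduct, mulVec]
  fun_prop

theorem measurable_conj_of_entries {α : Type*} [MeasurableSpace α]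
    {M : α → Matrix (Fin q) (Fin q) ℂ} (hM : ∀ k l, Measurable fun x => M x k l)
    (B : Matrix (Fin q) (Fin q) ℂ) (k l : Fin q) :
    Measurable fun x => ((M x)ᴴ * B * M x) k l := by
  simp only [Matrix.mul_apply, conjTranspose_apply]
  fun_prop

/-- The regression weights of the leakage. -/
def leakageWeight (Q : Matrix (Fin q) (Fin q) ℂ) (n : ℕ) (x : ℕ → Fin q → ℂ) (m : ℕ) :
    Fin q → ℂ :=
  (n : ℂ)⁻¹ • ((regularizedCov Q n x)⁻¹ *ᵥ x m)

/-- The weights depend only on the inner data. With these frozen, the leakage is linear in the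
conjugated noise vectors. -/
theorem subspaceLeakage_eq_sum (Q : Matrix (Fin q) (Fin q) ℂ) (n : ℕ) (x z : ℕ → Fin q → ℂ) :
    subspaceLeakage Q n x z =
      ∑ m ∈ Finset.range n, vecMulVec (leakageWeight Q n x m) (star (z m)) := by
  simp only [subspaceLeakage, sampleCrossCov, leakageWeight, mul_smul_comm, Finset.smul_sum,
    Matrix.mul_sum, mul_vecMulVec, smul_vecMulVec]

theorem sum_vecMulVec_leakageWeight (Q : Matrix (Fin q) (Fin q) ℂ) (n : ℕ) (x : ℕ → Fin q → ℂ) :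
    ∑ m ∈ Finset.range n, vecMulVec (leakageWeight Q n x m) (star (leakageWeight Q n x m)) =
      (n : ℂ)⁻¹ • ((regularizedCov Q n x)⁻¹ * sampleCov n x * (regularizedCov Q n x)⁻¹ᴴ) := by
  simp only [leakageWeight, sampleCov, mul_smul_comm, smul_mul_assoc, Finset.smul_sum,
    Matrix.mul_sum, Matrix.sum_mul, mul_vecMulVec, smul_vecMulVec, vecMulVec_mul, star_smul,
    star_mulVec, vecMulVec_smul, star_inv₀, star_natCast]

theorem regularizedCov_isHermitian {Q : Matrix (Fin q) (Fin q) ℂ} (hQ : Qᴴ = Q) (n : ℕ)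
    (x : ℕ → Fin q → ℂ) : (regularizedCov Q n x).IsHermitian := by
  have h : (sampleCov n x)ᴴ = sampleCov n x := by
    simp [sampleCov, conjTranspose_sum, conjTranspose_smul, conjTranspose_vecMulVec]
  rw [IsHermitian, regularizedCov, conjTranspose_add, h, conjTranspose_sub, conjTranspose_one, hQ]

/-- With `G` the regularized covariance, the Gram matrix of the weights is `n⁻¹ G⁻¹ (G - (1 - Q))
G⁻¹ᴴ`, so the sample covariance cancels against one inverse. No upper bound on the heavy-tailed data
is needed, only the lower bound `δ`. -/
theorem sum_leakageWeight_sq_le {δ : ℝ} (hδ : 0 < δ) {Q : Matrix (Fin q) (Fin q) ℂ} (n : ℕ)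
    {x : ℕ → Fin q → ℂ} (hx : x ∈ wellConditioned δ Q n) (k : Fin q) :
    ∑ m ∈ Finset.range n, ‖leakageWeight Q n x m k‖ ^ 2 ≤
      (√q / δ + (√q / δ) ^ 2 * ‖1 - Q‖) / n := by
  obtain ⟨h1, h2⟩ := inv_of_coercive hδ hx
  set G := regularizedCov Q n x with hG
  have e := congrFun (congrFun (sum_vecMulVec_leakageWeight Q n x) k) k
  have e2 : ((∑ m ∈ Finset.range n, ‖leakageWeight Q n x m k‖ ^ 2 : ℝ) : ℂ) =
      ((n : ℂ)⁻¹ • (G⁻¹ * sampleCov n x * G⁻¹ᴴ)) k k := by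
    rw [← e, Matrix.sum_apply]
    simp [vecMulVec_apply, Complex.mul_conj, Complex.normSq_eq_norm_sq]
  have e3 : G⁻¹ * sampleCov n x * G⁻¹ᴴ = G⁻¹ᴴ - G⁻¹ * (1 - Q) * G⁻¹ᴴ := by
    have : sampleCov n x = G - (1 - Q) := by rw [hG, regularizedCov]; abel
    rw [this, Matrix.mul_sub, h1, Matrix.sub_mul, Matrix.one_mul]
  have e4 : ‖G⁻¹ * sampleCov n x * G⁻¹ᴴ‖ ≤ √q / δ + (√q / δ) ^ 2 * ‖1 - Q‖ := by
    rw [e3]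
    refine (norm_sub_le _ _).trans ?_
    rw [frobenius_norm_conjTranspose]
    gcongr
    calc _ ≤ ‖G⁻¹ * (1 - Q)‖ * ‖G⁻¹ᴴ‖ := frobenius_norm_mul _ _
      _ ≤ (‖G⁻¹‖ * ‖1 - Q‖) * ‖G⁻¹‖ := by
          rw [frobenius_norm_conjTranspose]; gcongr; exact frobenius_norm_mul _ _
      _ ≤ ((√q / δ) * ‖1 - Q‖) * (√q / δ) := by gcongr
      _ = _ := by ring
  calc ∑ m ∈ Finset.range n, ‖leakageWeight Q n x m k‖ ^ 2
      = ‖((∑ m ∈ Finset.range n, ‖leakageWeight Q n x m k‖ ^ 2 : ℝ) : ℂ)‖ := by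
        rw [Complex.norm_real, Real.norm_of_nonneg (by positivity)]
    _ ≤ (n : ℝ)⁻¹ * ‖(G⁻¹ * sampleCov n x * G⁻¹ᴴ) k k‖ := by
        rw [e2, Matrix.smul_apply, smul_eq_mul, norm_mul, norm_inv, Complex.norm_natCast]
    _ ≤ (n : ℝ)⁻¹ * (√q / δ + (√q / δ) ^ 2 * ‖1 - Q‖) := by
        gcongr; exact (norm_entry_le _ k k).trans e4
    _ = _ := by ring

end

section

open scoped Matrix.Norms.Frobenius

variable {Ω : Type*} [MeasurableSpace Ω] {P : Measure Ω} {q : ℕ}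

theorem hermForm_sq_smul (s : ℝ) (M : Matrix (Fin q) (Fin q) ℂ) (w : Fin q → ℂ) :
    hermForm ((s : ℂ) ^ 2 • M) w = s ^ 2 * (quadForm M w).re := by
  rw [← Complex.ofReal_pow, hermForm_ofReal_smul]; rfl

theorem IsCircularGaussian.projection {X : Ω → Fin q → ℂ} {s : ℝ}
    (hX : IsCircularGaussian X ((s : ℂ) ^ 2 • (1 : Matrix (Fin q) (Fin q) ℂ)) P)
    {Q : Matrix (Fin q) (Fin q) ℂ} (hQ : Qᴴ = Q) (hQQ : Q * Q = Q) :
    IsCircularGaussian (fun ω => Q *ᵥ X ω) ((s : ℂ) ^ 2 • Q) P where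
  aemeasurable := by
    have mQ : Measurable fun x : Fin q → ℂ => Q *ᵥ x := by
      refine measurable_pi_iff.2 fun i => ?_
      simp only [mulVec, dotProduct]; fun_prop
    exact mQ.comp_aemeasurable hX.aemeasurable
  map_eq w := by
    simp only [IsCircularGaussian.star_dotProduct_mulVec_of_projection hQ]
    rw [hX.map_eq, IsCircularGaussian.hermForm_smul_one, hermForm_sq_smul,
      sqLen_mulVec_of_projection hQ hQQ, Complex.ofReal_re]

variable [IsProbabilityMeasure P] {Q : Matrix (Fin q) (Fin q) ℂ} {s : ℝ}
  {z : ℕ → Ω → Fin q → ℂ}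

theorem stdGaussianMoment_four_nonneg : 0 ≤ stdGaussianMoment 4 :=
  integral_nonneg fun x => by positivity

theorem noise_linearCombination (hQ : Qᴴ = Q) (hQQ : Q * Q = Q)
    (hz : ∀ m, IsCircularGaussian (z m) ((s : ℂ) ^ 2 • Q) P) (hm : ∀ m, Measurable (z m))
    (hi : iIndepFun z P) (w : Fin q → ℂ) (n : ℕ) (a : ℕ → ℂ) :
    Integrable (fun ω => ‖∑ m ∈ Finset.range n, a m * (star (z m ω) ⬝ᵥ w)‖ ^ 4) P ∧
    ∫ ω, (∑ m ∈ Finset.range n, a m * (star (z m ω) ⬝ᵥ w)).re ∂P = 0 ∧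
    ∫ ω, ‖∑ m ∈ Finset.range n, a m * (star (z m ω) ⬝ᵥ w)‖ ^ 4 ∂P ≤
      12 * (s ^ 2 * (quadForm Q w).re * (√(stdGaussianMoment 4) / 2) *
        ∑ m ∈ Finset.range n, ‖a m‖ ^ 2) ^ 2 := by
  have hw : ∀ w, 0 ≤ hermForm ((s : ℂ) ^ 2 • Q) w := fun w => by
    rw [hermForm_sq_smul]
    have := re_quadForm_projection_nonneg hQ hQQ w
    positivity
  have hw0 := re_quadForm_projection_nonneg hQ hQQ w
  have md : Measurable fun x : Fin q → ℂ => star x ⬝ᵥ w := by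
    simp only [dotProduct, Pi.star_apply]; fun_prop
  have hi' : iIndepFun (fun m ω => star (z m ω) ⬝ᵥ w) P := hi.comp (fun _ x => star x ⬝ᵥ w)
    fun _ => md
  have e : ∀ m (a : ℂ), (fun ω => (a * (star (z m ω) ⬝ᵥ w)).re) =
      fun ω => (star (a • w) ⬝ᵥ z m ω).re := fun m a => by
    ext ω; rw [star_smul_dotProduct_re]
  refine linearCombination_moments hi' (fun m => md.comp (hm m)) (by positivity) ?_ ?_ ?_ n a
  · intro m a
    rw [e]; exact (hz m).memLp_re _ 4
  · intro m a
    rw [e]; exact (hz m).integral_re _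
  · intro m a
    have : ∀ ω, (a * (star (z m ω) ⬝ᵥ w)).re = (star (a • w) ⬝ᵥ z m ω).re :=
      fun ω => (star_smul_dotProduct_re _ _ _).symm
    simp only [this]
    rw [(hz m).integral_re_pow_four (hw _), hermForm_smul, hermForm_sq_smul]
    have h4 := Real.sq_sqrt stdGaussianMoment_four_nonneg
    refine le_of_eq ?_
    calc _ = (‖a‖ ^ 2 * (s ^ 2 * (quadForm Q w).re) / 2) ^ 2 * √(stdGaussianMoment 4) ^ 2 := by
          rw [h4]
      _ = _ := by ring

theorem norm_pow_four_le (M : Matrix (Fin q) (Fin q) ℂ) :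
    ‖M‖ ^ 4 ≤ (q : ℝ) ^ 2 * ∑ k, ∑ l, ‖M k l‖ ^ 4 := by
  have h := sq_sum_le_card_mul_sum_sq (s := (Finset.univ : Finset (Fin q × Fin q)))
    (f := fun x => ‖M x.1 x.2‖ ^ 2)
  simp only [Fintype.sum_prod_type] at h
  rw [← frobenius_sq] at h
  simp only [← pow_mul, Finset.card_univ, Fintype.card_prod, Fintype.card_fin] at h
  norm_num at h
  calc _ ≤ _ := h
    _ = _ := by ring

/-- Fourth moment of the leakage for fixed clutter data. -/
theorem integral_subspaceLeakage_pow_four_le (hQ : Qᴴ = Q) (hQQ : Q * Q = Q)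
    (hz : ∀ m, IsCircularGaussian (z m) ((s : ℂ) ^ 2 • (1 - Q)) P) (hm : ∀ m, Measurable (z m))
    (hi : iIndepFun z P) {δ : ℝ} (hδ : 0 < δ) {n : ℕ} {x : ℕ → Fin q → ℂ}
    (hx : x ∈ wellConditioned δ Q n) :
    Integrable (fun ω => ‖subspaceLeakage Q n x fun m => z m ω‖ ^ 4) P ∧
    ∫ ω, ‖subspaceLeakage Q n x fun m => z m ω‖ ^ 4 ∂P ≤
      12 * q ^ 4 * (√(stdGaussianMoment 4) / 2 * (√q / δ + (√q / δ) ^ 2 * ‖1 - Q‖)) ^ 2 *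
        (s ^ 4 / n ^ 2) := by
  have hQ1 : (1 - Q)ᴴ = 1 - Q := by simp [hQ]
  have hQQ1 : (1 - Q) * (1 - Q) = 1 - Q := by simp [sub_mul, mul_sub, hQQ]
  have key : ∀ k l, Integrable (fun ω => ‖subspaceLeakage Q n x (fun m => z m ω) k l‖ ^ 4) P ∧
      ∫ ω, ‖subspaceLeakage Q n x (fun m => z m ω) k l‖ ^ 4 ∂P ≤
        12 * (√(stdGaussianMoment 4) / 2 * (√q / δ + (√q / δ) ^ 2 * ‖1 - Q‖)) ^ 2 *
        (s ^ 4 / n ^ 2) := by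
    intro k l
    obtain ⟨h1, -, h3⟩ := noise_linearCombination hQ1 hQQ1 hz hm hi (Pi.single l 1) n
      fun m => leakageWeight Q n x m k
    have e : ∀ ω, ∑ m ∈ Finset.range n, leakageWeight Q n x m k *
        (star (z m ω) ⬝ᵥ Pi.single l 1) = subspaceLeakage Q n x (fun m => z m ω) k l := by
      intro ω
      rw [subspaceLeakage_eq_sum, Matrix.sum_apply]
      simp [vecMulVec_apply]
    simp only [e] at h1 h3
    refine ⟨h1, h3.trans ?_⟩
    have b1 : (quadForm (1 - Q) (Pi.single l 1)).re ≤ 1 := by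
      have a1 := re_quadForm_projection_nonneg hQ hQQ (Pi.single l 1)
      rw [quadForm_sub, Complex.sub_re]
      have : (quadForm (1 : Matrix (Fin q) (Fin q) ℂ) (Pi.single l 1)).re = 1 := by
        simp [quadForm]
      linarith
    have b0 := re_quadForm_projection_nonneg hQ1 hQQ1 (Pi.single l 1)
    have b2 := sum_leakageWeight_sq_le hδ n hx k
    calc _ ≤ 12 * (s ^ 2 * 1 * (√(stdGaussianMoment 4) / 2) *
          ((√q / δ + (√q / δ) ^ 2 * ‖1 - Q‖) / n)) ^ 2 := by gcongr
      _ = _ := by ring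
  have hint : Integrable (fun ω => (q : ℝ) ^ 2 *
      ∑ k, ∑ l, ‖subspaceLeakage Q n x (fun m => z m ω) k l‖ ^ 4) P :=
    (integrable_finsetSum _ fun k _ => integrable_finsetSum _ fun l _ => (key k l).1).const_mul _
  have hmeas : Measurable fun ω => ‖subspaceLeakage Q n x fun m => z m ω‖ := by
    refine measurable_norm_of_entries fun k l => ?_
    have hg : Measurable fun ω => (x, fun m => z m ω) :=
      measurable_const.prodMk (measurable_pi_iff.2 hm)
    have := (measurable_subspaceLeakage Q n k l).comp hg
    simpa only [Function.comp_def] using this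
  refine ⟨hint.mono' (hmeas.pow_const 4).aestronglyMeasurable (Eventually.of_forall fun ω => ?_), ?_⟩
  · rw [Real.norm_of_nonneg (by positivity)]; exact norm_pow_four_le _
  · refine (integral_mono_of_nonneg (Eventually.of_forall fun ω => by positivity) hint
      (Eventually.of_forall fun ω => norm_pow_four_le _)).trans ?_
    rw [integral_const_mul, integral_finsetSum _ fun k _ => integrable_finsetSum _ fun l _ =>
      (key k l).1]
    calc _ ≤ (q : ℝ) ^ 2 * ∑ _k : Fin q, ∑ _l : Fin q, 12 * (√(stdGaussianMoment 4) / 2 *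
          (√q / δ + (√q / δ) ^ 2 * ‖1 - Q‖)) ^ 2 * (s ^ 4 / n ^ 2) := by
          refine mul_le_mul_of_nonneg_left (Finset.sum_le_sum fun k _ => ?_) (by positivity)
          rw [integral_finsetSum _ fun l _ => (key k l).1]
          exact Finset.sum_le_sum fun l _ => (key k l).2
      _ = _ := by
        simp only [Finset.sum_const, Finset.card_univ, Fintype.card_fin, nsmul_eq_mul]; ring

/-- The leakage is centred for fixed clutter data. -/
theorem integral_re_quadForm_subspaceLeakage (hQ : Qᴴ = Q) (hQQ : Q * Q = Q)
    (hz : ∀ m, IsCircularGaussian (z m) ((s : ℂ) ^ 2 • (1 - Q)) P) (hm : ∀ m, Measurable (z m))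
    (hi : iIndepFun z P) (n : ℕ) (x : ℕ → Fin q → ℂ) (d : Fin q → ℂ) :
    ∫ ω, (quadForm (subspaceLeakage Q n x fun m => z m ω) d).re ∂P = 0 := by
  have hQ1 : (1 - Q)ᴴ = 1 - Q := by simp [hQ]
  have hQQ1 : (1 - Q) * (1 - Q) = 1 - Q := by simp [sub_mul, mul_sub, hQQ]
  have h := (noise_linearCombination hQ1 hQQ1 hz hm hi d n
    fun m => star d ⬝ᵥ leakageWeight Q n x m).2.1
  rw [← h]
  congr 1
  ext ω
  rw [subspaceLeakage_eq_sum, quadForm, sum_mulVec, dotProduct_sum]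
  congr 1
  refine Finset.sum_congr rfl fun m _ => ?_
  rw [vecMulVec_mulVec]
  simp [dotProduct_smul, mul_comm]

/-- The mean energy of the leakage through `B` for fixed clutter data. -/
theorem integral_quadForm_conj_subspaceLeakage (hQ : Qᴴ = Q) (hQQ : Q * Q = Q)
    {B : Matrix (Fin q) (Fin q) ℂ} (hQB : Q * B = B)
    (hz : ∀ m, IsCircularGaussian (z m) ((s : ℂ) ^ 2 • (1 - Q)) P) (hm : ∀ m, Measurable (z m))
    (hi : iIndepFun z P) {δ : ℝ} (hδ : 0 < δ) {n : ℕ} {x : ℕ → Fin q → ℂ}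
    (hx : x ∈ wellConditioned δ Q n) (hxQ : ∀ m, Q *ᵥ x m = x m) (d : Fin q → ℂ) :
    ∫ ω, (quadForm ((subspaceLeakage Q n x fun m => z m ω)ᴴ * B *
      (subspaceLeakage Q n x fun m => z m ω)) d).re ∂P =
      s ^ 2 * (quadForm (1 - Q) d).re / n * ((regularizedCov Q n x)⁻¹ * B).trace.re := by
  have hQ1 : (1 - Q)ᴴ = 1 - Q := by simp [hQ]
  have hQQ1 : (1 - Q) * (1 - Q) = 1 - Q := by simp [sub_mul, mul_sub, hQQ]
  set W : ℕ → Ω → ℂ := fun m ω => star (z m ω) ⬝ᵥ d with hW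
  set α := leakageWeight Q n x with hα
  have md : Measurable fun x : Fin q → ℂ => star x ⬝ᵥ d := by
    simp only [dotProduct, Pi.star_apply]; fun_prop
  have hiW : iIndepFun W P := hi.comp (fun _ x => star x ⬝ᵥ d) fun _ => md
  have hmW : ∀ m, Measurable (W m) := fun m => md.comp (hm m)
  have hw : ∀ w, 0 ≤ hermForm ((s : ℂ) ^ 2 • (1 - Q)) w := fun w => by
    rw [hermForm_sq_smul]
    have := re_quadForm_projection_nonneg hQ1 hQQ1 w
    positivity
  have hL2 : ∀ m, MemLp (W m) 2 P := fun m => by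
    rw [memLp_two_iff_integrable_sq_norm (hmW m).aestronglyMeasurable]
    exact ((hz m).integral_norm_sq (hw d)).1
  have hW0 : ∀ m, ∫ ω, W m ω ∂P = 0 := by
    intro m
    have hint : Integrable (W m) P := (hL2 m).integrable (by norm_num)
    have r0 : ∫ ω, (W m ω).re ∂P = 0 := by
      rw [← (hz m).integral_re ((1 : ℂ) • d)]
      congr 1; ext ω; rw [star_smul_dotProduct_re, one_mul]
    have i0 : ∫ ω, (W m ω).im ∂P = 0 := by
      rw [← (hz m).integral_re ((-Complex.I) • d)]
      congr 1; ext ω; rw [star_smul_dotProduct_re]; simp [hW]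
    have e1 := integral_re hint
    have e2 := integral_im hint
    simp only [RCLike.re_eq_complex_re, RCLike.im_eq_complex_im] at e1 e2
    exact Complex.ext (by rw [← e1, r0]; rfl) (by rw [← e2, i0]; rfl)
  have hprod : ∀ m l, Integrable (fun ω => star (W m ω) * W l ω) P := fun m l =>
    (hL2 m).star.integrable_mul (hL2 l)
  have hdiag : ∀ m, ∫ ω, star (W m ω) * W m ω ∂P = (s ^ 2 * (quadForm (1 - Q) d).re : ℝ) := by
    intro m
    rw [← hermForm_sq_smul, ← ((hz m).integral_norm_sq (hw d)).2, ← integral_complex_ofReal]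
    congr 1; ext ω
    rw [Complex.star_def, Complex.conj_mul', Complex.ofReal_pow]
  have hJd : ∀ ω, (subspaceLeakage Q n x fun m => z m ω) *ᵥ d =
      ∑ m ∈ Finset.range n, W m ω • α m := by
    intro ω
    rw [subspaceLeakage_eq_sum, sum_mulVec]
    refine Finset.sum_congr rfl fun m _ => ?_
    rw [vecMulVec_mulVec]
    simp [hW, hα]
  have hexp : ∀ ω, quadForm ((subspaceLeakage Q n x fun m => z m ω)ᴴ * B *
      (subspaceLeakage Q n x fun m => z m ω)) d = ∑ m ∈ Finset.range n, ∑ l ∈ Finset.range n,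
        star (W m ω) * W l ω * (star (α m) ⬝ᵥ B *ᵥ α l) := by
    intro ω
    rw [Matrix.mul_assoc, quadForm_conjTranspose_mul, ← mulVec_mulVec, hJd, star_sum, mulVec_sum,
      sum_dotProduct]
    refine Finset.sum_congr rfl fun m _ => ?_
    rw [dotProduct_sum]
    refine Finset.sum_congr rfl fun l _ => ?_
    rw [mulVec_smul, star_smul, smul_dotProduct, dotProduct_smul, smul_eq_mul, smul_eq_mul]
    ring
  have hi2 : ∀ m l, Integrable (fun ω => star (W m ω) * W l ω * (star (α m) ⬝ᵥ B *ᵥ α l)) P :=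
    fun m l => (hprod m l).mul_const _
  have hint : Integrable (fun ω => quadForm ((subspaceLeakage Q n x fun m => z m ω)ᴴ * B *
      (subspaceLeakage Q n x fun m => z m ω)) d) P := by
    simp only [hexp]
    exact integrable_finsetSum _ fun m _ => integrable_finsetSum _ fun l _ => hi2 m l
  have hval : ∫ ω, quadForm ((subspaceLeakage Q n x fun m => z m ω)ᴴ * B *
      (subspaceLeakage Q n x fun m => z m ω)) d ∂P =
      (s ^ 2 * (quadForm (1 - Q) d).re : ℝ) *
        ∑ m ∈ Finset.range n, star (α m) ⬝ᵥ B *ᵥ α m := by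
    simp only [hexp]
    rw [integral_finsetSum _ fun m _ => integrable_finsetSum _ fun l _ => hi2 m l, Finset.mul_sum]
    refine Finset.sum_congr rfl fun m hm' => ?_
    rw [integral_finsetSum _ fun l _ => hi2 m l, Finset.sum_eq_single m]
    · rw [integral_mul_const, hdiag]
    · intro l _ hl
      rw [integral_mul_const, integral_conj_mul_of_indep hiW hmW hW0 hl.symm, zero_mul]
    · exact fun h => absurd hm' h
  -- By the same cancellation the Gram matrix is `n⁻¹ (G⁻¹ - G⁻¹ (1 - Q) G⁻¹)`. Since `G⁻¹` commutes
  -- with the block structure and `(1 - Q) B = 0`, only `n⁻¹ tr (G⁻¹ B)` survives.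
  have htr : ∑ m ∈ Finset.range n, star (α m) ⬝ᵥ B *ᵥ α m =
      (n : ℂ)⁻¹ * ((regularizedCov Q n x)⁻¹ * B).trace := by
    obtain ⟨h1, -⟩ := inv_of_coercive hδ hx
    set G := regularizedCov Q n x with hG
    have hGh : G⁻¹ᴴ = G⁻¹ := ((regularizedCov_isHermitian hQ n x).inv).eq
    have hBQ1 : (1 - Q) * B = 0 := by rw [sub_mul, one_mul, hQB, sub_self]
    have hS : Q * sampleCov n x = sampleCov n x := by
      simp only [sampleCov, mul_smul_comm, Matrix.mul_sum, mul_vecMulVec, hxQ]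
    have hG1 : (1 - Q) * G = 1 - Q := by
      rw [hG, regularizedCov, mul_add, sub_mul, one_mul, hS, sub_self, zero_add, hQQ1]
    have hG2 : (1 - Q) * G⁻¹ = 1 - Q := by
      have h1' : G * G⁻¹ = 1 := mul_eq_one_comm.1 h1
      conv_lhs => rw [← hG1]
      rw [Matrix.mul_assoc, h1', Matrix.mul_one]
    have e1 : ∀ m, star (α m) ⬝ᵥ B *ᵥ α m = (vecMulVec (α m) (star (α m)) * B).trace := by
      intro m
      rw [vecMulVec_mul, trace_vecMulVec, dotProduct_mulVec, dotProduct_comm]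
    simp only [e1]
    rw [← trace_sum, ← Finset.sum_mul, sum_vecMulVec_leakageWeight, smul_mul_assoc, trace_smul,
      smul_eq_mul, ← hG, hGh]
    have : sampleCov n x = G - (1 - Q) := by rw [hG, regularizedCov]; abel
    have e2 : G⁻¹ * sampleCov n x * G⁻¹ * B = G⁻¹ * B := by
      rw [this, Matrix.mul_sub, h1, Matrix.sub_mul, Matrix.one_mul, Matrix.mul_assoc G⁻¹, hG2,
        Matrix.sub_mul, Matrix.mul_assoc G⁻¹ (1 - Q), hBQ1, Matrix.mul_zero, sub_zero]
    rw [e2]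
  have e1 := integral_re hint
  simp only [RCLike.re_eq_complex_re] at e1
  rw [e1, hval, htr, Complex.re_ofReal_mul, ← Complex.ofReal_natCast, ← Complex.ofReal_inv,
    Complex.re_ofReal_mul]
  ring

end

end

/-! ### Lower bounds and continuity for the regularized covariance. -/

noncomputable section

section

open scoped Matrix.Norms.Frobenius

variable {q : ℕ}

theorem quadForm_vecMulVec (x v : Fin q → ℂ) :
    quadForm (vecMulVec x (star x)) v = (‖star x ⬝ᵥ v‖ ^ 2 : ℝ) := by
  have h : star v ⬝ᵥ x = star (star x ⬝ᵥ v) := star_dotProduct v x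
  rw [quadForm, vecMulVec_mulVec, ← Complex.normSq_eq_norm_sq, ← Complex.mul_conj,
    ← Complex.star_def, ← h]
  simp

theorem quadForm_smul (r : ℂ) (M : Matrix (Fin q) (Fin q) ℂ) (v : Fin q → ℂ) :
    quadForm (r • M) v = r * quadForm M v := by
  rw [quadForm, smul_mulVec, dotProduct_smul, smul_eq_mul, quadForm]

theorem quadForm_sum {ι : Type*} (s : Finset ι) (M : ι → Matrix (Fin q) (Fin q) ℂ)
    (v : Fin q → ℂ) : quadForm (∑ i ∈ s, M i) v = ∑ i ∈ s, quadForm (M i) v := by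
  simp [quadForm, sum_mulVec, dotProduct_sum]

theorem re_quadForm_sampleCov (n : ℕ) (x : ℕ → Fin q → ℂ) (v : Fin q → ℂ) :
    (quadForm (sampleCov n x) v).re =
      (n : ℝ)⁻¹ * ∑ m ∈ Finset.range n, ‖star (x m) ⬝ᵥ v‖ ^ 2 := by
  rw [sampleCov, quadForm_smul, quadForm_sum, ← Complex.ofReal_natCast, ← Complex.ofReal_inv,
    Complex.re_ofReal_mul, Complex.re_sum]
  simp only [quadForm_vecMulVec, Complex.ofReal_re]

theorem sqLen_smul (r : ℂ) (v : Fin q → ℂ) : sqLen (r • v) = ‖r‖ ^ 2 * sqLen v := by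
  simp [sqLen, mul_pow, Finset.mul_sum]

theorem re_quadForm_smul_vec (r : ℝ) (M : Matrix (Fin q) (Fin q) ℂ) (v : Fin q → ℂ) :
    (quadForm M ((r : ℂ) • v)).re = r ^ 2 * (quadForm M v).re := by
  have : quadForm M ((r : ℂ) • v) = ((r ^ 2 : ℝ) : ℂ) * quadForm M v := by
    simp only [quadForm, mulVec_smul, star_smul, smul_dotProduct, dotProduct_smul, smul_eq_mul,
      Complex.star_def, Complex.conj_ofReal, Complex.ofReal_pow]
    ring
  rw [this, Complex.re_ofReal_mul]

/-- Minimize over the compact unit sphere and use homogeneity. For `q = 0` the sphere is empty and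
any constant works. -/
theorem exists_coercive {G : Matrix (Fin q) (Fin q) ℂ}
    (hG : ∀ v ≠ 0, 0 < (quadForm G v).re) :
    ∃ δ, 0 < δ ∧ ∀ v, δ * sqLen v ≤ (quadForm G v).re := by
  have c1 : Continuous (sqLen : (Fin q → ℂ) → ℝ) := by unfold sqLen; fun_prop
  have c2 : Continuous fun v : Fin q → ℂ => (quadForm G v).re := by
    refine Complex.continuous_re.comp ?_
    unfold quadForm
    exact Continuous.dotProduct continuous_star (continuous_const.matrix_mulVec continuous_id)
  have hK : IsCompact {v : Fin q → ℂ | sqLen v = 1} := by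
    refine (isCompact_closedBall (0 : Fin q → ℂ) 1).of_isClosed_subset
      (isClosed_eq c1 continuous_const) fun v hv => ?_
    rw [mem_closedBall_zero_iff, pi_norm_le_iff_of_nonneg zero_le_one]
    intro i
    rw [← abs_of_nonneg (norm_nonneg (v i)), ← sq_le_one_iff_abs_le_one, ← (show sqLen v = 1 from hv)]
    exact Finset.single_le_sum (f := fun i => ‖v i‖ ^ 2) (fun _ _ => by positivity)
      (Finset.mem_univ i)
  have scale : ∀ v ≠ (0 : Fin q → ℂ), sqLen (((√(sqLen v))⁻¹ : ℝ) • v : Fin q → ℂ) = 1 := by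
    intro v hv
    have := sqLen_pos hv
    rw [← Complex.coe_smul, sqLen_smul, Complex.norm_real, Real.norm_of_nonneg (by positivity),
      inv_pow, Real.sq_sqrt this.le, inv_mul_cancel₀ this.ne']
  rcases Set.eq_empty_or_nonempty {v : Fin q → ℂ | sqLen v = 1} with he | hne
  · refine ⟨1, one_pos, fun v => ?_⟩
    by_cases hv : v = 0
    · simp [hv, sqLen, quadForm]
    · exact absurd (scale v hv) fun h => by
        have : _ ∈ {v : Fin q → ℂ | sqLen v = 1} := h
        rw [he] at this; exact this
  · obtain ⟨w, hw, hmin⟩ := hK.exists_isMinOn hne c2.continuousOn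
    have hw0 : w ≠ 0 := fun h0 => by
      have : sqLen w = 1 := hw
      rw [h0] at this; simp [sqLen] at this
    refine ⟨(quadForm G w).re, hG w hw0, fun v => ?_⟩
    by_cases hv : v = 0
    · simp [hv, sqLen, quadForm]
    · have h1 := hmin (scale v hv)
      have h2 := sqLen_pos hv
      simp only [Set.mem_ofPred_eq] at h1
      rw [← Complex.coe_smul, re_quadForm_smul_vec, inv_pow, Real.sq_sqrt h2.le,
        inv_mul_eq_div, le_div_iff₀ h2] at h1
      exact h1

/-- From `|a + b|² ≥ |a|² / 2 - |b|²`: half of `4 δ` minus the energy `δ` of the perturbation leaves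
`δ`. -/
theorem wellConditioned_add {δ : ℝ} {Q : Matrix (Fin q) (Fin q) ℂ} (hQ : Qᴴ = Q) (hQQ : Q * Q = Q)
    {n : ℕ} {x y u : ℕ → Fin q → ℂ} (hy : y ∈ wellConditioned (4 * δ) Q n)
    (hx : ∀ m < n, x m = y m + u m)
    (hu : (n : ℝ)⁻¹ * ∑ m ∈ Finset.range n, sqLen (u m) ≤ δ) : x ∈ wellConditioned δ Q n := by
  intro v
  have h1 := hy v
  have hQ1 : (1 - Q)ᴴ = 1 - Q := by simp [hQ]
  have hQQ1 : (1 - Q) * (1 - Q) = 1 - Q := by simp [sub_mul, mul_sub, hQQ]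
  have h0 := re_quadForm_projection_nonneg hQ1 hQQ1 v
  rw [regularizedCov, quadForm_add, Complex.add_re, re_quadForm_sampleCov] at h1 ⊢
  have key : (n : ℝ)⁻¹ * ∑ m ∈ Finset.range n, (‖star (y m) ⬝ᵥ v‖ ^ 2 / 2 - sqLen (u m) * sqLen v) ≤
      (n : ℝ)⁻¹ * ∑ m ∈ Finset.range n, ‖star (x m) ⬝ᵥ v‖ ^ 2 := by
    refine mul_le_mul_of_nonneg_left (Finset.sum_le_sum fun m hm => ?_) (by positivity)
    rw [hx m (Finset.mem_range.1 hm), star_add, add_dotProduct]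
    have h2 := norm_star_dotProduct_sq_le (u m) v
    have h3 := norm_sub_le (star (y m) ⬝ᵥ v + star (u m) ⬝ᵥ v) (star (u m) ⬝ᵥ v)
    rw [add_sub_cancel_right] at h3
    have h4 : ‖star (y m) ⬝ᵥ v‖ ^ 2 ≤
        (‖star (y m) ⬝ᵥ v + star (u m) ⬝ᵥ v‖ + ‖star (u m) ⬝ᵥ v‖) ^ 2 := by gcongr
    nlinarith [sq_nonneg (‖star (y m) ⬝ᵥ v + star (u m) ⬝ᵥ v‖ - ‖star (u m) ⬝ᵥ v‖)]
  rw [Finset.sum_sub_distrib, ← Finset.sum_div, ← Finset.sum_mul, mul_sub, ← mul_div_assoc,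
    ← mul_assoc] at key
  have h5 := mul_le_mul_of_nonneg_right hu (sqLen_nonneg v)
  linarith

/-- The outer product `x xᴴ / (1 + ‖x‖²)`. -/
def boundedOuter (x : Fin q → ℂ) : Matrix (Fin q) (Fin q) ℂ :=
  (((1 + sqLen x)⁻¹ : ℝ) : ℂ) • vecMulVec x (star x)

theorem quadForm_boundedOuter (x v : Fin q → ℂ) :
    quadForm (boundedOuter x) v = ((1 + sqLen x)⁻¹ * ‖star x ⬝ᵥ v‖ ^ 2 : ℝ) := by
  rw [boundedOuter, quadForm_smul, quadForm_vecMulVec, Complex.ofReal_mul]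

/-- A bound independent of the law of the data; it makes all moments of the truncated matrices
available. -/
theorem norm_boundedOuter_apply_le (x : Fin q → ℂ) (k l : Fin q) : ‖boundedOuter x k l‖ ≤ 1 := by
  have h0 := sqLen_nonneg x
  have hs : ∀ k, ‖x k‖ ^ 2 ≤ sqLen x := fun k =>
    Finset.single_le_sum (f := fun i => ‖x i‖ ^ 2) (fun _ _ => by positivity) (Finset.mem_univ k)
  rw [boundedOuter, Matrix.smul_apply, vecMulVec_apply, smul_eq_mul, norm_mul, Complex.norm_real,
    Real.norm_of_nonneg (by positivity), norm_mul, Pi.star_apply, norm_star,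
    inv_mul_le_iff₀ (by positivity)]
  nlinarith [hs k, hs l, sq_nonneg (‖x k‖ - ‖x l‖)]

theorem continuous_boundedOuter : Continuous (boundedOuter : (Fin q → ℂ) → _) := by
  have c1 : Continuous (sqLen : (Fin q → ℂ) → ℝ) := by unfold sqLen; fun_prop
  have c2 : Continuous fun x : Fin q → ℂ => (((1 + sqLen x)⁻¹ : ℝ) : ℂ) :=
    Complex.continuous_ofReal.comp ((continuous_const.add c1).inv₀ fun x =>
      (add_pos_of_pos_of_nonneg one_pos (sqLen_nonneg x)).ne')
  exact c2.smul (continuous_id.matrix_vecMulVec continuous_star)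

/-- Closeness of the truncated sample covariance to a coercive matrix bounds the regularized sample
covariance below. -/
theorem wellConditioned_of_boundedOuter {δ : ℝ} {Q M : Matrix (Fin q) (Fin q) ℂ} {n : ℕ}
    {y : ℕ → Fin q → ℂ} (hM : ∀ v, 2 * δ * sqLen v ≤ (quadForm (M + (1 - Q)) v).re)
    (hy : ‖(n : ℂ)⁻¹ • ∑ m ∈ Finset.range n, (boundedOuter (y m) - M)‖ ≤ δ) (hn : 0 < n) :
    y ∈ wellConditioned δ Q n := by
  intro v
  have h1 := hM v
  have h2 := (abs_le.1 ((Complex.abs_re_le_norm _).trans ((norm_quadForm_le _ v).trans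
    (mul_le_mul_of_nonneg_left hy (sqLen_nonneg v))))).1
  have hn' : (n : ℝ) ≠ 0 := by positivity
  rw [quadForm_smul, ← Complex.ofReal_natCast, ← Complex.ofReal_inv, Complex.re_ofReal_mul,
    quadForm_sum, Complex.re_sum] at h2
  simp only [quadForm_sub, quadForm_boundedOuter, Complex.sub_re, Complex.ofReal_re,
    Finset.sum_sub_distrib, Finset.sum_const, Finset.card_range, nsmul_eq_mul, mul_sub] at h2
  rw [inv_mul_cancel_left₀ hn'] at h2
  rw [regularizedCov, quadForm_add, Complex.add_re, re_quadForm_sampleCov]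
  rw [quadForm_add, Complex.add_re] at h1
  have h3 : (n : ℝ)⁻¹ * ∑ m ∈ Finset.range n, (1 + sqLen (y m))⁻¹ * ‖star (y m) ⬝ᵥ v‖ ^ 2 ≤
      (n : ℝ)⁻¹ * ∑ m ∈ Finset.range n, ‖star (y m) ⬝ᵥ v‖ ^ 2 := by
    refine mul_le_mul_of_nonneg_left (Finset.sum_le_sum fun m _ => ?_) (by positivity)
    refine mul_le_of_le_one_left (by positivity) (inv_le_one_of_one_le₀ ?_)
    linarith [sqLen_nonneg (y m)]
  linarith

theorem norm_vecMulVec_le (x y : Fin q → ℂ) :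
    ‖vecMulVec x (star y)‖ = √(sqLen x) * √(sqLen y) := by
  rw [← Real.sqrt_mul (sqLen_nonneg x), ← Real.sqrt_sq (norm_nonneg (vecMulVec x (star y))),
    frobenius_sq]
  congr 1
  simp only [sqLen, Finset.sum_mul_sum, vecMulVec_apply, norm_mul, mul_pow, Pi.star_apply, norm_star]

/-- Young's inequality on the cross terms with a free weight `s`. For noise of energy `σ²` the
choice `s = σ` makes both contributions `O(σ)` in mean. -/
theorem norm_vecMulVec_add_sub_le {s : ℝ} (hs : 0 < s) (y u : Fin q → ℂ) :
    ‖vecMulVec (y + u) (star (y + u)) - vecMulVec y (star y)‖ ≤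
      s * sqLen y + (s⁻¹ + 1) * sqLen u := by
  have e : vecMulVec (y + u) (star (y + u)) - vecMulVec y (star y) =
      vecMulVec y (star u) + vecMulVec u (star y) + vecMulVec u (star u) := by
    rw [star_add, add_vecMulVec, vecMulVec_add, vecMulVec_add]; abel
  rw [e]
  refine (norm_add₃_le).trans ?_
  rw [norm_vecMulVec_le, norm_vecMulVec_le, norm_vecMulVec_le]
  have hy := Real.sq_sqrt (sqLen_nonneg y)
  have hu := Real.sq_sqrt (sqLen_nonneg u)
  have h := sq_nonneg (s * √(sqLen y) - √(sqLen u))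
  have h2 : 2 * √(sqLen y) * √(sqLen u) ≤ s * √(sqLen y) ^ 2 + s⁻¹ * √(sqLen u) ^ 2 := by
    have : s * √(sqLen y) ^ 2 + s⁻¹ * √(sqLen u) ^ 2 - 2 * √(sqLen y) * √(sqLen u) =
      s⁻¹ * (s * √(sqLen y) - √(sqLen u)) ^ 2 := by field_simp; ring
    have : 0 ≤ s⁻¹ * (s * √(sqLen y) - √(sqLen u)) ^ 2 := by positivity
    linarith
  rw [hy, hu] at h2
  nlinarith

theorem norm_sampleCov_add_sub_le {s : ℝ} (hs : 0 < s) {n : ℕ} {x y u : ℕ → Fin q → ℂ}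
    (hx : ∀ m < n, x m = y m + u m) :
    ‖sampleCov n x - sampleCov n y‖ ≤ (n : ℝ)⁻¹ * ∑ m ∈ Finset.range n,
      (s * sqLen (y m) + (s⁻¹ + 1) * sqLen (u m)) := by
  rw [sampleCov, sampleCov, ← smul_sub, ← Finset.sum_sub_distrib, norm_smul, norm_inv,
    Complex.norm_natCast]
  refine mul_le_mul_of_nonneg_left ((norm_sum_le _ _).trans (Finset.sum_le_sum fun m hm => ?_))
    (by positivity)
  rw [hx m (Finset.mem_range.1 hm)]
  exact norm_vecMulVec_add_sub_le hs _ _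

theorem norm_trace_mul_le (M N : Matrix (Fin q) (Fin q) ℂ) : ‖(M * N).trace‖ ≤ q * (‖M‖ * ‖N‖) := by
  refine (norm_sum_le _ _).trans ?_
  calc _ ≤ ∑ _k : Fin q, ‖M‖ * ‖N‖ := Finset.sum_le_sum fun k _ =>
        (norm_entry_le (M * N) k k).trans (frobenius_norm_mul _ _)
    _ = _ := by simp

/-- Continuity of the trace of the inverse, quantitatively. -/
theorem abs_trace_inv_sub_le {δ : ℝ} (hδ : 0 < δ) {Q S H B : Matrix (Fin q) (Fin q) ℂ} {n : ℕ}
    {x : ℕ → Fin q → ℂ} (hx : x ∈ wellConditioned δ Q n) (hH : (S + (1 - Q)) * H = 1) :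
    |((regularizedCov Q n x)⁻¹ * B).trace.re - (H * B).trace.re| ≤
      q * (√q / δ * ‖H‖ * ‖B‖) * ‖sampleCov n x - S‖ := by
  obtain ⟨h1, h2⟩ := inv_of_coercive hδ hx
  set G := regularizedCov Q n x with hG
  have e : G⁻¹ * B - H * B = G⁻¹ * ((S - sampleCov n x) * H * B) := by
    have : S - sampleCov n x = (S + (1 - Q)) - G := by rw [hG, regularizedCov]; abel
    rw [this, Matrix.sub_mul, hH, Matrix.sub_mul, Matrix.mul_sub, Matrix.one_mul, Matrix.mul_assoc G,
      ← Matrix.mul_assoc G⁻¹ G, h1, Matrix.one_mul]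
  rw [← Complex.sub_re, ← trace_sub, e]
  refine (Complex.abs_re_le_norm _).trans ((norm_trace_mul_le _ _).trans ?_)
  have h3 : ‖(S - sampleCov n x) * H * B‖ ≤ ‖sampleCov n x - S‖ * ‖H‖ * ‖B‖ := by
    refine (frobenius_norm_mul _ _).trans ?_
    rw [norm_sub_rev]
    exact mul_le_mul_of_nonneg_right (frobenius_norm_mul _ _) (norm_nonneg _)
  calc _ ≤ q * (√q / δ * (‖sampleCov n x - S‖ * ‖H‖ * ‖B‖)) := by gcongr
    _ = _ := by ring

end

end

/-! ### Ill-conditioned clutter data have probability of order `1 / n²`. -/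

noncomputable section

section

open scoped Matrix.Norms.Frobenius

variable {Ω : Type*} [MeasurableSpace Ω] {P : Measure Ω} [IsProbabilityMeasure P] {q : ℕ}

/-- One of the real and imaginary parts exceeds `ε / 2` in absolute value. Each contributes `3 b⁴ /
(ε / 2)⁴ = 48 b⁴ / ε⁴`. -/
theorem measure_norm_sum_ge_le {X : ℕ → Ω → ℂ} (hind : iIndepFun X P)
    (hmeas : ∀ m, Measurable (X m)) {b : ℝ} (hb : ∀ m ω, ‖X m ω‖ ≤ b)
    (hX0 : ∀ m, ∫ ω, X m ω ∂P = 0) {ε : ℝ} (hε : 0 < ε) {n : ℕ} (hn : 0 < n) :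
    P.real {ω | ε ≤ ‖(n : ℂ)⁻¹ * ∑ m ∈ Finset.range n, X m ω‖} ≤ 96 * b ^ 4 / ε ^ 4 / n ^ 2 := by
  have hi : ∀ m, Integrable (X m) P := fun m =>
    Integrable.of_bound (hmeas m).aestronglyMeasurable b (Eventually.of_forall (hb m))
  have part : ∀ f : ℂ → ℝ, Measurable f → (∀ x, |f x| ≤ ‖x‖) → (∀ m, ∫ ω, f (X m ω) ∂P = 0) →
      P.real {ω | ε / 2 ≤ |(n : ℝ)⁻¹ * ∑ m ∈ Finset.range n, f (X m ω)|} ≤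
        48 * b ^ 4 / ε ^ 4 / n ^ 2 := by
    intro f hf hfb hf0
    have hbd : ∀ m ω, |f (X m ω)| ≤ b := fun m ω => (hfb _).trans (hb m ω)
    have h4 : ∀ m, ∫ ω, f (X m ω) ^ 4 ∂P ≤ (b ^ 2) ^ 2 := fun m => by
      have h : ∀ ω, f (X m ω) ^ 4 ≤ (b ^ 2) ^ 2 := fun ω => by
        calc f (X m ω) ^ 4 = |f (X m ω)| ^ 4 := ((by decide : Even 4).pow_abs _).symm
          _ ≤ b ^ 4 := by gcongr; exact hbd m ω
          _ = _ := by ring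
      refine (integral_mono_of_nonneg (Eventually.of_forall fun ω => by positivity)
        (integrable_const ((b ^ 2) ^ 2)) (Eventually.of_forall h)).trans ?_
      simp
    have := measure_sum_ge_le (hind.comp (fun _ => f) fun _ => hf) (fun m => hf.comp (hmeas m))
      (fun m => MemLp.of_bound (hf.comp (hmeas m)).aestronglyMeasurable b
        (Eventually.of_forall (hbd m))) hf0 (sq_nonneg b) h4 (half_pos hε) hn
    refine this.trans (le_of_eq ?_)
    field_simp; ring
  have hre := part Complex.re Complex.measurable_re Complex.abs_re_le_norm fun m => by
    have := integral_re (hi m)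
    simp only [RCLike.re_eq_complex_re] at this
    rw [this, hX0]; rfl
  have him := part Complex.im Complex.measurable_im Complex.abs_im_le_norm fun m => by
    have := integral_im (hi m)
    simp only [RCLike.im_eq_complex_im] at this
    rw [this, hX0]; rfl
  have hsub : {ω | ε ≤ ‖(n : ℂ)⁻¹ * ∑ m ∈ Finset.range n, X m ω‖} ⊆
      {ω | ε / 2 ≤ |(n : ℝ)⁻¹ * ∑ m ∈ Finset.range n, (X m ω).re|} ∪
      {ω | ε / 2 ≤ |(n : ℝ)⁻¹ * ∑ m ∈ Finset.range n, (X m ω).im|} := by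
    intro ω hω
    by_contra hc
    simp only [Set.mem_union, Set.mem_ofPred_eq, not_or, not_le] at hω hc
    have := Complex.norm_le_abs_re_add_abs_im ((n : ℂ)⁻¹ * ∑ m ∈ Finset.range n, X m ω)
    rw [← Complex.ofReal_natCast, ← Complex.ofReal_inv, Complex.re_ofReal_mul,
      Complex.im_ofReal_mul, Complex.re_sum, Complex.im_sum] at this
    rw [← Complex.ofReal_natCast, ← Complex.ofReal_inv] at hω
    linarith
  refine (measureReal_mono hsub).trans ((measureReal_union_le _ _).trans ?_)
  calc _ ≤ 48 * b ^ 4 / ε ^ 4 / n ^ 2 + 48 * b ^ 4 / ε ^ 4 / (n : ℝ) ^ 2 := add_le_add hre him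
    _ = _ := by ring

variable {y : ℕ → Ω → Fin q → ℂ} {S Q : Matrix (Fin q) (Fin q) ℂ}

theorem integrable_boundedOuter (hm : Measurable (y 0)) (k l : Fin q) :
    Integrable (fun ω => boundedOuter (y 0 ω) k l) P :=
  Integrable.of_bound (((continuous_boundedOuter.matrix_elem k l).measurable.comp
    hm).aestronglyMeasurable) 1 (Eventually.of_forall fun _ => norm_boundedOuter_apply_le _ k l)

/-- The truncated covariance, completed on the kernel of `Q`, is positive definite. -/
theorem exists_coercive_boundedOuter (hm : Measurable (y 0)) (hQ : Qᴴ = Q) (hQQ : Q * Q = Q)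
    (hS : ∀ k l, ∫ ω, y 0 ω k * star (y 0 ω l) ∂P = S k l)
    (hSi : ∀ k l, Integrable (fun ω => y 0 ω k * star (y 0 ω l)) P)
    {T : Matrix (Fin q) (Fin q) ℂ} (hTS : T * S = Q) :
    ∃ δ, 0 < δ ∧ ∀ v, 2 * δ * sqLen v ≤ (quadForm
      ((Matrix.of fun k l => ∫ ω, boundedOuter (y 0 ω) k l ∂P) + (1 - Q)) v).re := by
  have hQ1 : (1 - Q)ᴴ = 1 - Q := by simp [hQ]
  have hQQ1 : (1 - Q) * (1 - Q) = 1 - Q := by simp [sub_mul, mul_sub, hQQ]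
  have hM : ∀ v, Integrable (fun ω => (1 + sqLen (y 0 ω))⁻¹ * ‖star (y 0 ω) ⬝ᵥ v‖ ^ 2) P ∧
      (quadForm (Matrix.of fun k l => ∫ ω, boundedOuter (y 0 ω) k l ∂P) v).re =
      ∫ ω, (1 + sqLen (y 0 ω))⁻¹ * ‖star (y 0 ω) ⬝ᵥ v‖ ^ 2 ∂P := by
    intro v
    have e : ∀ ω, quadForm (boundedOuter (y 0 ω)) v =
        ∑ k, ∑ l, star (v k) * (boundedOuter (y 0 ω) k l * v l) := fun ω => by
      simp [quadForm, dotProduct, mulVec, Finset.mul_sum]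
    have hkl : ∀ k l, Integrable (fun ω => star (v k) * (boundedOuter (y 0 ω) k l * v l)) P :=
      fun k l => ((integrable_boundedOuter hm k l).mul_const _).const_mul _
    have hint : Integrable (fun ω => quadForm (boundedOuter (y 0 ω)) v) P := by
      simp only [e]
      exact integrable_finsetSum _ fun k _ => integrable_finsetSum _ fun l _ => hkl k l
    have hv : ∫ ω, quadForm (boundedOuter (y 0 ω)) v ∂P =
        quadForm (Matrix.of fun k l => ∫ ω, boundedOuter (y 0 ω) k l ∂P) v := by
      simp only [e]
      rw [integral_finsetSum _ fun k _ => integrable_finsetSum _ fun l _ => hkl k l]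
      simp only [quadForm, dotProduct, mulVec, Finset.mul_sum, Matrix.of_apply, Pi.star_apply]
      refine Finset.sum_congr rfl fun k _ => ?_
      rw [integral_finsetSum _ fun l _ => hkl k l]
      refine Finset.sum_congr rfl fun l _ => ?_
      rw [integral_const_mul, integral_mul_const]
    have h1 := integral_re hint
    have h2 := hint.re
    simp only [RCLike.re_eq_complex_re, quadForm_boundedOuter, Complex.ofReal_re] at h1 h2
    refine ⟨h2, ?_⟩
    rw [h1, ← hv]
    simp only [quadForm_boundedOuter]
  have hpos : ∀ v ≠ 0, 0 < (quadForm
      ((Matrix.of fun k l => ∫ ω, boundedOuter (y 0 ω) k l ∂P) + (1 - Q)) v).re := by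
    intro v hv
    obtain ⟨hi, hv1⟩ := hM v
    have hnn : ∀ ω, 0 ≤ (1 + sqLen (y 0 ω))⁻¹ * ‖star (y 0 ω) ⬝ᵥ v‖ ^ 2 := fun ω => by
      have := sqLen_nonneg (y 0 ω); positivity
    have h1 := re_quadForm_projection_nonneg hQ1 hQQ1 v
    rw [quadForm_add, Complex.add_re, hv1]
    have h2 : 0 ≤ ∫ ω, (1 + sqLen (y 0 ω))⁻¹ * ‖star (y 0 ω) ⬝ᵥ v‖ ^ 2 ∂P :=
      integral_nonneg fun ω => hnn ω
    by_contra hc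
    have h3 : ∫ ω, (1 + sqLen (y 0 ω))⁻¹ * ‖star (y 0 ω) ⬝ᵥ v‖ ^ 2 ∂P = 0 := by
      linarith
    have h4 : (quadForm (1 - Q) v).re = 0 := by linarith
    rw [integral_eq_zero_iff_of_nonneg hnn hi] at h3
    -- If the truncated form vanishes, the data are almost surely orthogonal to `v`, so `S v = 0`
    -- for the untruncated covariance and `Q v = T S v = 0`. Together with `(1 - Q) v = 0` this
    -- gives `v = 0`.
    have h5 : S *ᵥ v = 0 := by
      ext k
      have : (S *ᵥ v) k = ∫ ω, y 0 ω k * (star (y 0 ω) ⬝ᵥ v) ∂P := by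
        simp only [mulVec, dotProduct, ← hS, Finset.mul_sum, Pi.star_apply]
        rw [integral_finsetSum]
        · refine Finset.sum_congr rfl fun l _ => ?_
          rw [← integral_mul_const]
          simp only [mul_assoc]
        · intro l _
          simpa only [mul_assoc] using (hSi k l).mul_const (v l)
      rw [this, Pi.zero_apply]
      refine integral_eq_zero_of_ae ?_
      filter_upwards [h3] with ω hω
      have := sqLen_nonneg (y 0 ω)
      simp only [Pi.zero_apply, mul_eq_zero, inv_eq_zero, pow_eq_zero_iff, norm_eq_zero, ne_eq,
        OfNat.ofNat_ne_zero, not_false_eq_true] at hω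
      rcases hω with h | h
      · linarith
      · rw [h, mul_zero]; rfl
    have h6 : (1 - Q) *ᵥ v = 0 := by
      refine sqLen_eq_zero ?_
      rwa [sqLen_mulVec_of_projection hQ1 hQQ1, Complex.ofReal_re] at h4
    refine hv ?_
    rw [sub_mulVec, one_mulVec, ← hTS, ← mulVec_mulVec, h5, mulVec_zero, sub_zero] at h6
    exact h6
  obtain ⟨δ, hδ, h⟩ := exists_coercive hpos
  exact ⟨δ / 2, by positivity, fun v => by simpa [mul_div_cancel₀] using h v⟩

/-- The clutter data are well conditioned outside an event of probability `O(1/n²)`. -/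
theorem exists_measure_not_wellConditioned_le (hm : ∀ m, Measurable (y m)) (hind : iIndepFun y P)
    (hid : ∀ m, IdentDistrib (y m) (y 0) P P) (hQ : Qᴴ = Q) (hQQ : Q * Q = Q)
    (hS : ∀ k l, ∫ ω, y 0 ω k * star (y 0 ω l) ∂P = S k l)
    (hSi : ∀ k l, Integrable (fun ω => y 0 ω k * star (y 0 ω l)) P)
    {T : Matrix (Fin q) (Fin q) ℂ} (hTS : T * S = Q) :
    ∃ δ, 0 < δ ∧ ∃ C, 0 ≤ C ∧ ∀ n : ℕ, 0 < n →
      P.real {ω | (fun m => y m ω) ∉ wellConditioned δ Q n} ≤ C / n ^ 2 := by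
  obtain ⟨δ, hδ, hco⟩ := exists_coercive_boundedOuter (hm 0) hQ hQQ hS hSi hTS
  set M := Matrix.of fun k l => ∫ ω, boundedOuter (y 0 ω) k l ∂P with hM
  -- If all entries deviate by less than `ε`, the Frobenius norm of the deviation is at most `q ε ≤
  -- δ`; the `+ 1` covers `q = 0`.
  set ε := δ / (q + 1) with hε
  have hε0 : 0 < ε := by positivity
  have mB : ∀ k l, Measurable fun x : Fin q → ℂ => boundedOuter x k l := fun k l =>
    (continuous_boundedOuter.matrix_elem k l).measurable
  refine ⟨δ, hδ, ∑ _k : Fin q, ∑ _l : Fin q, 96 * 2 ^ 4 / ε ^ 4, by positivity, fun n hn => ?_⟩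
  have hMle : ∀ k l, ‖M k l‖ ≤ 1 := fun k l => by
    refine (norm_integral_le_of_norm_le_const (C := 1)
      (Eventually.of_forall fun ω => norm_boundedOuter_apply_le (y 0 ω) k l)).trans ?_
    simp
  have key : ∀ k l, P.real {ω | ε ≤ ‖(n : ℂ)⁻¹ * ∑ m ∈ Finset.range n,
      (boundedOuter (y m ω) k l - M k l)‖} ≤ 96 * 2 ^ 4 / ε ^ 4 / n ^ 2 := by
    intro k l
    refine measure_norm_sum_ge_le (hind.comp (fun _ x => boundedOuter x k l - M k l)
      fun _ => (mB k l).sub_const _) (fun m => ((mB k l).sub_const _).comp (hm m))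
      (fun m ω => ?_) (fun m => ?_) hε0 hn
    · refine (norm_sub_le _ _).trans ?_
      linarith [hMle k l, norm_boundedOuter_apply_le (y m ω) k l]
    · have h1 := ((hid m).comp ((mB k l).sub_const (M k l))).integral_eq
      refine h1.trans ?_
      simp only [Function.comp_def]
      rw [integral_sub (integrable_boundedOuter (hm 0) k l) (integrable_const _)]
      simp [hM]
  have hsub : {ω | (fun m => y m ω) ∉ wellConditioned δ Q n} ⊆
      ⋃ k : Fin q, ⋃ l : Fin q, {ω | ε ≤ ‖(n : ℂ)⁻¹ * ∑ m ∈ Finset.range n,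
      (boundedOuter (y m ω) k l - M k l)‖} := by
    intro ω hω
    by_contra hc
    simp only [Set.mem_iUnion, Set.mem_ofPred_eq, not_exists, not_le] at hc
    refine hω (wellConditioned_of_boundedOuter hco ?_ hn)
    refine (abs_le_of_sq_le_sq' ?_ hδ.le).2
    rw [frobenius_sq]
    calc _ ≤ ∑ _k : Fin q, ∑ _l : Fin q, ε ^ 2 := by
          refine Finset.sum_le_sum fun k _ => Finset.sum_le_sum fun l _ => ?_
          have := (hc k l).le
          rw [Matrix.smul_apply, Matrix.sum_apply, smul_eq_mul]
          simp only [Matrix.sub_apply]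
          gcongr
      _ = (q * ε) ^ 2 := by simp; ring
      _ ≤ δ ^ 2 := by
          gcongr
          rw [hε, mul_div_assoc', div_le_iff₀ (by positivity)]
          nlinarith
  refine (measureReal_mono hsub).trans ?_
  refine (measureReal_iUnion_fintype_le _).trans ?_
  rw [Finset.sum_div]
  refine Finset.sum_le_sum fun k _ => (measureReal_iUnion_fintype_le _).trans ?_
  rw [Finset.sum_div]
  exact Finset.sum_le_sum fun l _ => key k l

end

end

/-! ### Noise energy and the law of large numbers for the clutter. -/

noncomputable section

section

open scoped Matrix.Norms.Frobenius

variable {Ω : Type*} [MeasurableSpace Ω] {P : Measure Ω} {q : ℕ}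
  {S Q : Matrix (Fin q) (Fin q) ℂ}

/-- The energy is quadratic in the noise, so its fourth-moment Chebyshev inequality needs eighth
moments. -/
theorem IsCircularGaussian.integral_norm_apply_pow_eight_le {X : Ω → Fin q → ℂ} {s : ℝ}
    (hX : IsCircularGaussian X ((s : ℂ) ^ 2 • (1 : Matrix (Fin q) (Fin q) ℂ)) P) (k : Fin q) :
    Integrable (fun ω => ‖X ω k‖ ^ 8) P ∧ ∫ ω, ‖X ω k‖ ^ 8 ∂P ≤ s ^ 8 * stdGaussianMoment 8 := by
  have hi : Integrable (fun ω => ‖X ω k‖ ^ 8) P :=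
    (hX.memLp_apply k (p := (8 : ℕ)) (by norm_num)).integrable_norm_pow (by norm_num)
  refine ⟨hi, ?_⟩
  have hw : ∀ a : ℂ, ‖a‖ = 1 →
      hermForm ((s : ℂ) ^ 2 • (1 : Matrix (Fin q) (Fin q) ℂ)) (Pi.single k a) = s ^ 2 := fun a ha => by
    rw [hermForm_smul_one, sqLen, Finset.sum_eq_single k]
    · simp [ha]
    · intro b _ hb; simp [hb]
    · simp
  have h8 : ∀ a : ℂ, ‖a‖ = 1 → Integrable (fun ω => (star (Pi.single k a) ⬝ᵥ X ω).re ^ 8) P ∧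
      ∫ ω, (star (Pi.single k a) ⬝ᵥ X ω).re ^ 8 ∂P = (s ^ 2 / 2) ^ 4 * stdGaussianMoment 8 := by
    intro a ha
    refine ⟨?_, ?_⟩
    · have := (hX.memLp_re (Pi.single k a) 8).integrable_norm_pow (p := 8) (by norm_num)
      simpa [(by decide : Even 8).pow_abs] using this
    · rw [hX.integral_re_pow_eight (by rw [hw a ha]; positivity), hw a ha]
  obtain ⟨i1, e1⟩ := h8 1 (by simp)
  obtain ⟨i2, e2⟩ := h8 Complex.I (by simp)
  have hle : ∀ ω, ‖X ω k‖ ^ 8 ≤ 8 * ((star (Pi.single k 1) ⬝ᵥ X ω).re ^ 8 +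
      (star (Pi.single k Complex.I) ⬝ᵥ X ω).re ^ 8) := by
    intro ω
    have a1 : (star (Pi.single k 1) ⬝ᵥ X ω).re = (X ω k).re := by
      rw [← Pi.single_star]; simp
    have a2 : (star (Pi.single k Complex.I) ⬝ᵥ X ω).re = (X ω k).im := by
      rw [← Pi.single_star]; simp
    rw [a1, a2]
    have := add_pow_le (sq_nonneg (X ω k).re) (sq_nonneg (X ω k).im) 4
    calc ‖X ω k‖ ^ 8 = (‖X ω k‖ ^ 2) ^ 4 := by ring
      _ = ((X ω k).re ^ 2 + (X ω k).im ^ 2) ^ 4 := by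
        rw [← Complex.normSq_eq_norm_sq, Complex.normSq_apply]; ring
      _ ≤ _ := this.trans (le_of_eq (by norm_num; ring))
  refine (integral_mono hi ((i1.add i2).const_mul 8) hle).trans (le_of_eq ?_)
  simp only [Pi.add_apply]
  rw [integral_const_mul, integral_add i1 i2, e1, e2]
  ring

variable [IsProbabilityMeasure P]

/-- The mean noise energy exceeds `(q + 1) s²` with probability `O(1/n²)`, uniformly in the
noise level. -/
theorem measure_noise_energy_ge_le {z : ℕ → Ω → Fin q → ℂ} {s : ℝ} (hs : 0 < s)
    (hz : ∀ m, IsCircularGaussian (z m) ((s : ℂ) ^ 2 • (1 : Matrix (Fin q) (Fin q) ℂ)) P)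
    (hm : ∀ m, Measurable (z m)) (hi : iIndepFun z P) {n : ℕ} (hn : 0 < n) :
    P.real {ω | (q + 1) * s ^ 2 ≤ (n : ℝ)⁻¹ * ∑ m ∈ Finset.range n, sqLen (z m ω)} ≤
      24 * q ^ 4 * (stdGaussianMoment 8 + 1) / n ^ 2 := by
  have m8 : 0 ≤ stdGaussianMoment 8 := integral_nonneg fun x => by positivity
  have cs : Continuous (sqLen : (Fin q → ℂ) → ℝ) := by unfold sqLen; fun_prop
  -- The energy centred at its mean `q s²`; the threshold `(q + 1) s²` is a deviation of `s²`.
  set X : ℕ → Ω → ℝ := fun m ω => sqLen (z m ω) - q * s ^ 2 with hX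
  have hXm : ∀ m, Measurable (X m) := fun m => (cs.measurable.comp (hm m)).sub_const _
  have hsq : ∀ m k, Integrable (fun ω => ‖z m ω k‖ ^ 2) P ∧ ∫ ω, ‖z m ω k‖ ^ 2 ∂P = s ^ 2 := by
    intro m k
    have h1 : hermForm ((s : ℂ) ^ 2 • (1 : Matrix (Fin q) (Fin q) ℂ)) (Pi.single k 1) = s ^ 2 := by
      rw [IsCircularGaussian.hermForm_smul_one, sqLen, Finset.sum_eq_single k]
      · simp
      · intro b _ hb; simp [hb]
      · simp
    have := (hz m).integral_norm_sq (w := Pi.single k 1) (by rw [h1]; positivity)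
    rw [h1] at this
    simpa using this
  have hX0 : ∀ m, ∫ ω, X m ω ∂P = 0 := by
    intro m
    simp only [hX, sqLen]
    rw [integral_sub (integrable_finsetSum _ fun k _ => (hsq m k).1) (integrable_const _),
      integral_finsetSum _ fun k _ => (hsq m k).1]
    simp [(hsq m _).2]
  have hle : ∀ m ω, X m ω ^ 4 ≤ 8 * (q ^ 3 * ∑ k, ‖z m ω k‖ ^ 8 + q ^ 4 * s ^ 8) := by
    intro m ω
    have h1 : sqLen (z m ω) ^ 4 ≤ q ^ 3 * ∑ k, ‖z m ω k‖ ^ 8 := by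
      have c1 := sq_sum_le_card_mul_sum_sq (s := (Finset.univ : Finset (Fin q)))
        (f := fun k => ‖z m ω k‖ ^ 2)
      have c2 := sq_sum_le_card_mul_sum_sq (s := (Finset.univ : Finset (Fin q)))
        (f := fun k => ‖z m ω k‖ ^ 4)
      simp only [← pow_mul, Finset.card_univ, Fintype.card_fin] at c1 c2
      norm_num at c1 c2
      calc sqLen (z m ω) ^ 4 = ((∑ k, ‖z m ω k‖ ^ 2) ^ 2) ^ 2 := by rw [sqLen]; ring
        _ ≤ (q * ∑ k, ‖z m ω k‖ ^ 4) ^ 2 := by gcongr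
        _ = q ^ 2 * (∑ k, ‖z m ω k‖ ^ 4) ^ 2 := by ring
        _ ≤ q ^ 2 * (q * ∑ k, ‖z m ω k‖ ^ 8) := by gcongr
        _ = _ := by ring
    have h2 := sqLen_nonneg (z m ω)
    have h3 : (0 : ℝ) ≤ q * s ^ 2 := by positivity
    have h4 : X m ω ^ 4 ≤ (sqLen (z m ω) + q * s ^ 2) ^ 4 := by
      rw [← (by decide : Even 4).pow_abs]
      refine pow_le_pow_left₀ (abs_nonneg _) ?_ 4
      simp only [hX]
      exact (abs_sub _ _).trans (by rw [abs_of_nonneg h2, abs_of_nonneg h3])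
    refine h4.trans ((add_pow_le h2 h3 4).trans ?_)
    norm_num
    rw [mul_pow, ← pow_mul]
    norm_num
    linarith
  have hint : ∀ m, Integrable (fun ω => 8 * (q ^ 3 * ∑ k, ‖z m ω k‖ ^ 8 + (q : ℝ) ^ 4 * s ^ 8)) P :=
    fun m => (((integrable_finsetSum _ fun k _ =>
      ((hz m).integral_norm_apply_pow_eight_le k).1).const_mul _).add (integrable_const _)).const_mul _
  have hX4 : ∀ m, MemLp (X m) 4 P := by
    intro m
    rw [← integrable_norm_rpow_iff (hXm m).aestronglyMeasurable (by norm_num) (by norm_num)]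
    have e : ∀ ω, ‖X m ω‖ ^ (ENNReal.toReal 4) = X m ω ^ 4 := fun ω => by
      rw [show ENNReal.toReal 4 = ((4 : ℕ) : ℝ) by norm_num, Real.rpow_natCast, Real.norm_eq_abs,
        (by decide : Even 4).pow_abs]
    simp only [e]
    refine (hint m).mono' ((hXm m).pow_const 4).aestronglyMeasurable
      (Eventually.of_forall fun ω => ?_)
    rw [Real.norm_of_nonneg (by positivity)]
    exact hle m ω
  -- `v` scales as `s⁴`, so `v² / (s²)⁴` is free of `s` and the bound is uniform in the noise level.
  set v : ℝ := √(8 * q ^ 4 * (stdGaussianMoment 8 + 1)) * s ^ 4 with hv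
  have hv2 : v ^ 2 = 8 * q ^ 4 * (stdGaussianMoment 8 + 1) * s ^ 8 := by
    rw [hv, mul_pow, Real.sq_sqrt (by positivity)]; ring
  have hXv : ∀ m, ∫ ω, X m ω ^ 4 ∂P ≤ v ^ 2 := by
    intro m
    refine (integral_mono_of_nonneg (Eventually.of_forall fun ω => by positivity) (hint m)
      (Eventually.of_forall (hle m))).trans ?_
    rw [integral_const_mul, integral_add ((integrable_finsetSum _ fun k _ =>
      ((hz m).integral_norm_apply_pow_eight_le k).1).const_mul _) (integrable_const _),
      integral_const_mul, integral_finsetSum _ fun k _ =>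
      ((hz m).integral_norm_apply_pow_eight_le k).1, hv2]
    have h1 : ∑ k, ∫ ω, ‖z m ω k‖ ^ 8 ∂P ≤ ∑ _k : Fin q, s ^ 8 * stdGaussianMoment 8 :=
      Finset.sum_le_sum fun k _ => ((hz m).integral_norm_apply_pow_eight_le k).2
    simp only [Finset.sum_const, Finset.card_univ, Fintype.card_fin, nsmul_eq_mul] at h1
    have h2 : (q : ℝ) ^ 3 * ∑ k, ∫ ω, ‖z m ω k‖ ^ 8 ∂P ≤
        q ^ 3 * (q * (s ^ 8 * stdGaussianMoment 8)) := by gcongr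
    simp only [integral_const, probReal_univ, smul_eq_mul, one_mul]
    linarith
  have := measure_sum_ge_le (hi.comp (fun _ x => sqLen x - q * s ^ 2)
    fun _ => cs.measurable.sub_const _) hXm hX4 hX0 (by positivity) hXv
    (ε := s ^ 2) (by positivity) hn
  refine (measureReal_mono fun ω hω => ?_).trans (this.trans (le_of_eq ?_))
  · simp only [Set.mem_ofPred_eq, Function.comp_def] at hω ⊢
    refine le_trans ?_ (le_abs_self _)
    have hn' : (n : ℝ) ≠ 0 := by positivity
    rw [Finset.sum_sub_distrib, mul_sub, Finset.sum_const, Finset.card_range, nsmul_eq_mul,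
      inv_mul_cancel_left₀ hn']
    linarith
  · rw [hv2]; field_simp; ring

variable {y : ℕ → Ω → Fin q → ℂ}

/-- The `L¹` form of the strong law, entry by entry; it needs no more than the second moments of the
clutter. -/
theorem tendsto_integral_norm_sampleCov_sub (hm : ∀ m, Measurable (y m)) (hind : iIndepFun y P)
    (hid : ∀ m, IdentDistrib (y m) (y 0) P P)
    (hS : ∀ k l, ∫ ω, y 0 ω k * star (y 0 ω l) ∂P = S k l)
    (hSi : ∀ k l, Integrable (fun ω => y 0 ω k * star (y 0 ω l)) P) :
    (∀ n, Integrable (fun ω => ‖sampleCov n (fun m => y m ω) - S‖) P) ∧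
    Tendsto (fun n => ∫ ω, ‖sampleCov n (fun m => y m ω) - S‖ ∂P) atTop (𝓝 0) := by
  have mX : ∀ k l, Measurable fun x : Fin q → ℂ => x k * star (x l) := fun k l => by fun_prop
  have hent : ∀ n k l ω, (sampleCov n (fun m => y m ω) - S) k l =
      (n : ℝ)⁻¹ • (∑ m ∈ Finset.range n, y m ω k * star (y m ω l)) -
        ∫ ω, y 0 ω k * star (y 0 ω l) ∂P := by
    intro n k l ω
    rw [hS, Matrix.sub_apply, sampleCov, Matrix.smul_apply, Matrix.sum_apply, smul_eq_mul,
      Complex.real_smul, Complex.ofReal_inv, Complex.ofReal_natCast]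
    simp [vecMulVec_apply]
  have hI : ∀ m k l, Integrable (fun ω => y m ω k * star (y m ω l)) P := fun m k l =>
    ((hid m).comp (mX k l)).integrable_iff.2 (hSi k l)
  have hie : ∀ n k l, Integrable (fun ω => (sampleCov n (fun m => y m ω) - S) k l) P := by
    intro n k l
    simp only [hent]
    exact ((integrable_finsetSum _ fun m _ => hI m k l).smul (n : ℝ)⁻¹).sub (integrable_const _)
  have hlim : ∀ k l, Tendsto (fun n : ℕ => ∫ ω, ‖(sampleCov n (fun m => y m ω) - S) k l‖ ∂P) atTop
      (𝓝 0) := by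
    intro k l
    have h := strong_law_Lp (μ := P) (p := 1) le_rfl (by simp)
      (fun m ω => y m ω k * star (y m ω l)) (memLp_one_iff_integrable.2 (hSi k l))
      (fun i j hij => (hind.indepFun hij).comp (mX k l) (mX k l))
      (fun m => (hid m).comp (mX k l))
    have h2 := (ENNReal.tendsto_toReal (by simp)).comp h
    refine h2.congr fun n => ?_
    simp only [Function.comp_apply, ← hent]
    rw [eLpNorm_one_eq_lintegral_enorm, integral_norm_eq_lintegral_enorm (hie n k l).1]
  have hle : ∀ n ω, ‖sampleCov n (fun m => y m ω) - S‖ ≤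
      ∑ k, ∑ l, ‖(sampleCov n (fun m => y m ω) - S) k l‖ := by
    intro n ω
    refine (abs_le_of_sq_le_sq' ?_ (by positivity)).2
    rw [frobenius_sq]
    refine (Finset.sum_le_sum fun k _ => Finset.sum_sq_le_sq_sum_of_nonneg fun l _ => norm_nonneg _).trans ?_
    exact Finset.sum_sq_le_sq_sum_of_nonneg fun k _ => by positivity
  have hisum : ∀ n, Integrable (fun ω => ∑ k, ∑ l, ‖(sampleCov n (fun m => y m ω) - S) k l‖) P :=
    fun n => integrable_finsetSum _ fun k _ => integrable_finsetSum _ fun l _ => (hie n k l).norm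
  have hmeas : ∀ n, Measurable fun ω => ‖sampleCov n (fun m => y m ω) - S‖ := fun n => by
    refine measurable_norm_of_entries fun k l => ?_
    simp only [hent]
    fun_prop
  have hin : ∀ n, Integrable (fun ω => ‖sampleCov n (fun m => y m ω) - S‖) P := fun n =>
    (hisum n).mono' (hmeas n).aestronglyMeasurable (Eventually.of_forall fun ω => by
      rw [norm_norm]; exact hle n ω)
  refine ⟨hin, ?_⟩
  have hsum : Tendsto (fun n : ℕ => ∑ k, ∑ l, ∫ ω, ‖(sampleCov n (fun m => y m ω) - S) k l‖ ∂P)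
      atTop (𝓝 0) := by
    have := tendsto_finsetSum (Finset.univ : Finset (Fin q)) fun k _ =>
      tendsto_finsetSum (Finset.univ : Finset (Fin q)) fun l _ => hlim k l
    simpa using this
  refine squeeze_zero (fun n => by positivity) (fun n => ?_) hsum
  refine (integral_mono (hin n) (hisum n) (hle n)).trans (le_of_eq ?_)
  rw [integral_finsetSum _ fun k _ => integrable_finsetSum _ fun l _ => (hie n k l).norm]
  refine Finset.sum_congr rfl fun k _ => ?_
  rw [integral_finsetSum _ fun l _ => (hie n k l).norm]

end

end

/-! ### Loss ratio and leakage loss on all events. -/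

noncomputable section

section

open scoped Matrix.Norms.Frobenius

variable {q : ℕ}

/-- The normalized signal loss of the projection `1 - V` relative to `1 - Q`. -/
def lossRatio (B Q : Matrix (Fin q) (Fin q) ℂ) (d : Fin q → ℂ) (η σ : ℝ)
    (V : Matrix (Fin q) (Fin q) ℂ) : ℝ :=
  (quadForm (1 - V) d).re ^ 2 / ((η / σ ^ 2 * (quadForm ((1 - V) * B * (1 - V)) d).re +
    (quadForm (1 - V) d).re) * (quadForm (1 - Q) d).re)

/-- The indicator function of `wellConditioned`. -/
def wellConditionedInd (δ : ℝ) (Q : Matrix (Fin q) (Fin q) ℂ) (n : ℕ) (x : ℕ → Fin q → ℂ) : ℝ :=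
  (wellConditioned δ Q n).indicator 1 x

theorem measurable_wellConditionedInd (δ : ℝ) (Q : Matrix (Fin q) (Fin q) ℂ) (n : ℕ) :
    Measurable (wellConditionedInd δ Q n) :=
  measurable_one.indicator (measurableSet_wellConditioned δ Q n)

theorem wellConditionedInd_mem (δ : ℝ) (Q : Matrix (Fin q) (Fin q) ℂ) (n : ℕ)
    (x : ℕ → Fin q → ℂ) : 0 ≤ wellConditionedInd δ Q n x ∧ wellConditionedInd δ Q n x ≤ 1 := by
  unfold wellConditionedInd
  by_cases hx : x ∈ wellConditioned δ Q n <;> simp [hx]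

/-- First-order loss caused by the leakage `J`. -/
def leakageLoss (B Q : Matrix (Fin q) (Fin q) ℂ) (d : Fin q → ℂ) (η σ : ℝ)
    (J : Matrix (Fin q) (Fin q) ℂ) : ℝ :=
  (2 * (quadForm J d).re + η / σ ^ 2 * (quadForm (Jᴴ * B * J) d).re) / (quadForm (1 - Q) d).re

/-- Since the clutter term in the denominator is nonnegative, the ratio is at most `s / t`. This
deterministic bound is what is used on the bad event. -/
theorem lossRatio_mem {B Q : Matrix (Fin q) (Fin q) ℂ} (hB : B.PosSemidef) {d : Fin q → ℂ}
    (ht : 0 < (quadForm (1 - Q) d).re) {η : ℝ} (hη : 0 ≤ η) (σ : ℝ)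
    {V : Matrix (Fin q) (Fin q) ℂ} (hV : Vᴴ = V) (hVV : V * V = V) :
    0 ≤ lossRatio B Q d η σ V ∧ lossRatio B Q d η σ V ≤ sqLen d / (quadForm (1 - Q) d).re := by
  have hV1 : (1 - V)ᴴ = 1 - V := by simp [hV]
  have hVV1 : (1 - V) * (1 - V) = 1 - V := by simp [sub_mul, mul_sub, hVV]
  have hs := re_quadForm_projection_nonneg hV1 hVV1 d
  have hs2 : (quadForm (1 - V) d).re ≤ sqLen d := by
    have h := re_quadForm_projection_nonneg hV hVV d
    have h1 : (quadForm (1 : Matrix (Fin q) (Fin q) ℂ) d).re = sqLen d := by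
      rw [quadForm, one_mulVec, star_dotProduct_self_eq_sqLen, Complex.ofReal_re]
    rw [quadForm_sub, Complex.sub_re, h1]
    linarith
  have hb : 0 ≤ (quadForm ((1 - V) * B * (1 - V)) d).re := by
    have : quadForm ((1 - V) * B * (1 - V)) d = quadForm B ((1 - V) *ᵥ d) := by
      conv_lhs => rw [← hV1, Matrix.mul_assoc, quadForm_conjTranspose_mul, hV1, ← mulVec_mulVec]
      rfl
    rw [this]; exact hermForm_nonneg hB _
  unfold lossRatio
  set s := (quadForm (1 - V) d).re
  set t := (quadForm (1 - Q) d).re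
  set b := (quadForm ((1 - V) * B * (1 - V)) d).re
  have hb' : 0 ≤ η / σ ^ 2 * b := by positivity
  refine ⟨by positivity, ?_⟩
  rcases hs.eq_or_lt with h | h
  · rw [← h]; have := sqLen_nonneg d; simp; positivity
  · rw [div_le_div_iff₀ (by positivity) ht]
    calc s ^ 2 * t = s * (s * t) := by ring
      _ ≤ sqLen d * ((η / σ ^ 2 * b + s) * t) := mul_le_mul hs2
        (mul_le_mul_of_nonneg_right (by linarith) ht.le) (by positivity) (sqLen_nonneg d)

/-- Needed when the inner data are well conditioned but the noise energy is large: the indicator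
then keeps the leakage term although the expansion is not available. -/
theorem abs_leakageLoss_le {B Q : Matrix (Fin q) (Fin q) ℂ} {d : Fin q → ℂ}
    (ht : 0 < (quadForm (1 - Q) d).re) {η σ : ℝ} (hη : 0 ≤ η) (hσ : 0 < σ)
    (J : Matrix (Fin q) (Fin q) ℂ) :
    |leakageLoss B Q d η σ J| ≤ (2 + η * ‖B‖) * sqLen d / (quadForm (1 - Q) d).re *
      (1 + (‖J‖ ^ 2 + ‖J‖ ^ 4 / σ ^ 4)) := by
  have h1 := abs_re_quadForm_le J d
  have h2 : |(quadForm (Jᴴ * B * J) d).re| ≤ sqLen d * (‖B‖ * ‖J‖ ^ 2) := by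
    refine (abs_re_quadForm_le _ d).trans (mul_le_mul_of_nonneg_left ?_ (sqLen_nonneg d))
    calc ‖Jᴴ * B * J‖ ≤ ‖Jᴴ‖ * ‖B‖ * ‖J‖ := (frobenius_norm_mul _ _).trans
          (mul_le_mul_of_nonneg_right (frobenius_norm_mul _ _) (norm_nonneg _))
      _ = _ := by rw [frobenius_norm_conjTranspose]; ring
  have hd := sqLen_nonneg d
  have hJ := norm_nonneg J
  rw [leakageLoss, abs_div, abs_of_pos ht, div_mul_eq_mul_div ((2 + η * ‖B‖) * sqLen d)]
  refine div_le_div_of_nonneg_right ?_ ht.le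
  have e1 : 2 * ‖J‖ ≤ 1 + ‖J‖ ^ 2 := by nlinarith [sq_nonneg (‖J‖ - 1)]
  have e2 : 2 * (‖J‖ ^ 2 / σ ^ 2) ≤ 1 + ‖J‖ ^ 4 / σ ^ 4 := by
    have := sq_nonneg (‖J‖ ^ 2 / σ ^ 2 - 1)
    have e : ‖J‖ ^ 4 / σ ^ 4 = (‖J‖ ^ 2 / σ ^ 2) ^ 2 := by rw [div_pow]; ring
    rw [e]; linarith
  have e3 : 0 ≤ ‖J‖ ^ 4 / σ ^ 4 := by positivity
  have e4 : 0 ≤ ‖J‖ ^ 2 / σ ^ 2 := by positivity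
  set X := 1 + (‖J‖ ^ 2 + ‖J‖ ^ 4 / σ ^ 4) with hX
  have e5 : 2 * ‖J‖ ≤ 2 * X := by linarith [sq_nonneg ‖J‖]
  have e6 : ‖J‖ ^ 2 / σ ^ 2 ≤ X := by linarith [sq_nonneg ‖J‖]
  calc |2 * (quadForm J d).re + η / σ ^ 2 * (quadForm (Jᴴ * B * J) d).re|
      ≤ 2 * |(quadForm J d).re| + η / σ ^ 2 * |(quadForm (Jᴴ * B * J) d).re| := by
        refine (abs_add_le _ _).trans ?_
        rw [abs_mul, abs_mul, abs_of_pos two_pos, abs_of_nonneg (show 0 ≤ η / σ ^ 2 by positivity)]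
    _ ≤ 2 * (sqLen d * ‖J‖) + η / σ ^ 2 * (sqLen d * (‖B‖ * ‖J‖ ^ 2)) := by gcongr
    _ = sqLen d * (2 * ‖J‖) + η * ‖B‖ * sqLen d * (‖J‖ ^ 2 / σ ^ 2) := by ring
    _ ≤ sqLen d * (2 * X) + η * ‖B‖ * sqLen d * X := by gcongr
    _ = _ := by ring

/-- The loss expansion on all events. -/
theorem exists_abs_lossRatio_sub_le {B Q : Matrix (Fin q) (Fin q) ℂ} (hQ : Qᴴ = Q)
    (hQQ : Q * Q = Q) (hB : B.PosSemidef) (hQB : Q * B = B) (hBQ : B * Q = B) {d : Fin q → ℂ}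
    (ht : 0 < (quadForm (1 - Q) d).re) {η K δ : ℝ} (hη : 0 ≤ η) (hK : 0 ≤ K) (hδ : 0 < δ) :
    ∃ C, 0 ≤ C ∧ ∃ σ₀, 0 < σ₀ ∧ ∀ σ, 0 < σ → σ < σ₀ → ∀ (n : ℕ)
      (V R : Matrix (Fin q) (Fin q) ℂ) (x z : ℕ → Fin q → ℂ), Vᴴ = V → V * V = V →
      Q.trace = V.trace → R * V = V * R → Q * R * Q + (1 - Q) = regularizedCov Q n x →
      Q * R * (1 - Q) = sampleCrossCov n x z →
      ‖R * (1 - V)‖ ≤ (n : ℝ)⁻¹ * ∑ m ∈ Finset.range n, sqLen (z m) →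
      ∀ b : ℝ, 0 ≤ b → (x ∉ wellConditioned δ Q n → 1 ≤ b) →
      (K * σ ^ 2 < (n : ℝ)⁻¹ * ∑ m ∈ Finset.range n, sqLen (z m) → 1 ≤ b) →
      |lossRatio B Q d η σ V - 1 + wellConditionedInd δ Q n x *
        leakageLoss B Q d η σ (subspaceLeakage Q n x z)| ≤
        C * (wellConditionedInd δ Q n x * (‖subspaceLeakage Q n x z‖ ^ 2 +
          ‖subspaceLeakage Q n x z‖ ^ 4 / σ ^ 4)) +
        C * (if Q *ᵥ d = 0 then 0 else 1) * σ ^ 2 + C * b := by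
  obtain ⟨C, hC, H⟩ := lossRatio_expansion hQ hQQ hB hQB hBQ ht hη hK
    (show 0 ≤ √q / δ by positivity)
  set t := (quadForm (1 - Q) d).re with ht'
  have hd := sqLen_nonneg d
  set C₁ := (2 + η * ‖B‖) * sqLen d / t with hC₁
  have hC₁0 : 0 ≤ C₁ := by positivity
  have hc0 : 0 ≤ sqLen d / t := by positivity
  have hlim : Tendsto (fun σ : ℝ => √q / δ * (K * σ ^ 2)) (𝓝 0) (𝓝 0) := by
    have : Continuous fun σ : ℝ => √q / δ * (K * σ ^ 2) := by fun_prop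
    simpa using this.tendsto 0
  obtain ⟨σ₁, hσ₁, hsmall⟩ := Metric.eventually_nhds_iff.1 (hlim.eventually_lt_const
    (show (0 : ℝ) < 1 / 2 by norm_num))
  refine ⟨C + C₁ + (1 + sqLen d / t), by positivity, min 1 σ₁, lt_min one_pos hσ₁, ?_⟩
  intro σ hσ hσlt n V R x z hV hVV htr hRV hT hX hle b hb hb1 hb2
  have hσ1 : σ ≤ 1 := hσlt.le.trans (min_le_left _ _)
  have hσs := hsmall (y := σ) (by
    rw [Real.dist_eq, sub_zero, abs_of_pos hσ]; exact hσlt.trans_le (min_le_right _ _))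
  set J := subspaceLeakage Q n x z with hJ
  obtain ⟨r0, r1⟩ := lossRatio_mem hB ht hη σ hV hVV
  set m : ℝ := if Q *ᵥ d = 0 then 0 else 1 with hm
  have hm0 : 0 ≤ m := by rw [hm]; split_ifs <;> simp
  have hr : |lossRatio B Q d η σ V - 1| ≤ 1 + sqLen d / t := by
    rw [abs_le]; constructor <;> linarith
  have hJ0 : 0 ≤ ‖J‖ ^ 2 + ‖J‖ ^ 4 / σ ^ 4 := by positivity
  set Y := ‖J‖ ^ 2 + ‖J‖ ^ 4 / σ ^ 4 with hY
  have hmσ : 0 ≤ m * σ ^ 2 := by positivity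
  -- The perturbation expansion applies when the inner data are well conditioned and the noise
  -- energy is small. In the other cases `b ≥ 1` pays for the crude bounds.
  by_cases h1 : x ∈ wellConditioned δ Q n
  · have hi : wellConditionedInd δ Q n x = 1 := by simp [wellConditionedInd, h1]
    rw [hi, one_mul, one_mul]
    by_cases h2 : K * σ ^ 2 < (n : ℝ)⁻¹ * ∑ m ∈ Finset.range n, sqLen (z m)
    · have hb' := hb2 h2
      have hl := abs_leakageLoss_le (B := B) ht hη hσ J
      rw [← hC₁, ← hY] at hl
      refine (abs_add_le _ _).trans ?_
      have a1 : 0 ≤ C * Y := by positivity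
      have a2 : 0 ≤ (1 + sqLen d / t) * Y := by positivity
      have a3 : 0 ≤ (C + C₁ + (1 + sqLen d / t)) * m * σ ^ 2 := by positivity
      have a4 : (C + C₁ + (1 + sqLen d / t)) * 1 ≤ (C + C₁ + (1 + sqLen d / t)) * b := by gcongr
      linarith
    · obtain ⟨g1, g2⟩ := inv_of_coercive hδ h1
      have := H σ hσ hσ1 hσs.le V R (regularizedCov Q n x)⁻¹ hV hVV htr hRV (by rw [hT, g1])
        (hle.trans (not_lt.1 h2)) g2 J (by
          rw [hJ, subspaceLeakage, ← hX]; simp only [Matrix.mul_assoc])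
      refine le_trans (by simpa only [lossRatio, leakageLoss] using this) ?_
      rw [← hY]
      have a1 : 0 ≤ (C₁ + (1 + sqLen d / t)) * Y := by positivity
      have a2 : 0 ≤ (C₁ + (1 + sqLen d / t)) * (m * σ ^ 2) := by positivity
      have a3 : 0 ≤ (C + C₁ + (1 + sqLen d / t)) * b := by positivity
      linarith
  · have hi : wellConditionedInd δ Q n x = 0 := by simp [wellConditionedInd, h1]
    have hb' := hb1 h1
    rw [hi, zero_mul, add_zero, zero_mul, mul_zero, zero_add]
    have a3 : 0 ≤ (C + C₁ + (1 + sqLen d / t)) * m * σ ^ 2 := by positivity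
    have a4 : (C + C₁ + (1 + sqLen d / t)) * 1 ≤ (C + C₁ + (1 + sqLen d / t)) * b := by gcongr
    linarith

end

/-! ### Mean of the leakage terms over inner data and outer noise. -/

section

open scoped Matrix.Norms.Frobenius

variable {Ω : Type*} [MeasurableSpace Ω] {P : Measure Ω} [IsProbabilityMeasure P] {q : ℕ}
  {B Q : Matrix (Fin q) (Fin q) ℂ} {X Z : Ω → ℕ → Fin q → ℂ} {s : ℝ}

/-- The second moment is derived from the fourth by `Φ² ≤ (n / (2 s²)) Φ⁴ + s² / (2 n)`, whose
weights balance the two terms when `Φ⁴` is of order `s⁴ / n²`. -/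
theorem integral_sq_add_pow_four_le {I Φ : Ω → ℝ} (mI : Measurable I) (mΦ : Measurable Φ)
    (hI0 : ∀ ω, 0 ≤ I ω) (hI1 : ∀ ω, I ω ≤ 1) (hs : 0 < s) {n : ℕ} (hn : 0 < n) {C₄ : ℝ}
    (hC₄0 : 0 ≤ C₄) (i4 : Integrable (fun ω => I ω * Φ ω ^ 4) P)
    (e4 : ∫ ω, I ω * Φ ω ^ 4 ∂P ≤ C₄ * (s ^ 4 / n ^ 2)) :
    Integrable (fun ω => I ω * (Φ ω ^ 2 + Φ ω ^ 4 / s ^ 4)) P ∧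
    ∫ ω, I ω * (Φ ω ^ 2 + Φ ω ^ 4 / s ^ 4) ∂P ≤ (C₄ + 1) * (s ^ 2 / n + 1 / n ^ 2) := by
  have hn' : (0 : ℝ) < n := by exact_mod_cast hn
  have hpt : ∀ ω, I ω * (Φ ω ^ 2 + Φ ω ^ 4 / s ^ 4) ≤
      (n / (2 * s ^ 2) + 1 / s ^ 4) * (I ω * Φ ω ^ 4) + s ^ 2 / (2 * n) := by
    intro ω
    have hI0 := hI0 ω
    have hI1 := hI1 ω
    have a1 : Φ ω ^ 2 ≤ n / (2 * s ^ 2) * Φ ω ^ 4 + s ^ 2 / (2 * n) := by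
      have : n / (2 * s ^ 2) * Φ ω ^ 4 + s ^ 2 / (2 * n) - Φ ω ^ 2 =
          (n * Φ ω ^ 2 - s ^ 2) ^ 2 / (2 * n * s ^ 2) := by field_simp; ring
      have h2 : 0 ≤ (n * Φ ω ^ 2 - s ^ 2) ^ 2 / (2 * n * s ^ 2) := by positivity
      linarith
    have a2 : I ω * (Φ ω ^ 2) ≤ I ω * (n / (2 * s ^ 2) * Φ ω ^ 4 + s ^ 2 / (2 * n)) := by gcongr
    have a3 : I ω * (s ^ 2 / (2 * n)) ≤ 1 * (s ^ 2 / (2 * n)) := by gcongr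
    calc _ = I ω * Φ ω ^ 2 + I ω * Φ ω ^ 4 / s ^ 4 := by ring
      _ ≤ I ω * (n / (2 * s ^ 2) * Φ ω ^ 4 + s ^ 2 / (2 * n)) + I ω * Φ ω ^ 4 / s ^ 4 := by gcongr
      _ = (n / (2 * s ^ 2) + 1 / s ^ 4) * (I ω * Φ ω ^ 4) + I ω * (s ^ 2 / (2 * n)) := by ring
      _ ≤ _ := by linarith
  have i24' : Integrable (fun ω => (n / (2 * s ^ 2) + 1 / s ^ 4) * (I ω * Φ ω ^ 4) +
      s ^ 2 / (2 * n)) P := (i4.const_mul _).add (integrable_const _)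
  have hnn : ∀ ω, 0 ≤ I ω * (Φ ω ^ 2 + Φ ω ^ 4 / s ^ 4) := fun ω =>
    mul_nonneg (hI0 ω) (by positivity)
  have i24 : Integrable (fun ω => I ω * (Φ ω ^ 2 + Φ ω ^ 4 / s ^ 4)) P := by
    refine i24'.mono' (by fun_prop) (Eventually.of_forall fun ω => ?_)
    rw [Real.norm_of_nonneg (hnn ω)]; exact hpt ω
  have e24 : ∫ ω, I ω * (Φ ω ^ 2 + Φ ω ^ 4 / s ^ 4) ∂P ≤ (C₄ + 1) * (s ^ 2 / n + 1 / n ^ 2) := by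
    refine (integral_mono i24 i24' hpt).trans ?_
    rw [integral_add (i4.const_mul _) (integrable_const _), integral_const_mul]
    simp only [integral_const, probReal_univ, smul_eq_mul, one_mul]
    calc _ ≤ (n / (2 * s ^ 2) + 1 / s ^ 4) * (C₄ * (s ^ 4 / n ^ 2)) + s ^ 2 / (2 * n) := by gcongr
      _ = C₄ * (s ^ 2 / n) / 2 + C₄ * (1 / n ^ 2) + (s ^ 2 / n) / 2 := by field_simp
      _ ≤ _ := by
        have b1 : 0 ≤ s ^ 2 / (n : ℝ) := by positivity
        have b2 : 0 ≤ 1 / (n : ℝ) ^ 2 := by positivity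
        nlinarith [mul_nonneg hC₄0 b1]
  exact ⟨i24, e24⟩

/-- Moments of the leakage for independent clutter data `X` and noise data `Z`. -/
theorem leakage_moments (hQ : Qᴴ = Q) (hQQ : Q * Q = Q) (hs : 0 < s)
    (hX : Measurable X) (hZ : Measurable Z) (hXZ : IndepFun X Z P)
    (hz : ∀ m, IsCircularGaussian (fun ω => Z ω m) ((s : ℂ) ^ 2 • (1 - Q)) P)
    (hi : iIndepFun (fun m ω => Z ω m) P) {δ : ℝ} (hδ : 0 < δ) {n : ℕ} (hn : 0 < n) {C₄ : ℝ}
    (hC₄ : 12 * q ^ 4 * (√(stdGaussianMoment 4) / 2 * (√q / δ + (√q / δ) ^ 2 * ‖1 - Q‖)) ^ 2 ≤ C₄) :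
    Integrable (fun ω => wellConditionedInd δ Q n (X ω) *
      (‖subspaceLeakage Q n (X ω) (Z ω)‖ ^ 2 + ‖subspaceLeakage Q n (X ω) (Z ω)‖ ^ 4 / s ^ 4)) P ∧
    ∫ ω, wellConditionedInd δ Q n (X ω) *
      (‖subspaceLeakage Q n (X ω) (Z ω)‖ ^ 2 + ‖subspaceLeakage Q n (X ω) (Z ω)‖ ^ 4 / s ^ 4) ∂P ≤
      (C₄ + 1) * (s ^ 2 / n + 1 / n ^ 2) := by
  have hC₄0 : 0 ≤ C₄ := le_trans (by positivity) hC₄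
  have hmJ : ∀ k l, Measurable fun p : (ℕ → Fin q → ℂ) × (ℕ → Fin q → ℂ) =>
      subspaceLeakage Q n p.1 p.2 k l := measurable_subspaceLeakage Q n
  have hmN := measurable_norm_of_entries hmJ
  have hmI : Measurable fun p : (ℕ → Fin q → ℂ) × (ℕ → Fin q → ℂ) => wellConditionedInd δ Q n p.1 :=
    (measurable_wellConditionedInd δ Q n).comp measurable_fst
  have hmZ : ∀ m, Measurable fun ω => Z ω m := fun m => (measurable_pi_apply m).comp hZ
  have hind := wellConditionedInd_mem δ Q n
  have hm4 : Measurable fun p : (ℕ → Fin q → ℂ) × (ℕ → Fin q → ℂ) =>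
      wellConditionedInd δ Q n p.1 * ‖subspaceLeakage Q n p.1 p.2‖ ^ 4 := hmI.mul (hmN.pow_const 4)
  -- The indicator depends on the inner data alone, so freezing them either puts the fourth-moment
  -- bound in force or makes the integrand zero.
  obtain ⟨i4, e4⟩ := integrable_of_indepFun_of_integral_le hX hZ hXZ hm4
    (fun p => mul_nonneg (hind _).1 (by positivity)) (c := C₄ * (s ^ 4 / n ^ 2)) (fun x => by
      by_cases hx : x ∈ wellConditioned δ Q n
      · have hi1 : wellConditionedInd δ Q n x = 1 := by simp [wellConditionedInd, hx]
        obtain ⟨a, b⟩ := integral_subspaceLeakage_pow_four_le hQ hQQ hz hmZ hi hδ hx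
        simp only [hi1, one_mul]
        refine ⟨a, b.trans ?_⟩
        gcongr
      · have hi1 : wellConditionedInd δ Q n x = 0 := by simp [wellConditionedInd, hx]
        simp only [hi1, zero_mul, integral_zero]
        exact ⟨integrable_zero _ _ _, by positivity⟩)
  have hXZm : Measurable fun ω => (X ω, Z ω) := hX.prodMk hZ
  have mI : Measurable fun ω => wellConditionedInd δ Q n (X ω) :=
    (measurable_wellConditionedInd δ Q n).comp hX
  have mΦ : Measurable fun ω => ‖subspaceLeakage Q n (X ω) (Z ω)‖ := by
    have := hmN.comp hXZm
    simpa only [Function.comp_def] using this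
  exact integral_sq_add_pow_four_le mI mΦ (fun ω => (hind (X ω)).1) (fun ω => (hind (X ω)).2) hs hn
    hC₄0 i4 e4

/-- The mean first-order loss for independent clutter data `X` and noise data `Z`. -/
theorem integral_leakageLoss (hQ : Qᴴ = Q) (hQQ : Q * Q = Q) (hQB : Q * B = B) (hs : 0 < s)
    (hX : Measurable X) (hZ : Measurable Z) (hXZ : IndepFun X Z P)
    (hXQ : ∀ ω m, Q *ᵥ X ω m = X ω m)
    (hz : ∀ m, IsCircularGaussian (fun ω => Z ω m) ((s : ℂ) ^ 2 • (1 - Q)) P)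
    (hi : iIndepFun (fun m ω => Z ω m) P) {δ : ℝ} (hδ : 0 < δ) {η : ℝ}
    {d : Fin q → ℂ} (ht : 0 < (quadForm (1 - Q) d).re) {n : ℕ} (hn : 0 < n) :
    Integrable (fun ω => wellConditionedInd δ Q n (X ω) *
      leakageLoss B Q d η s (subspaceLeakage Q n (X ω) (Z ω))) P ∧
    ∫ ω, wellConditionedInd δ Q n (X ω) *
      leakageLoss B Q d η s (subspaceLeakage Q n (X ω) (Z ω)) ∂P =
      η / n * ∫ ω, wellConditionedInd δ Q n (X ω) *
        ((regularizedCov Q n (X ω))⁻¹ * B).trace.re ∂P := by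
  have hn' : (0 : ℝ) < n := by exact_mod_cast hn
  have hmJ : ∀ k l, Measurable fun p : (ℕ → Fin q → ℂ) × (ℕ → Fin q → ℂ) =>
      subspaceLeakage Q n p.1 p.2 k l := measurable_subspaceLeakage Q n
  have hmI : Measurable fun p : (ℕ → Fin q → ℂ) × (ℕ → Fin q → ℂ) => wellConditionedInd δ Q n p.1 :=
    (measurable_wellConditionedInd δ Q n).comp measurable_fst
  have hmZ : ∀ m, Measurable fun ω => Z ω m := fun m => (measurable_pi_apply m).comp hZ
  have hind := wellConditionedInd_mem δ Q n
  have i24 := (leakage_moments hQ hQQ hs hX hZ hXZ hz hi hδ hn le_rfl).1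
  set I : Ω → ℝ := fun ω => wellConditionedInd δ Q n (X ω) with hI
  set Φ : Ω → ℝ := fun ω => ‖subspaceLeakage Q n (X ω) (Z ω)‖ with hΦ
  have hXZm : Measurable fun ω => (X ω, Z ω) := hX.prodMk hZ
  have hmQ : Measurable fun p : (ℕ → Fin q → ℂ) × (ℕ → Fin q → ℂ) =>
      wellConditionedInd δ Q n p.1 * (quadForm (subspaceLeakage Q n p.1 p.2) d).re :=
    hmI.mul (Complex.measurable_re.comp (measurable_quadForm_of_entries hmJ d))
  have hmE : Measurable fun p : (ℕ → Fin q → ℂ) × (ℕ → Fin q → ℂ) => wellConditionedInd δ Q n p.1 *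
      (quadForm ((subspaceLeakage Q n p.1 p.2)ᴴ * B * subspaceLeakage Q n p.1 p.2) d).re :=
    hmI.mul (Complex.measurable_re.comp (measurable_quadForm_of_entries
      (measurable_conj_of_entries hmJ B) d))
  have hdom : Integrable (fun ω => 1 + I ω * (Φ ω ^ 2 + Φ ω ^ 4 / s ^ 4)) P :=
    (integrable_const 1).add i24
  have hd := sqLen_nonneg d
  have iQ : Integrable (fun ω => I ω * (quadForm (subspaceLeakage Q n (X ω) (Z ω)) d).re) P := by
    refine (hdom.const_mul (sqLen d)).mono' (hmQ.comp hXZm).aestronglyMeasurable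
      (Eventually.of_forall fun ω => ?_)
    have h1 := abs_re_quadForm_le (subspaceLeakage Q n (X ω) (Z ω)) d
    have hI0 := (hind (X ω)).1
    have hI1 := (hind (X ω)).2
    rw [Real.norm_eq_abs, abs_mul, abs_of_nonneg hI0]
    have h2 : Φ ω ≤ 1 + (Φ ω ^ 2 + Φ ω ^ 4 / s ^ 4) := by
      have : 0 ≤ Φ ω ^ 4 / s ^ 4 := by positivity
      nlinarith [sq_nonneg (Φ ω - 1)]
    calc _ ≤ I ω * (sqLen d * Φ ω) := by gcongr
      _ ≤ I ω * (sqLen d * (1 + (Φ ω ^ 2 + Φ ω ^ 4 / s ^ 4))) := by gcongr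
      _ = sqLen d * (I ω * 1 + I ω * (Φ ω ^ 2 + Φ ω ^ 4 / s ^ 4)) := by ring
      _ ≤ _ := by gcongr; linarith
  have iE : Integrable (fun ω => I ω * (quadForm ((subspaceLeakage Q n (X ω) (Z ω))ᴴ * B *
      subspaceLeakage Q n (X ω) (Z ω)) d).re) P := by
    refine (i24.const_mul (sqLen d * ‖B‖)).mono' (hmE.comp hXZm).aestronglyMeasurable
      (Eventually.of_forall fun ω => ?_)
    set J := subspaceLeakage Q n (X ω) (Z ω) with hJ
    have h2 : |(quadForm (Jᴴ * B * J) d).re| ≤ sqLen d * (‖B‖ * ‖J‖ ^ 2) := by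
      refine (abs_re_quadForm_le _ d).trans (mul_le_mul_of_nonneg_left ?_ (sqLen_nonneg d))
      calc ‖Jᴴ * B * J‖ ≤ ‖Jᴴ‖ * ‖B‖ * ‖J‖ := (frobenius_norm_mul _ _).trans
            (mul_le_mul_of_nonneg_right (frobenius_norm_mul _ _) (norm_nonneg _))
        _ = _ := by rw [frobenius_norm_conjTranspose]; ring
    have hI0 := (hind (X ω)).1
    rw [Real.norm_eq_abs, abs_mul, abs_of_nonneg hI0]
    have h3 : 0 ≤ ‖J‖ ^ 4 / s ^ 4 := by positivity
    calc _ ≤ I ω * (sqLen d * (‖B‖ * ‖J‖ ^ 2)) := by gcongr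
      _ ≤ I ω * (sqLen d * (‖B‖ * (‖J‖ ^ 2 + ‖J‖ ^ 4 / s ^ 4))) := by gcongr; linarith
      _ = _ := by ring
  -- Given the inner data the linear term is centred, so it contributes nothing at order `1 / √n`.
  have eQ : ∫ ω, I ω * (quadForm (subspaceLeakage Q n (X ω) (Z ω)) d).re ∂P = 0 := by
    rw [integral_eq_integral_integral_of_indepFun hX hZ hXZ hmQ iQ]
    refine integral_eq_zero_of_ae (Eventually.of_forall fun ω => ?_)
    have := integral_re_quadForm_subspaceLeakage hQ hQQ hz hmZ hi n (X ω) d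
    simp only [integral_const_mul]
    rw [this, mul_zero]; rfl
  have eE : ∫ ω, I ω * (quadForm ((subspaceLeakage Q n (X ω) (Z ω))ᴴ * B *
      subspaceLeakage Q n (X ω) (Z ω)) d).re ∂P = s ^ 2 * (quadForm (1 - Q) d).re / n *
      ∫ ω, I ω * ((regularizedCov Q n (X ω))⁻¹ * B).trace.re ∂P := by
    rw [integral_eq_integral_integral_of_indepFun hX hZ hXZ hmE iE, ← integral_const_mul]
    congr 1
    ext ω
    simp only [integral_const_mul]
    by_cases hx : X ω ∈ wellConditioned δ Q n
    · rw [integral_quadForm_conj_subspaceLeakage hQ hQQ hQB hz hmZ hi hδ hx (hXQ ω) d]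
      ring
    · have hi1 : wellConditionedInd δ Q n (X ω) = 0 := by simp [wellConditionedInd, hx]
      simp [hI, hi1]
  set t := (quadForm (1 - Q) d).re with ht'
  have esplit : ∀ ω, I ω * leakageLoss B Q d η s (subspaceLeakage Q n (X ω) (Z ω)) =
      2 / t * (I ω * (quadForm (subspaceLeakage Q n (X ω) (Z ω)) d).re) +
      η / s ^ 2 / t * (I ω * (quadForm ((subspaceLeakage Q n (X ω) (Z ω))ᴴ * B *
        subspaceLeakage Q n (X ω) (Z ω)) d).re) := fun ω => by
    rw [leakageLoss]; ring
  refine ⟨?_, ?_⟩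
  · refine Integrable.congr ?_ (Eventually.of_forall fun ω => (esplit ω).symm)
    exact (iQ.const_mul _).add (iE.const_mul _)
  · rw [integral_congr_ae (Eventually.of_forall esplit)]
    rw [integral_add (iQ.const_mul _) (iE.const_mul _), integral_const_mul, integral_const_mul, eQ,
      eE]
    field_simp
    ring

end

end

/-! ### The clutter process and its projections. -/

noncomputable section

section

open scoped Matrix.Norms.Frobenius

variable {Ω : Type*} [MeasurableSpace Ω] {P : Measure Ω} {q : ℕ} {B Q : Matrix (Fin q) (Fin q) ℂ}

/-- Every coordinate of `(1 - Q) X` has variance zero, so the vector lies in the range of `Q` almost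
surely. -/
theorem IsCircularGaussian.mulVec_ae_eq {X : Ω → Fin q → ℂ} {S : Matrix (Fin q) (Fin q) ℂ}
    (hX : IsCircularGaussian X S P) (hQ : Qᴴ = Q) (hS : S * (1 - Q) = 0) :
    ∀ᵐ ω ∂P, Q *ᵥ X ω = X ω := by
  have h : ∀ k, ∀ᵐ ω ∂P, star (X ω) ⬝ᵥ ((1 - Q) *ᵥ Pi.single k 1) = 0 := fun k => by
    refine hX.dotProduct_ae_eq_zero ?_
    rw [hermForm, mulVec_mulVec, hS, zero_mulVec, dotProduct_zero, Complex.zero_re]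
  filter_upwards [ae_all_iff.2 h] with ω hω
  have hQ1 : (1 - Q)ᴴ = 1 - Q := by simp [hQ]
  have h0 : (1 - Q) *ᵥ X ω = 0 := by
    ext k
    have := congrArg star (hω k)
    rw [← star_dotProduct, ← star_dotProduct_mulVec_of_projection hQ1, star_zero] at this
    simpa [← Pi.single_star] using this
  rw [sub_mulVec, one_mulVec, sub_eq_zero] at h0
  exact h0.symm

/-- The clutter part `τ c` of a snapshot. -/
def clutter (τ : ℕ → Ω → ℝ) (c : ℕ → Ω → Fin q → ℂ) (m : ℕ) (ω : Ω) : Fin q → ℂ :=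
  fun k => (τ m ω : ℂ) * c m ω k

variable {τ : ℕ → Ω → ℝ} {c z : ℕ → Ω → Fin q → ℂ} {S : Matrix (Fin q) (Fin q) ℂ} {σ : ℝ}

theorem measurable_clutter (hτ : ∀ m, Measurable (τ m)) (hc : ∀ m, Measurable (c m)) (m : ℕ) :
    Measurable (clutter τ c m) := by
  have := hτ m
  have := hc m
  unfold clutter
  fun_prop

theorem IsSIRV.iIndepFun_clutter (H : IsSIRV τ c z S σ P) : iIndepFun (clutter τ c) P :=
  H.indep_snapshots.comp (fun _ (x : ℝ × (Fin q → ℂ) × (Fin q → ℂ)) (k : Fin q) =>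
    (x.1 : ℂ) * x.2.1 k) fun _ => by fun_prop

theorem IsSIRV.identDistrib_clutter [IsProbabilityMeasure P] (H : IsSIRV τ c z S σ P) (m : ℕ) :
    IdentDistrib (clutter τ c m) (clutter τ c 0) P P :=
  (IdentDistrib.prodMk (H.texture_identDistrib m) ((H.speckle m).identDistrib (H.speckle 0))
    (H.indep_texture_speckle m) (H.indep_texture_speckle 0)).comp
    (u := fun (x : ℝ × (Fin q → ℂ)) (k : Fin q) => (x.1 : ℂ) * x.2 k) (by fun_prop)

theorem IsSIRV.integral_clutter_mul_star (H : IsSIRV τ c z S σ P) (hS : S.PosSemidef)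
    (k l : Fin q) :
    Integrable (fun ω => clutter τ c 0 ω k * star (clutter τ c 0 ω l)) P ∧
      ∫ ω, clutter τ c 0 ω k * star (clutter τ c 0 ω l) ∂P =
        (((∫ ω, τ 0 ω ^ 2 ∂P : ℝ) : ℂ) • S) k l := by
  have e : ∀ ω, clutter τ c 0 ω k * star (clutter τ c 0 ω l) =
      ((τ 0 ω ^ 2 : ℝ) : ℂ) * (c 0 ω k * star (c 0 ω l)) := fun ω => by
    simp only [clutter, star_mul', Complex.star_def, Complex.conj_ofReal, Complex.ofReal_pow]
    ring
  have hind : IndepFun (fun ω => ((τ 0 ω ^ 2 : ℝ) : ℂ)) (fun ω => c 0 ω k * star (c 0 ω l)) P :=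
    (H.indep_texture_speckle 0).comp (φ := fun t : ℝ => ((t ^ 2 : ℝ) : ℂ))
      (ψ := fun x : Fin q → ℂ => x k * star (x l)) (by fun_prop) (by fun_prop)
  have i1 : Integrable (fun ω => ((τ 0 ω ^ 2 : ℝ) : ℂ)) P :=
    (H.texture_memLp 0).integrable_sq.ofReal
  have i2 := (H.speckle 0).integrable_mul_star k l
  simp only [e]
  refine ⟨hind.integrable_mul i1 i2, ?_⟩
  rw [hind.integral_fun_mul_eq_mul_integral i1.1 i2.1, (H.speckle 0).integral_mul_star hS,
    Matrix.smul_apply, smul_eq_mul, integral_complex_ofReal]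

theorem IsSIRV.integrable_sqLen_clutter [IsProbabilityMeasure P] (H : IsSIRV τ c z S σ P)
    (hS : S.PosSemidef) (m : ℕ) : Integrable (fun ω => sqLen (clutter τ c m ω)) P ∧
      ∫ ω, sqLen (clutter τ c m ω) ∂P = ∫ ω, sqLen (clutter τ c 0 ω) ∂P := by
  have hs : Measurable (sqLen : (Fin q → ℂ) → ℝ) := by unfold sqLen; fun_prop
  have hid := (H.identDistrib_clutter m).comp hs
  have e : ∀ ω, sqLen (clutter τ c 0 ω) =
      ∑ k, (clutter τ c 0 ω k * star (clutter τ c 0 ω k)).re := fun ω => by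
    refine Finset.sum_congr rfl fun k _ => ?_
    rw [Complex.star_def, Complex.mul_conj', ← Complex.ofReal_pow, Complex.ofReal_re]
  have h0 : Integrable (fun ω => sqLen (clutter τ c 0 ω)) P := by
    simp only [e]
    exact integrable_finsetSum _ fun k _ => (H.integral_clutter_mul_star hS k k).1.re
  exact ⟨hid.integrable_iff.2 h0, hid.integral_eq⟩

theorem IsCircularGaussian.integral_sqLen {X : Ω → Fin q → ℂ} {s : ℝ}
    (hX : IsCircularGaussian X ((s : ℂ) ^ 2 • (1 : Matrix (Fin q) (Fin q) ℂ)) P) :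
    Integrable (fun ω => sqLen (X ω)) P ∧ ∫ ω, sqLen (X ω) ∂P = q * s ^ 2 := by
  have h1 : ∀ k : Fin q,
      hermForm ((s : ℂ) ^ 2 • (1 : Matrix (Fin q) (Fin q) ℂ)) (Pi.single k 1) = s ^ 2 := fun k => by
    rw [hermForm_smul_one, sqLen, Finset.sum_eq_single k]
    · simp
    · intro b _ hb; simp [hb]
    · simp
  have hk : ∀ k, Integrable (fun ω => ‖X ω k‖ ^ 2) P ∧ ∫ ω, ‖X ω k‖ ^ 2 ∂P = s ^ 2 := fun k => by
    have := hX.integral_norm_sq (w := Pi.single k 1) (by rw [h1]; positivity)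
    rw [h1] at this
    simpa using this
  unfold sqLen
  refine ⟨integrable_finsetSum _ fun k _ => (hk k).1, ?_⟩
  rw [integral_finsetSum _ fun k _ => (hk k).1]
  simp [(hk _).2]

theorem sqLen_projection_le (hQ : Qᴴ = Q) (hQQ : Q * Q = Q) (v : Fin q → ℂ) :
    sqLen (Q *ᵥ v) ≤ sqLen v := by
  have h := IsCircularGaussian.sqLen_projection_add hQ hQQ v v
  rw [← add_mulVec, add_sub_cancel, one_mulVec] at h
  linarith [sqLen_nonneg ((1 - Q) *ᵥ v)]

/-- The inverse of the limiting regularized covariance. -/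
theorem exists_inv_regularized {Bi : Matrix (Fin q) (Fin q) ℂ} (hQQ : Q * Q = Q) (hQB : Q * B = B)
    (hBQ : B * Q = B) (hBi : B * Bi = Q) {e : ℝ} (he : e ≠ 0) :
    ∃ H : Matrix (Fin q) (Fin q) ℂ, ((e : ℂ) • B + (1 - Q)) * H = 1 ∧
      (H * B).trace = (e : ℂ)⁻¹ * Q.trace := by
  have he' : (e : ℂ) ≠ 0 := by exact_mod_cast he
  -- `Bi` need only be a right inverse of `B` on the range; the left factor `Q` removes its
  -- component in the kernel of `Q`.
  refine ⟨(e : ℂ)⁻¹ • (Q * Bi) + (1 - Q), ?_, ?_⟩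
  · have h1 : B * (Q * Bi) = Q := by rw [← Matrix.mul_assoc, hBQ, hBi]
    have h2 : (1 - Q) * (Q * Bi) = 0 := by
      rw [← Matrix.mul_assoc, sub_mul, one_mul, hQQ, sub_self, Matrix.zero_mul]
    have h3 : B * (1 - Q) = 0 := by rw [mul_sub, mul_one, hBQ, sub_self]
    have h4 : (1 - Q) * (1 - Q) = 1 - Q := by simp [sub_mul, mul_sub, hQQ]
    rw [add_mul, mul_add, mul_add, smul_mul_smul_comm, h1, mul_inv_cancel₀ he', one_smul,
      smul_mul_assoc, h3, smul_zero, mul_smul_comm, h2, smul_zero, h4]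
    abel
  · have h1 : (Q * Bi * B).trace = Q.trace := by
      rw [trace_mul_comm, ← Matrix.mul_assoc, hBQ, hBi]
    have h2 : (1 - Q) * B = 0 := by rw [sub_mul, one_mul, hQB, sub_self]
    rw [add_mul, h2, add_zero, smul_mul_assoc, trace_smul, h1, smul_eq_mul]

theorem sampleCov_projection (hQ : Qᴴ = Q) (n : ℕ) (x : ℕ → Fin q → ℂ) :
    sampleCov n (fun m => Q *ᵥ x m) = Q * sampleCov n x * Q := by
  simp only [sampleCov, mul_smul_comm, smul_mul_assoc, Matrix.mul_sum, Matrix.sum_mul,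
    mul_vecMulVec, vecMulVec_mul, star_mulVec, hQ]

theorem sampleCrossCov_projection (hQ : Qᴴ = Q) (n : ℕ) (x : ℕ → Fin q → ℂ) :
    sampleCrossCov n (fun m => Q *ᵥ x m) (fun m => (1 - Q) *ᵥ x m) =
      Q * sampleCov n x * (1 - Q) := by
  have hQ1 : (1 - Q)ᴴ = 1 - Q := by simp [hQ]
  simp only [sampleCrossCov, sampleCov, mul_smul_comm, smul_mul_assoc, Matrix.mul_sum,
    Matrix.sum_mul, mul_vecMulVec, vecMulVec_mul, star_mulVec, hQ1]

/-- Applied with `1 - Q` it identifies the bound supplied by the extremal property of principal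
components as the mean outer noise energy. -/
theorem re_trace_sampleCov_mul (hQ : Qᴴ = Q) (hQQ : Q * Q = Q) (n : ℕ) (x : ℕ → Fin q → ℂ) :
    (sampleCov n x * Q).trace.re = (n : ℝ)⁻¹ * ∑ m ∈ Finset.range n, sqLen (Q *ᵥ x m) := by
  have h : ∀ m, (vecMulVec (x m) (star (x m)) * Q).trace = (sqLen (Q *ᵥ x m) : ℂ) := fun m => by
    rw [vecMulVec_mul, trace_vecMulVec, dotProduct_comm, ← dotProduct_mulVec]
    exact sqLen_mulVec_of_projection hQ hQQ _
  rw [sampleCov, smul_mul_assoc, trace_smul, Matrix.sum_mul, trace_sum, smul_eq_mul,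
    ← Complex.ofReal_natCast, ← Complex.ofReal_inv, Complex.re_ofReal_mul, Complex.re_sum]
  simp only [h, Complex.ofReal_re]

theorem sampleCov_posSemidef (n : ℕ) (x : ℕ → Fin q → ℂ) : (sampleCov n x).PosSemidef := by
  unfold sampleCov
  refine PosSemidef.smul (posSemidef_sum _ fun m _ => posSemidef_vecMulVec_self_star _) ?_
  rw [← Complex.ofReal_natCast, ← Complex.ofReal_inv]
  exact Complex.zero_le_real.2 (by positivity)

end

end

/-! ### Inner data, outer noise, the bad event, and the limiting trace. -/

noncomputable section

section

open scoped Matrix.Norms.Frobenius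

variable {Ω : Type*} {q : ℕ} {Q : Matrix (Fin q) (Fin q) ℂ} {τ : ℕ → Ω → ℝ}
  {c z : ℕ → Ω → Fin q → ℂ} {σ : ℝ}

/-- The data seen inside the range of `Q`. -/
def innerData (Q : Matrix (Fin q) (Fin q) ℂ) (τ : ℕ → Ω → ℝ) (c z : ℕ → Ω → Fin q → ℂ) (ω : Ω) :
    ℕ → Fin q → ℂ :=
  fun m => Q *ᵥ snapshot (τ m ω) (c m ω) (z m ω)

/-- The noise seen outside the range of `Q`. -/
def outerNoise (Q : Matrix (Fin q) (Fin q) ℂ) (z : ℕ → Ω → Fin q → ℂ) (ω : Ω) : ℕ → Fin q → ℂ :=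
  fun m => (1 - Q) *ᵥ z m ω

/-- The event that the clutter data are badly conditioned or the noise energy is large. -/
def badEvent (δ : ℝ) (Q : Matrix (Fin q) (Fin q) ℂ) (τ : ℕ → Ω → ℝ) (c z : ℕ → Ω → Fin q → ℂ)
    (σ : ℝ) (n : ℕ) : Set Ω :=
  {ω | (fun m => clutter τ c m ω) ∉ wellConditioned δ Q n} ∪
    {ω | (q + 1) * σ ^ 2 ≤ (n : ℝ)⁻¹ * ∑ m ∈ Finset.range n, sqLen (z m ω)}

/-- Inner data are clutter plus projected noise, and off the bad event the noise energy is at most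
`δ`. The bad event tests the conditioning of the clutter, whose law is free of `σ`, so its
probability has a constant uniform in `σ`. The factor `4` is the loss in `wellConditioned_add`. -/
theorem innerData_mem_wellConditioned (hQ : Qᴴ = Q) (hQQ : Q * Q = Q) {δ : ℝ} {n : ℕ} {ω : Ω}
    (hσδ : (q + 1) * σ ^ 2 ≤ δ) (hcl : ∀ m, Q *ᵥ clutter τ c m ω = clutter τ c m ω)
    (h : ω ∉ badEvent (4 * δ) Q τ c z σ n) : innerData Q τ c z ω ∈ wellConditioned δ Q n := by
  simp only [badEvent, Set.mem_union, Set.mem_ofPred_eq, not_or, not_not, not_le] at h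
  refine wellConditioned_add hQ hQQ h.1 (u := fun m => Q *ᵥ z m ω) (fun m _ => ?_) ?_
  · change Q *ᵥ (clutter τ c m ω + z m ω) = _
    rw [mulVec_add, hcl]
  · refine le_trans ?_ (h.2.le.trans hσδ)
    exact mul_le_mul_of_nonneg_left (Finset.sum_le_sum fun m _ => sqLen_projection_le hQ hQQ _)
      (by positivity)

end

section

open scoped Matrix.Norms.Frobenius

variable {Ω : Type*} [MeasurableSpace Ω] {P : Measure Ω} {q : ℕ}
  {B Q : Matrix (Fin q) (Fin q) ℂ} {τ : ℕ → Ω → ℝ} {c z : ℕ → Ω → Fin q → ℂ}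
  {S : Matrix (Fin q) (Fin q) ℂ} {σ : ℝ}

theorem IsSIRV.iIndepFun_noise (H : IsSIRV τ c z S σ P) : iIndepFun z P :=
  H.indep_snapshots.comp (fun _ (x : ℝ × (Fin q → ℂ) × (Fin q → ℂ)) => x.2.2) fun _ => by fun_prop

theorem IsSIRV.clutter_ae_eq (H : IsSIRV τ c z S σ P) (hQ : Qᴴ = Q) (hS : S * (1 - Q) = 0) :
    ∀ᵐ ω ∂P, (∀ m, Q *ᵥ c m ω = c m ω) ∧ ∀ m, Q *ᵥ clutter τ c m ω = clutter τ c m ω := by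
  filter_upwards [ae_all_iff.2 fun m => (H.speckle m).mulVec_ae_eq hQ hS] with ω hω
  refine ⟨hω, fun m => ?_⟩
  have : clutter τ c m ω = (τ m ω : ℂ) • c m ω := rfl
  rw [this, mulVec_smul, hω]

theorem measurable_mulVec_const (Q : Matrix (Fin q) (Fin q) ℂ) :
    Measurable fun x : Fin q → ℂ => Q *ᵥ x := by
  refine measurable_pi_iff.2 fun i => ?_
  simp only [mulVec, dotProduct]; fun_prop

theorem measurable_innerData (hτ : ∀ m, Measurable (τ m)) (hc : ∀ m, Measurable (c m))
    (hz : ∀ m, Measurable (z m)) : Measurable (innerData Q τ c z) := by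
  refine measurable_pi_iff.2 fun m => ?_
  refine (measurable_mulVec_const Q).comp ?_
  exact (measurable_clutter hτ hc m).add (hz m)

theorem measurable_outerNoise (hz : ∀ m, Measurable (z m)) : Measurable (outerNoise Q z) :=
  measurable_pi_iff.2 fun m => (measurable_mulVec_const (1 - Q)).comp (hz m)

theorem IsSIRV.iIndepFun_outerNoise (H : IsSIRV τ c z S σ P) (Q : Matrix (Fin q) (Fin q) ℂ) :
    iIndepFun (fun m ω => outerNoise Q z ω m) P :=
  H.iIndepFun_noise.comp (fun _ x => (1 - Q) *ᵥ x) fun _ => measurable_mulVec_const _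

theorem measurableSet_badEvent (hτ : ∀ m, Measurable (τ m)) (hc : ∀ m, Measurable (c m))
    (hz : ∀ m, Measurable (z m)) (δ : ℝ) (n : ℕ) :
    MeasurableSet (badEvent δ Q τ c z σ n) := by
  have cs : Measurable (sqLen : (Fin q → ℂ) → ℝ) := by unfold sqLen; fun_prop
  have h1 : Measurable fun ω m => clutter τ c m ω :=
    measurable_pi_iff.2 fun m => measurable_clutter hτ hc m
  refine MeasurableSet.union (h1 (measurableSet_wellConditioned δ Q n).compl) ?_
  refine measurableSet_le measurable_const (Measurable.const_mul ?_ _)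
  exact Finset.measurable_sum _ fun m _ => cs.comp (hz m)

variable [IsProbabilityMeasure P]

theorem IsSIRV.indepFun_innerData_outerNoise (H : IsSIRV τ c z S σ P) (hτ : ∀ m, Measurable (τ m))
    (hc : ∀ m, Measurable (c m)) (hz : ∀ m, Measurable (z m)) (hQ : Qᴴ = Q) (hQQ : Q * Q = Q) :
    IndepFun (innerData Q τ c z) (outerNoise Q z) P := by
  have h := indepFun_sequences (P := P) (fun i => by
    rcases i with ⟨m, b | b⟩
    · simpa [Function.comp_def] using (measurable_mulVec_const (1 - Q)).comp (hz m)
    · exact (measurable_mulVec_const Q).comp ((measurable_clutter hτ hc m).add (hz m)))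
    (H.iIndepFun_projection hτ hc hz hQ hQQ)
  simp only [if_true, Bool.false_eq_true, if_false] at h
  exact h

theorem measureReal_badEvent_le (H : IsSIRV τ c z S σ P) (hσ : 0 < σ)
    (hz : ∀ m, Measurable (z m)) {δ C : ℝ} {n : ℕ} (hn : 0 < n)
    (hC : P.real {ω | (fun m => clutter τ c m ω) ∉ wellConditioned δ Q n} ≤ C / n ^ 2) :
    P.real (badEvent δ Q τ c z σ n) ≤ (C + 24 * q ^ 4 * (stdGaussianMoment 8 + 1)) / n ^ 2 := by
  refine (measureReal_union_le _ _).trans ?_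
  rw [add_div]
  exact add_le_add hC (measure_noise_energy_ge_le hσ H.noise hz H.iIndepFun_noise hn)

/-- The limiting mean of the trace of the inverse regularized covariance. -/
theorem exists_abs_integral_trace_sub_le (H : IsSIRV τ c z S σ P) (hσ : 0 < σ)
    (hτ : ∀ m, Measurable (τ m)) (hc : ∀ m, Measurable (c m)) (hz : ∀ m, Measurable (z m))
    (hQ : Qᴴ = Q) (hQQ : Q * Q = Q) (hS : S.PosSemidef) (hSQ : S * (1 - Q) = 0) {δ : ℝ} (hδ : 0 < δ)
    (hσδ : (q + 1) * σ ^ 2 ≤ δ) {S' N : Matrix (Fin q) (Fin q) ℂ} (hN : (S' + (1 - Q)) * N = 1)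
    {n : ℕ} (hn : 0 < n)
    (hi : Integrable (fun ω => ‖sampleCov n (fun m => clutter τ c m ω) - S'‖) P) :
    |∫ ω, wellConditionedInd δ Q n (innerData Q τ c z ω) *
        ((regularizedCov Q n (innerData Q τ c z ω))⁻¹ * B).trace.re ∂P - (N * B).trace.re| ≤
      q * (√q / δ * ‖N‖ * ‖B‖) * (∫ ω, ‖sampleCov n (fun m => clutter τ c m ω) - S'‖ ∂P +
        σ * ∫ ω, sqLen (clutter τ c 0 ω) ∂P + (σ + σ ^ 2) * q) +
      |(N * B).trace.re| * P.real (badEvent (4 * δ) Q τ c z σ n) := by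
  have hn' : (n : ℝ) ≠ 0 := by positivity
  set L := (N * B).trace.re with hL
  set C := q * (√q / δ * ‖N‖ * ‖B‖) with hC
  have hC0 : 0 ≤ C := by positivity
  set X := innerData Q τ c z with hX
  have hXm : Measurable X := measurable_innerData hτ hc hz
  have hbad := measurableSet_badEvent (Q := Q) (σ := σ) hτ hc hz (4 * δ) n
  -- Bounds the difference between the sample covariances of inner data and clutter; the weight `σ`
  -- in Young's inequality makes its mean `O(σ)`.
  set D : Ω → ℝ := fun ω => (n : ℝ)⁻¹ * ∑ m ∈ Finset.range n,
    (σ * sqLen (clutter τ c m ω) + (σ⁻¹ + 1) * sqLen (z m ω)) with hD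
  have iD1 : ∀ m, Integrable (fun ω => σ * sqLen (clutter τ c m ω) + (σ⁻¹ + 1) * sqLen (z m ω)) P :=
    fun m => ((H.integrable_sqLen_clutter hS m).1.const_mul _).add
      ((H.noise m).integral_sqLen.1.const_mul _)
  have iD : Integrable D P := (integrable_finsetSum _ fun m _ => iD1 m).const_mul _
  have eD : ∫ ω, D ω ∂P = σ * ∫ ω, sqLen (clutter τ c 0 ω) ∂P + (σ + σ ^ 2) * q := by
    simp only [hD]
    rw [integral_const_mul, integral_finsetSum _ fun m _ => iD1 m]
    have : ∀ m, ∫ ω, σ * sqLen (clutter τ c m ω) + (σ⁻¹ + 1) * sqLen (z m ω) ∂P =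
        σ * ∫ ω, sqLen (clutter τ c 0 ω) ∂P + (σ + σ ^ 2) * q := fun m => by
      rw [integral_add ((H.integrable_sqLen_clutter hS m).1.const_mul _)
        ((H.noise m).integral_sqLen.1.const_mul _), integral_const_mul, integral_const_mul,
        (H.integrable_sqLen_clutter hS m).2, (H.noise m).integral_sqLen.2]
      field_simp
    simp only [this, Finset.sum_const, Finset.card_range, nsmul_eq_mul]
    rw [inv_mul_cancel_left₀ hn']
  set F : Ω → ℝ := fun ω => wellConditionedInd δ Q n (X ω) *
    ((regularizedCov Q n (X ω))⁻¹ * B).trace.re with hF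
  have hFm : Measurable F := by
    have h1 : Measurable fun x => ((regularizedCov Q n x)⁻¹ * B).trace := by
      simp only [Matrix.trace, Matrix.diag, Matrix.mul_apply]
      exact Finset.measurable_sum _ fun k _ => Finset.measurable_sum _ fun l _ =>
        (measurable_regularizedCov_inv Q n k l).mul_const _
    exact ((measurable_wellConditionedInd δ Q n).comp hXm).mul
      (Complex.measurable_re.comp (h1.comp hXm))
  set Y : Ω → ℝ := fun ω => C * (‖sampleCov n (fun m => clutter τ c m ω) - S'‖ + D ω) +
    |L| * (badEvent (4 * δ) Q τ c z σ n).indicator 1 ω with hY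
  have ib : Integrable ((badEvent (4 * δ) Q τ c z σ n).indicator (1 : Ω → ℝ)) P :=
    (integrable_const (1 : ℝ)).indicator hbad
  have i1 : Integrable (fun ω => C * (‖sampleCov n (fun m => clutter τ c m ω) - S'‖ + D ω)) P :=
    (hi.add iD).const_mul C
  have iY : Integrable Y P := i1.add (ib.const_mul _)
  have hle : ∀ᵐ ω ∂P, ‖F ω - L‖ ≤ Y ω := by
    filter_upwards [H.clutter_ae_eq hQ hSQ] with ω hω
    have hD0 : 0 ≤ D ω := by
      refine mul_nonneg (by positivity) (Finset.sum_nonneg fun m _ => ?_)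
      have := sqLen_nonneg (clutter τ c m ω)
      have := sqLen_nonneg (z m ω)
      positivity
    rw [Real.norm_eq_abs]
    by_cases hx : X ω ∈ wellConditioned δ Q n
    · have hi1 : wellConditionedInd δ Q n (X ω) = 1 := by simp [wellConditionedInd, hx]
      simp only [hF, hi1, one_mul]
      refine (abs_trace_inv_sub_le hδ hx hN).trans ?_
      have h0 : 0 ≤ |L| * (badEvent (4 * δ) Q τ c z σ n).indicator (1 : Ω → ℝ) ω :=
        mul_nonneg (abs_nonneg _) (Set.indicator_nonneg (fun _ _ => zero_le_one) _)
      have h1 : ‖sampleCov n (X ω) - S'‖ ≤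
          ‖sampleCov n (fun m => clutter τ c m ω) - S'‖ + D ω := by
        have e : sampleCov n (X ω) - S' = (sampleCov n (fun m => clutter τ c m ω) - S') +
            (sampleCov n (X ω) - sampleCov n (fun m => clutter τ c m ω)) := by abel
        rw [e]
        refine (norm_add_le _ _).trans (add_le_add le_rfl ?_)
        refine (norm_sampleCov_add_sub_le hσ (u := fun m => Q *ᵥ z m ω) (fun m _ => ?_)).trans ?_
        · change Q *ᵥ (clutter τ c m ω + z m ω) = _
          rw [mulVec_add, hω.2]
        · refine mul_le_mul_of_nonneg_left (Finset.sum_le_sum fun m _ => ?_) (by positivity)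
          have := sqLen_projection_le hQ hQQ (z m ω)
          gcongr
      calc _ ≤ C * (‖sampleCov n (fun m => clutter τ c m ω) - S'‖ + D ω) := by
            rw [← hC]; gcongr
        _ ≤ _ := by simp only [hY]; linarith
    · have hi1 : wellConditionedInd δ Q n (X ω) = 0 := by simp [wellConditionedInd, hx]
      have hb : ω ∈ badEvent (4 * δ) Q τ c z σ n := by
        by_contra hb
        exact hx (innerData_mem_wellConditioned hQ hQQ hσδ hω.2 hb)
      simp only [hF, hi1, zero_mul, zero_sub, abs_neg, hY, Set.indicator_of_mem hb, Pi.one_apply,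
        mul_one]
      have : 0 ≤ C * (‖sampleCov n (fun m => clutter τ c m ω) - S'‖ + D ω) := by positivity
      linarith
  have iFL : Integrable (fun ω => F ω - L) P :=
    iY.mono' (hFm.sub_const L).aestronglyMeasurable hle
  have iF : Integrable F P :=
    (iFL.add (integrable_const L)).congr (Eventually.of_forall fun ω => sub_add_cancel _ _)
  have e1 : ∫ ω, F ω ∂P - L = ∫ ω, F ω - L ∂P := by
    rw [integral_sub iF (integrable_const _)]; simp
  rw [e1, ← Real.norm_eq_abs]
  refine (norm_integral_le_of_norm_le iY hle).trans (le_of_eq ?_)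
  simp only [hY]
  rw [integral_add i1 (ib.const_mul _), integral_const_mul,
    integral_const_mul, integral_indicator_one hbad]
  rw [integral_add hi iD, eD, add_assoc]

end

end

/-! ### Expansion of the mean loss ratio. -/

noncomputable section

section

open scoped Matrix.Norms.Frobenius

variable {Ω : Type*} [MeasurableSpace Ω] {P : Measure Ω} {q : ℕ}
  {B Q : Matrix (Fin q) (Fin q) ℂ} {τ : ℕ → Ω → ℝ} {c : ℕ → Ω → Fin q → ℂ}
  {z : ℝ → ℕ → Ω → Fin q → ℂ}

theorem aemeasurable_quadForm_of_entries {V : Ω → Matrix (Fin q) (Fin q) ℂ}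
    (hV : ∀ k l, AEMeasurable (fun ω => V ω k l) P) (d : Fin q → ℂ) :
    AEMeasurable (fun ω => quadForm (V ω) d) P := by
  simp only [quadForm, dotProduct, mulVec]
  fun_prop

theorem aemeasurable_mul_apply {V W : Ω → Matrix (Fin q) (Fin q) ℂ}
    (hV : ∀ k l, AEMeasurable (fun ω => V ω k l) P) (hW : ∀ k l, AEMeasurable (fun ω => W ω k l) P)
    (k l : Fin q) : AEMeasurable (fun ω => (V ω * W ω) k l) P := by
  simp only [Matrix.mul_apply]
  fun_prop

theorem aemeasurable_lossRatio {V : Ω → Matrix (Fin q) (Fin q) ℂ}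
    (hV : ∀ k l, AEMeasurable (fun ω => V ω k l) P) (d : Fin q → ℂ) (η σ : ℝ) :
    AEMeasurable (fun ω => lossRatio B Q d η σ (V ω)) P := by
  have h1 : ∀ k l, AEMeasurable (fun ω => (1 - V ω) k l) P := fun k l => by
    simp only [Matrix.sub_apply]; exact (hV k l).const_sub _
  have h2 : ∀ k l, AEMeasurable (fun ω => ((1 - V ω) * B * (1 - V ω)) k l) P :=
    aemeasurable_mul_apply (aemeasurable_mul_apply h1 fun _ _ => aemeasurable_const) h1
  have h3 := Complex.measurable_re.comp_aemeasurable (aemeasurable_quadForm_of_entries h1 d)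
  have h4 := Complex.measurable_re.comp_aemeasurable (aemeasurable_quadForm_of_entries h2 d)
  exact (h3.pow_const 2).div (((h4.const_mul _).add h3).mul_const _)

variable [IsProbabilityMeasure P]

/-- Expansion of the mean loss ratio of the sample projection at a single noise level. -/
theorem abs_integral_lossRatio_sub_le {z : ℕ → Ω → Fin q → ℂ} {S : Matrix (Fin q) (Fin q) ℂ}
    {σ : ℝ} (H : IsSIRV τ c z S σ P) (hσ : 0 < σ)
    (hτ : ∀ m, Measurable (τ m)) (hc : ∀ m, Measurable (c m)) (hz : ∀ m, Measurable (z m))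
    (hQ : Qᴴ = Q) (hQQ : Q * Q = Q) (hB : B.PosSemidef) (hQB : Q * B = B)
    (hSQ : S * (1 - Q) = 0) {r : ℂ} (hr : Q.trace = r) {d : Fin q → ℂ}
    (ht : 0 < (quadForm (1 - Q) d).re) {η : ℝ} (hη : 0 ≤ η) {δ : ℝ} (hδ : 0 < δ)
    (hσδ : (q + 1) * σ ^ 2 ≤ δ) {C C₄ μ : ℝ} (hC : 0 ≤ C) {n : ℕ} (hn : 0 < n)
    (hC₄ : 12 * q ^ 4 * (√(stdGaussianMoment 4) / 2 * (√q / δ + (√q / δ) ^ 2 * ‖1 - Q‖)) ^ 2 ≤ C₄)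
    (hexp : ∀ (V R : Matrix (Fin q) (Fin q) ℂ) (x z : ℕ → Fin q → ℂ), Vᴴ = V → V * V = V →
      Q.trace = V.trace → R * V = V * R → Q * R * Q + (1 - Q) = regularizedCov Q n x →
      Q * R * (1 - Q) = sampleCrossCov n x z →
      ‖R * (1 - V)‖ ≤ (n : ℝ)⁻¹ * ∑ m ∈ Finset.range n, sqLen (z m) →
      ∀ b : ℝ, 0 ≤ b → (x ∉ wellConditioned δ Q n → 1 ≤ b) →
      ((q + 1) * σ ^ 2 < (n : ℝ)⁻¹ * ∑ m ∈ Finset.range n, sqLen (z m) → 1 ≤ b) →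
      |lossRatio B Q d η σ V - 1 + wellConditionedInd δ Q n x *
        leakageLoss B Q d η σ (subspaceLeakage Q n x z)| ≤
        C * (wellConditionedInd δ Q n x * (‖subspaceLeakage Q n x z‖ ^ 2 +
          ‖subspaceLeakage Q n x z‖ ^ 4 / σ ^ 4)) +
        C * μ * σ ^ 2 + C * b)
    {V : Ω → Matrix (Fin q) (Fin q) ℂ} (hVm : ∀ k l, AEMeasurable (fun ω => V ω k l) P)
    (hV : ∀ᵐ ω ∂P, (V ω)ᴴ = V ω ∧ V ω * V ω = V ω ∧ (V ω).trace = r ∧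
      sampleCov n (fun m => snapshot (τ m ω) (c m ω) (z m ω)) * V ω =
        V ω * sampleCov n (fun m => snapshot (τ m ω) (c m ω) (z m ω)) ∧
      ∀ Q : Matrix (Fin q) (Fin q) ℂ, Qᴴ = Q → Q * Q = Q → Q.trace = r →
        ‖sampleCov n (fun m => snapshot (τ m ω) (c m ω) (z m ω)) * (1 - V ω)‖ ≤
          (sampleCov n (fun m => snapshot (τ m ω) (c m ω) (z m ω)) * (1 - Q)).trace.re) :
    Integrable (fun ω => lossRatio B Q d η σ (V ω)) P ∧
    |∫ ω, lossRatio B Q d η σ (V ω) ∂P - 1 + η / n * ∫ ω,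
      wellConditionedInd δ Q n (innerData Q τ c z ω) *
        ((regularizedCov Q n (innerData Q τ c z ω))⁻¹ * B).trace.re ∂P| ≤
      C * ((C₄ + 1) * (σ ^ 2 / n + 1 / n ^ 2)) + C * μ * σ ^ 2 +
        C * P.real (badEvent (4 * δ) Q τ c z σ n) := by
  have hQ1 : (1 - Q)ᴴ = 1 - Q := by simp [hQ]
  have hQQ1 : (1 - Q) * (1 - Q) = 1 - Q := by simp [sub_mul, mul_sub, hQQ]
  set X := innerData Q τ c z with hX
  set Z := outerNoise Q z with hZ
  have hXm : Measurable X := measurable_innerData hτ hc hz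
  have hZm : Measurable Z := measurable_outerNoise hz
  have hXZ := H.indepFun_innerData_outerNoise hτ hc hz hQ hQQ
  have hZg : ∀ m, IsCircularGaussian (fun ω => Z ω m) ((σ : ℂ) ^ 2 • (1 - Q)) P := fun m =>
    (H.noise m).projection hQ1 hQQ1
  have hZi : iIndepFun (fun m ω => Z ω m) P := H.iIndepFun_outerNoise Q
  have hXQ : ∀ ω m, Q *ᵥ X ω m = X ω m := fun ω m => by
    simp only [hX, innerData, mulVec_mulVec, hQQ]
  obtain ⟨i1, e1⟩ := leakage_moments hQ hQQ hσ hXm hZm hXZ hZg hZi hδ hn hC₄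
  obtain ⟨i2, e2⟩ := integral_leakageLoss (η := η) hQ hQQ hQB hσ hXm hZm hXZ hXQ hZg hZi hδ ht hn
  have hbad := measurableSet_badEvent (Q := Q) (σ := σ) hτ hc hz (4 * δ) n
  have ib : Integrable ((badEvent (4 * δ) Q τ c z σ n).indicator (1 : Ω → ℝ)) P :=
    (integrable_const (1 : ℝ)).indicator hbad
  have il : Integrable (fun ω => lossRatio B Q d η σ (V ω)) P := by
    refine Integrable.of_bound (aemeasurable_lossRatio hVm d η σ).aestronglyMeasurable
      (sqLen d / (quadForm (1 - Q) d).re) ?_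
    filter_upwards [hV] with ω hω
    obtain ⟨a, b⟩ := lossRatio_mem hB ht hη σ hω.1 hω.2.1
    rwa [Real.norm_of_nonneg a]
  refine ⟨il, ?_⟩
  have iL : Integrable (fun ω => lossRatio B Q d η σ (V ω) - 1) P := il.sub (integrable_const 1)
  have iY1 : Integrable (fun ω => C * (wellConditionedInd δ Q n (X ω) *
      (‖subspaceLeakage Q n (X ω) (Z ω)‖ ^ 2 + ‖subspaceLeakage Q n (X ω) (Z ω)‖ ^ 4 / σ ^ 4)) +
      C * μ * σ ^ 2) P := (i1.const_mul C).add (integrable_const (C * μ * σ ^ 2))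
  have hle : ∀ᵐ ω ∂P, ‖lossRatio B Q d η σ (V ω) - 1 + wellConditionedInd δ Q n (X ω) *
      leakageLoss B Q d η σ (subspaceLeakage Q n (X ω) (Z ω))‖ ≤
      C * (wellConditionedInd δ Q n (X ω) * (‖subspaceLeakage Q n (X ω) (Z ω)‖ ^ 2 +
        ‖subspaceLeakage Q n (X ω) (Z ω)‖ ^ 4 / σ ^ 4)) + C * μ * σ ^ 2 +
        C * (badEvent (4 * δ) Q τ c z σ n).indicator 1 ω := by
    filter_upwards [hV, H.clutter_ae_eq hQ hSQ] with ω hω hcl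
    obtain ⟨v1, v2, v3, v4, v5⟩ := hω
    -- The projection outside the range removes the clutter, leaving pure noise.
    have hout : ∀ m, (1 - Q) *ᵥ snapshot (τ m ω) (c m ω) (z m ω) = Z ω m := fun m => by
      change (1 - Q) *ᵥ (clutter τ c m ω + z m ω) = (1 - Q) *ᵥ z m ω
      rw [mulVec_add, sub_mulVec, one_mulVec, hcl.2, sub_self, zero_add]
    have hi0 : 0 ≤ (badEvent (4 * δ) Q τ c z σ n).indicator (1 : Ω → ℝ) ω :=
      Set.indicator_nonneg (fun _ _ => zero_le_one) _
    -- The number `b` is the indicator of the bad event, so its mean is the bad probability.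
    refine hexp (V ω) (sampleCov n fun m => snapshot (τ m ω) (c m ω) (z m ω)) (X ω) (Z ω)
      v1 v2 (hr.trans v3.symm) v4 ?_ ?_ ?_ _ hi0 ?_ ?_
    · rw [regularizedCov, ← sampleCov_projection hQ]; rfl
    · rw [← sampleCrossCov_projection hQ]
      simp only [hout]; rfl
    · refine (v5 Q hQ hQQ hr).trans (le_of_eq ?_)
      rw [re_trace_sampleCov_mul hQ1 hQQ1]
      simp only [hout]
    · intro hx
      have : ω ∈ badEvent (4 * δ) Q τ c z σ n := by
        by_contra hb
        exact hx (innerData_mem_wellConditioned hQ hQQ hσδ hcl.2 hb)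
      simp [this]
    · intro hx
      have : ω ∈ badEvent (4 * δ) Q τ c z σ n := by
        refine Or.inr (hx.le.trans ?_)
        exact mul_le_mul_of_nonneg_left (Finset.sum_le_sum fun m _ =>
          sqLen_projection_le hQ1 hQQ1 _) (by positivity)
      simp [this]
  have e : ∫ ω, lossRatio B Q d η σ (V ω) ∂P - 1 + η / n * ∫ ω, wellConditionedInd δ Q n (X ω) *
        ((regularizedCov Q n (X ω))⁻¹ * B).trace.re ∂P =
      ∫ ω, (lossRatio B Q d η σ (V ω) - 1 + wellConditionedInd δ Q n (X ω) *
        leakageLoss B Q d η σ (subspaceLeakage Q n (X ω) (Z ω))) ∂P := by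
    rw [integral_add iL i2, e2, integral_sub il (integrable_const 1)]
    simp
  rw [e, ← Real.norm_eq_abs]
  refine (norm_integral_le_of_norm_le (iY1.add (ib.const_mul C)) hle).trans ?_
  have e3 : ∫ ω, (C * (wellConditionedInd δ Q n (X ω) * (‖subspaceLeakage Q n (X ω) (Z ω)‖ ^ 2 +
        ‖subspaceLeakage Q n (X ω) (Z ω)‖ ^ 4 / σ ^ 4)) + C * μ * σ ^ 2 +
        C * (badEvent (4 * δ) Q τ c z σ n).indicator 1 ω) ∂P =
      C * ∫ ω, wellConditionedInd δ Q n (X ω) * (‖subspaceLeakage Q n (X ω) (Z ω)‖ ^ 2 +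
        ‖subspaceLeakage Q n (X ω) (Z ω)‖ ^ 4 / σ ^ 4) ∂P + C * μ * σ ^ 2 +
        C * P.real (badEvent (4 * δ) Q τ c z σ n) := by
    rw [integral_add iY1 (ib.const_mul C), integral_add (i1.const_mul C) (integrable_const _),
      integral_const_mul, integral_const_mul C ((badEvent (4 * δ) Q τ c z σ n).indicator 1),
      integral_indicator_one hbad]
    simp
  refine (le_of_eq e3).trans ?_
  gcongr

/-- Joint expansion of the mean loss ratio in the sample size and the noise level. -/
theorem exists_integral_lossRatio_expansion {Bi : Matrix (Fin q) (Fin q) ℂ}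
    (hτ : ∀ m, Measurable (τ m)) (hc : ∀ m, Measurable (c m)) (hz : ∀ σ m, Measurable (z σ m))
    (hQ : Qᴴ = Q) (hQQ : Q * Q = Q) (hB : B.PosSemidef) (hQB : Q * B = B) (hBQ : B * Q = B)
    (hBi : B * Bi = Q) {r : ℕ} (hr : Q.trace = r) {a : ℝ} (ha : 0 < a)
    (hE : 0 < ∫ ω, τ 0 ω ^ 2 ∂P)
    (H : ∀ σ > 0, IsSIRV τ c (z σ) ((a : ℂ) • B) σ P) {d : Fin q → ℂ}
    (ht : 0 < (quadForm (1 - Q) d).re) {η : ℝ} (hη : 0 ≤ η)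
    {V : ℝ → ℕ → Ω → Matrix (Fin q) (Fin q) ℂ}
    (hVm : ∀ σ > 0, ∀ n k l, AEMeasurable (fun ω => V σ n ω k l) P)
    (hV : ∀ σ > 0, ∀ n, ∀ᵐ ω ∂P, (V σ n ω)ᴴ = V σ n ω ∧ V σ n ω * V σ n ω = V σ n ω ∧
      (V σ n ω).trace = r ∧
      sampleCov n (fun m => snapshot (τ m ω) (c m ω) (z σ m ω)) * V σ n ω =
        V σ n ω * sampleCov n (fun m => snapshot (τ m ω) (c m ω) (z σ m ω)) ∧
      ∀ Q : Matrix (Fin q) (Fin q) ℂ, Qᴴ = Q → Q * Q = Q → Q.trace = r →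
        ‖sampleCov n (fun m => snapshot (τ m ω) (c m ω) (z σ m ω)) * (1 - V σ n ω)‖ ≤
          (sampleCov n (fun m => snapshot (τ m ω) (c m ω) (z σ m ω)) * (1 - Q)).trace.re) :
    ∃ C, 0 ≤ C ∧ ∃ σ₀, 0 < σ₀ ∧ ∃ θ : ℝ → ℕ → ℝ,
      Tendsto (fun x : ℕ × ℝ => θ x.2 x.1) (atTop ×ˢ 𝓝[>] (0 : ℝ))
        (𝓝 (r / (a * ∫ ω, τ 0 ω ^ 2 ∂P))) ∧
      ∀ σ, 0 < σ → σ < σ₀ → ∀ n : ℕ, 0 < n →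
        Integrable (fun ω => lossRatio B Q d η σ (V σ n ω)) P ∧
        |∫ ω, lossRatio B Q d η σ (V σ n ω) ∂P - 1 + η / n * θ σ n| ≤
          C * (σ ^ 2 / n + 1 / n ^ 2) + C * (if Q *ᵥ d = 0 then 0 else 1) * σ ^ 2 := by
  set E := ∫ ω, τ 0 ω ^ 2 ∂P with hE'
  have hS : ((a : ℂ) • B).PosSemidef := hB.smul (Complex.zero_le_real.2 ha.le)
  have hB0 : B * (1 - Q) = 0 := by rw [mul_sub, mul_one, hBQ, sub_self]
  have hSQ : ((a : ℂ) • B) * (1 - Q) = 0 := by rw [smul_mul_assoc, hB0, smul_zero]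
  -- The clutter does not depend on the noise level, so its properties can be taken from the model
  -- at `σ = 1`.
  have H1 := H 1 one_pos
  set S' : Matrix (Fin q) (Fin q) ℂ := ((a * E : ℝ) : ℂ) • B with hS'
  have hSe : (E : ℂ) • (a : ℂ) • B = S' := by
    rw [hS', smul_smul, Complex.ofReal_mul, mul_comm]
  have hcl : ∀ k l, Integrable (fun ω => clutter τ c 0 ω k * star (clutter τ c 0 ω l)) P ∧
      ∫ ω, clutter τ c 0 ω k * star (clutter τ c 0 ω l) ∂P = S' k l := fun k l => by
    have := H1.integral_clutter_mul_star hS k l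
    rwa [← hE', hSe] at this
  have he : a * E ≠ 0 := by positivity
  have hT : ((((a * E : ℝ) : ℂ)⁻¹) • Biᴴ) * S' = Q := by
    have h1 : Biᴴ * B = Q := by
      rw [← hQ, ← hBi, conjTranspose_mul, hB.1.eq]
    have he' : ((a * E : ℝ) : ℂ) ≠ 0 := by exact_mod_cast he
    rw [hS', smul_mul_smul_comm, h1, inv_mul_cancel₀ he', one_smul]
  have mcl := measurable_clutter hτ hc
  obtain ⟨δ₀, hδ₀, C₁, hC₁, hbad⟩ := exists_measure_not_wellConditioned_le (Q := Q) mcl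
    H1.iIndepFun_clutter H1.identDistrib_clutter hQ hQQ (fun k l => (hcl k l).2)
    (fun k l => (hcl k l).1) hT
  -- A quarter of the clutter's constant, in anticipation of the loss caused by the inner noise.
  set δ := δ₀ / 4 with hδ'
  have hδ : 0 < δ := by positivity
  have h4δ : 4 * δ = δ₀ := by rw [hδ']; ring
  rw [← h4δ] at hbad
  obtain ⟨N, hN, hNB⟩ := exists_inv_regularized hQQ hQB hBQ hBi he
  obtain ⟨C₂, hC₂, σ₁, hσ₁, hexp⟩ := exists_abs_lossRatio_sub_le hQ hQQ hB hQB hBQ ht hη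
    (show (0 : ℝ) ≤ q + 1 by positivity) hδ
  have hL : (N * B).trace.re = r / (a * E) := by
    rw [hNB, hr, ← Complex.ofReal_inv, Complex.re_ofReal_mul, Complex.natCast_re, inv_mul_eq_div]
  obtain ⟨hcovi, hcov⟩ := tendsto_integral_norm_sampleCov_sub mcl H1.iIndepFun_clutter
    H1.identDistrib_clutter (fun k l => (hcl k l).2) (fun k l => (hcl k l).1)
  have hsmall : ∀ σ : ℝ, 0 < σ → σ < min 1 (δ / (q + 1)) → (q + 1) * σ ^ 2 ≤ δ := by
    intro σ hσ hlt
    have h1 : σ ≤ 1 := hlt.le.trans (min_le_left _ _)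
    have h2 := hlt.le.trans (min_le_right _ _)
    rw [le_div_iff₀ (by positivity)] at h2
    have h3 : σ ^ 2 ≤ σ := by nlinarith
    calc (q + 1) * σ ^ 2 ≤ (q + 1) * σ := by gcongr
      _ ≤ δ := by linarith
  have m8 : 0 ≤ stdGaussianMoment 8 := integral_nonneg fun x => by positivity
  set C₃ := C₁ + 24 * q ^ 4 * (stdGaussianMoment 8 + 1) with hC₃
  have hC₃0 : 0 ≤ C₃ := by positivity
  have hbadle : ∀ σ, 0 < σ → ∀ n : ℕ, 0 < n →
      P.real (badEvent (4 * δ) Q τ c (z σ) σ n) ≤ C₃ / n ^ 2 := fun σ hσ n hn =>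
    measureReal_badEvent_le (H σ hσ) hσ (hz σ) hn (hbad n hn)
  set C₄ : ℝ := 12 * q ^ 4 * (√(stdGaussianMoment 4) / 2 *
    (√q / δ + (√q / δ) ^ 2 * ‖1 - Q‖)) ^ 2 with hC₄
  have hC₄0 : 0 ≤ C₄ := by positivity
  set μ : ℝ := if Q *ᵥ d = 0 then 0 else 1 with hμ
  have hμ0 : 0 ≤ μ := by rw [hμ]; split_ifs <;> simp
  set σ₀ := min σ₁ (min 1 (δ / (q + 1))) with hσ₀
  have hσ₀0 : 0 < σ₀ := lt_min hσ₁ (lt_min one_pos (by positivity))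
  -- `θ` is the mean of `tr (G⁻¹ B)` over well-conditioned inner data, `G` being their regularized
  -- covariance.
  refine ⟨C₂ * (C₄ + 1) + C₂ + C₂ * C₃, by positivity, σ₀, hσ₀0, fun σ n => ∫ ω,
    wellConditionedInd δ Q n (innerData Q τ c (z σ) ω) *
      ((regularizedCov Q n (innerData Q τ c (z σ) ω))⁻¹ * B).trace.re ∂P, ?_, ?_⟩
  · rw [tendsto_iff_norm_sub_tendsto_zero, ← hL]
    have hev : ∀ᶠ x : ℕ × ℝ in atTop ×ˢ 𝓝[>] (0 : ℝ), 0 < x.1 ∧ 0 < x.2 ∧ x.2 < σ₀ :=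
      (eventually_gt_atTop 0).prod_mk (Ioo_mem_nhdsGT hσ₀0)
    have t1 : Tendsto (fun x : ℕ × ℝ => x.1) (atTop ×ˢ 𝓝[>] (0 : ℝ)) atTop := tendsto_fst
    have t2 : Tendsto (fun x : ℕ × ℝ => x.2) (atTop ×ˢ 𝓝[>] (0 : ℝ)) (𝓝 0) :=
      tendsto_nhdsWithin_iff.1 tendsto_snd |>.1
    refine squeeze_zero' (Eventually.of_forall fun x => norm_nonneg _) (g := fun x : ℕ × ℝ =>
      q * (√q / δ * ‖N‖ * ‖B‖) * (∫ ω, ‖sampleCov x.1 (fun m => clutter τ c m ω) - S'‖ ∂P +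
        x.2 * ∫ ω, sqLen (clutter τ c 0 ω) ∂P + (x.2 + x.2 ^ 2) * q) +
      |(N * B).trace.re| * (C₃ / (x.1 : ℝ) ^ 2)) ?_ ?_
    · filter_upwards [hev] with x hx
      obtain ⟨hn, hσ, hlt⟩ := hx
      have := exists_abs_integral_trace_sub_le (B := B) (H x.2 hσ) hσ hτ hc (hz x.2) hQ hQQ hS hSQ hδ
        (hsmall x.2 hσ (hlt.trans_le (min_le_right _ _))) hN hn (hcovi x.1)
      rw [Real.norm_eq_abs]
      refine this.trans ?_
      have := hbadle x.2 hσ x.1 hn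
      gcongr
    · have a1 := hcov.comp t1
      have a2 := t2.mul_const (∫ ω, sqLen (clutter τ c 0 ω) ∂P)
      have a3 := (t2.add (t2.pow 2)).mul_const (q : ℝ)
      have a4 : Tendsto (fun x : ℕ × ℝ => C₃ / (x.1 : ℝ) ^ 2) (atTop ×ˢ 𝓝[>] (0 : ℝ)) (𝓝 0) :=
        tendsto_const_nhds.div_atTop ((tendsto_pow_atTop two_ne_zero).comp
          (tendsto_natCast_atTop_atTop.comp t1))
      have := (((a1.add a2).add a3).const_mul (q * (√q / δ * ‖N‖ * ‖B‖))).add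
        (a4.const_mul |(N * B).trace.re|)
      simpa using this
  · intro σ hσ hlt n hn
    have hσ1 : σ < σ₁ := hlt.trans_le (min_le_left _ _)
    obtain ⟨i, h⟩ := abs_integral_lossRatio_sub_le (H σ hσ) hσ hτ hc (hz σ) hQ hQQ hB hQB hSQ hr ht
      hη hδ (hsmall σ hσ (hlt.trans_le (min_le_right _ _))) hC₂ hn le_rfl (hexp σ hσ hσ1 n)
      (hVm σ hσ n) (hV σ hσ n)
    rw [← hC₄] at h
    refine ⟨i, h.trans ?_⟩
    have hn' : (0 : ℝ) < n := by exact_mod_cast hn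
    have b1 : C₂ * P.real (badEvent (4 * δ) Q τ c (z σ) σ n) ≤ C₂ * (C₃ / n ^ 2) :=
      mul_le_mul_of_nonneg_left (hbadle σ hσ n hn) hC₂
    have b2 : 0 ≤ σ ^ 2 / n := by positivity
    have b3 : 0 ≤ 1 / (n : ℝ) ^ 2 := by positivity
    have b4 : 0 ≤ μ * σ ^ 2 := by positivity
    have c1 : 0 ≤ C₂ * C₃ * (σ ^ 2 / n) := by positivity
    have c2 : 0 ≤ C₂ * (σ ^ 2 / n + 1 / n ^ 2) := by positivity
    have c3 : 0 ≤ (C₂ * (C₄ + 1) + C₂ * C₃) * (μ * σ ^ 2) := by positivity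
    have b5 : C₂ * (C₃ / n ^ 2) = C₂ * C₃ * (1 / (n : ℝ) ^ 2) := by ring
    rw [b5] at b1
    linarith

end

/-! ### From the expansion to the two asymptotic statements. -/

section

/-- Multiplication by `n` turns the error into `σ² + 1 / n`, which vanishes jointly without any
relation between `n` and `σ`. -/
theorem tendsto_mul_one_sub_of_expansion {f θ : ℝ → ℕ → ℝ} {C η L σ₀ : ℝ} (hσ₀ : 0 < σ₀)
    (hθ : Tendsto (fun x : ℕ × ℝ => θ x.2 x.1) (atTop ×ˢ 𝓝[>] (0 : ℝ)) (𝓝 L))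
    (h : ∀ σ, 0 < σ → σ < σ₀ → ∀ n : ℕ, 0 < n →
      |f σ n - 1 + η / n * θ σ n| ≤ C * (σ ^ 2 / n + 1 / n ^ 2)) :
    Tendsto (fun x : ℕ × ℝ => (x.1 : ℝ) * (1 - f x.2 x.1)) (atTop ×ˢ 𝓝[>] (0 : ℝ))
      (𝓝 (η * L)) := by
  have hev : ∀ᶠ x : ℕ × ℝ in atTop ×ˢ 𝓝[>] (0 : ℝ), 0 < x.1 ∧ 0 < x.2 ∧ x.2 < σ₀ :=
    (eventually_gt_atTop 0).prod_mk (Ioo_mem_nhdsGT hσ₀)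
  have t1 : Tendsto (fun x : ℕ × ℝ => x.1) (atTop ×ˢ 𝓝[>] (0 : ℝ)) atTop := tendsto_fst
  have t2 : Tendsto (fun x : ℕ × ℝ => x.2) (atTop ×ˢ 𝓝[>] (0 : ℝ)) (𝓝 0) :=
    tendsto_nhdsWithin_iff.1 tendsto_snd |>.1
  have h0 : Tendsto (fun x : ℕ × ℝ => (x.1 : ℝ) * (1 - f x.2 x.1) - η * θ x.2 x.1)
      (atTop ×ˢ 𝓝[>] (0 : ℝ)) (𝓝 0) := by
    refine squeeze_zero_norm' (a := fun x : ℕ × ℝ => C * (x.2 ^ 2 + 1 / (x.1 : ℝ))) ?_ ?_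
    · filter_upwards [hev] with x hx
      obtain ⟨hn, hσ, hlt⟩ := hx
      have hn' : (0 : ℝ) < x.1 := by exact_mod_cast hn
      have h1 := h x.2 hσ hlt x.1 hn
      have e : (x.1 : ℝ) * (1 - f x.2 x.1) - η * θ x.2 x.1 =
          -(x.1 * (f x.2 x.1 - 1 + η / x.1 * θ x.2 x.1)) := by field_simp; ring
      rw [e, norm_neg, Real.norm_eq_abs, abs_mul, abs_of_pos hn']
      calc _ ≤ (x.1 : ℝ) * (C * (x.2 ^ 2 / x.1 + 1 / x.1 ^ 2)) := by gcongr
        _ = _ := by field_simp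
    · have := ((t2.pow 2).add (tendsto_one_div_atTop_nhds_zero_nat.comp t1)).const_mul C
      simpa using this
  have := h0.add (hθ.const_mul η)
  simpa using this

/-- The uniform error `C σ²` cannot be absorbed in `ε / n`. The term `C σ² / n` joins it, whence `2
C`; the deviation of `θ` from its limit and `C / n²` fit into `ε / n`. -/
theorem eventually_abs_sub_le_of_expansion {f θ : ℝ → ℕ → ℝ} {C η L σ₀ : ℝ} (hC : 0 ≤ C)
    (hσ₀ : 0 < σ₀)
    (hθ : Tendsto (fun x : ℕ × ℝ => θ x.2 x.1) (atTop ×ˢ 𝓝[>] (0 : ℝ)) (𝓝 L))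
    (h : ∀ σ, 0 < σ → σ < σ₀ → ∀ n : ℕ, 0 < n →
      |f σ n - 1 + η / n * θ σ n| ≤ C * (σ ^ 2 / n + 1 / n ^ 2) + C * σ ^ 2) {ε : ℝ} (hε : 0 < ε) :
    ∀ᶠ x : ℕ × ℝ in atTop ×ˢ 𝓝[>] (0 : ℝ),
      |f x.2 x.1 - (1 - η * L / x.1)| ≤ ε / x.1 + 2 * C * x.2 ^ 2 := by
  have hev : ∀ᶠ x : ℕ × ℝ in atTop ×ˢ 𝓝[>] (0 : ℝ), 0 < x.1 ∧ 0 < x.2 ∧ x.2 < σ₀ :=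
    (eventually_gt_atTop 0).prod_mk (Ioo_mem_nhdsGT hσ₀)
  have t1 : Tendsto (fun x : ℕ × ℝ => x.1) (atTop ×ˢ 𝓝[>] (0 : ℝ)) atTop := tendsto_fst
  have h0 : Tendsto (fun x : ℕ × ℝ => |η * (θ x.2 x.1 - L)| + C * (1 / (x.1 : ℝ)))
      (atTop ×ˢ 𝓝[>] (0 : ℝ)) (𝓝 0) := by
    have := ((hθ.sub_const L).const_mul η).abs.add
      ((tendsto_one_div_atTop_nhds_zero_nat.comp t1).const_mul C)
    simpa using this
  filter_upwards [hev, h0.eventually_lt_const hε] with x hx hlt'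
  obtain ⟨hn, hσ, hlt⟩ := hx
  have hn' : (0 : ℝ) < x.1 := by exact_mod_cast hn
  have hn1 : (1 : ℝ) ≤ x.1 := by exact_mod_cast hn
  have h1 := h x.2 hσ hlt x.1 hn
  have e : f x.2 x.1 - (1 - η * L / x.1) =
      (f x.2 x.1 - 1 + η / x.1 * θ x.2 x.1) - η * (θ x.2 x.1 - L) / x.1 := by field_simp; ring
  rw [e]
  refine (abs_sub _ _).trans ?_
  rw [abs_div, abs_of_pos hn']
  have h2 : x.2 ^ 2 / x.1 ≤ x.2 ^ 2 := div_le_self (by positivity) hn1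
  have h3 : |η * (θ x.2 x.1 - L)| / x.1 + C * (1 / x.1 ^ 2) ≤ ε / x.1 := by
    have : |η * (θ x.2 x.1 - L)| / x.1 + C * (1 / (x.1 : ℝ) ^ 2) =
      (|η * (θ x.2 x.1 - L)| + C * (1 / x.1)) / x.1 := by field_simp
    rw [this]
    gcongr
  have h4 := mul_le_mul_of_nonneg_left h2 hC
  linarith

end

end

/-! ### Assembly of the main theorem. -/

noncomputable section

section

variable {Ω : Type*} [MeasurableSpace Ω] {P : Measure Ω} {p q r : ℕ}

theorem aemeasurable_sinrLoss {A : Matrix (Fin p) (Fin p) ℂ} {B : Matrix (Fin q) (Fin q) ℂ}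
    (hA : A.PosSemidef) {h : Fin p → ℂ} (hh : sqLen h = 1) {dA : Fin p → ℂ}
    (hdA : spatialProj h *ᵥ dA ≠ 0) (dB : Fin q → ℂ) {α : ℂ} (hα : α ≠ 0) (E σ : ℝ)
    {U : Ω → Matrix (Fin q) (Fin r) ℂ} (hU : ∀ i j, AEMeasurable (fun ω => U ω i j) P) :
    AEMeasurable (fun ω => sinrLoss α (clutterNoiseCov E (A ⊗ₖ B) σ) h (kronVec dA dB) (U ω)) P := by
  simp only [sinrLoss_eq_div hA hh hdA dB hα]
  refine AEMeasurable.div_const ?_ _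
  have h1 : ∀ k, AEMeasurable (fun ω => ((1 - U ω * (U ω)ᴴ) *ᵥ dB) k) P := fun k => by
    simp only [mulVec, dotProduct, Matrix.sub_apply, Matrix.mul_apply, conjTranspose_apply]
    fun_prop
  have h2 : AEMeasurable (fun ω => (1 - U ω * (U ω)ᴴ) *ᵥ dB) P := aemeasurable_pi_lambda _ h1
  have h3 : Measurable (temporalSinr (E * hermForm A (normalizedResidual h dA)) σ B dB) := by
    unfold temporalSinr hermForm sqLen
    simp only [mulVec, dotProduct, Pi.star_apply]
    fun_prop
  exact h3.comp_aemeasurable h2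

end

/-- The product filter encodes the joint limit: an eventual property holds for all `n ≥ N` and `0 <
σ < σ₀` for suitable `N` and `σ₀`. -/
theorem mainTheorem1 {Ω : Type*} [MeasurableSpace Ω] (P : Measure Ω) [IsProbabilityMeasure P]
    {p q rb : ℕ}
    -- covariance factors and the fixed spatial estimate
    (A : Matrix (Fin p) (Fin p) ℂ) (hA : A.PosSemidef)
    (B : Matrix (Fin q) (Fin q) ℂ) (hB : B.PosSemidef) (hrank : B.rank = rb)
    (h : Fin p → ℂ) (h_unit : ‖WithLp.toLp 2 h‖ = 1) (h_pos : hermForm A h ≠ 0)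
    -- target amplitude and steering vector
    (α : ℂ) (hα : α ≠ 0) (dA : Fin p → ℂ) (hdA : spatialProj h *ᵥ dA ≠ 0)
    (dB : Fin q → ℂ) (hdB : dB ∉ Set.range B.mulVec)
    -- training data, for every noise level
    (τ : ℕ → Ω → ℝ) (c : ℕ → Ω → Fin p × Fin q → ℂ) (z : ℝ → ℕ → Ω → Fin p × Fin q → ℂ)
    (hmodel : ∀ σ > 0, IsSIRV τ c (z σ) (A ⊗ₖ B) σ P)
    -- estimated temporal clutter subspace from the first `n` snapshots
    (U : ℝ → ℕ → Ω → Matrix (Fin q) (Fin rb) ℂ)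
    (hU_meas : ∀ σ > 0, ∀ n i j, AEMeasurable (fun ω => U σ n ω i j) P)
    (hU : ∀ σ > 0, ∀ n, ∀ᵐ ω ∂P, IsPrincipalComponents
      (temporalFit (sampleCov n (fun m => snapshot (τ m ω) (c m ω) (z σ m ω)))
        (vecMulVec h (star h)))
      (U σ n ω))
    -- the SINR loss
    (ρ : ℝ → ℕ → Ω → ℝ)
    (hρ : ∀ σ n ω, ρ σ n ω =
      sinrLoss α (clutterNoiseCov (∫ ω', (τ 0 ω') ^ 2 ∂P) (A ⊗ₖ B) σ) h (kronVec dA dB)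
        (U σ n ω)) :
    (∀ σ > 0, ∀ n, Integrable (ρ σ n) P) ∧
    -- target orthogonal to the temporal clutter subspace: the error is `o(1/n)`
    ((∀ v, star (B *ᵥ v) ⬝ᵥ dB = 0) →
      Tendsto (fun x : ℕ × ℝ => (x.1 : ℝ) * (1 - ∫ ω, ρ x.2 x.1 ω ∂P))
        (atTop ×ˢ 𝓝[>] (0 : ℝ)) (𝓝 (kappa A h dA * rb))) ∧
    -- target merely outside the temporal clutter subspace: the error is `o(1/n) + O(σ²)`
    (0 < kappa A h dA →
      ∃ C : ℝ, ∀ ε > 0, ∀ᶠ x : ℕ × ℝ in atTop ×ˢ 𝓝[>] (0 : ℝ),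
        |(∫ ω, ρ x.2 x.1 ω ∂P) - (1 - kappa A h dA * rb / x.1)| ≤ ε / x.1 + C * x.2 ^ 2) := by
  have hh : sqLen h = 1 := by rw [sqLen_eq_norm_sq, h_unit, one_pow]
  have ha : 0 < hermForm A h := (hermForm_nonneg hA h).lt_of_ne' h_pos
  have M1 := hmodel 1 one_pos
  set E := ∫ ω, (τ 0 ω) ^ 2 ∂P with hEdef
  have hE : 0 < E := by
    refine (integral_pos_iff_support_of_nonneg (fun ω => sq_nonneg _)
      (M1.texture_memLp 0).integrable_sq).2 ?_
    have h1 : ∀ᵐ ω ∂P, ω ∈ Function.support fun ω => τ 0 ω ^ 2 := by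
      filter_upwards [M1.texture_pos 0] with ω hω
      exact (pow_pos hω 2).ne'
    rw [measure_eq_measure_of_null_sdiff (Set.subset_univ _) (by simpa [Set.sdiff_eq] using! h1)]
    simp
  obtain ⟨Q, Bi, hQ, hQQ, hQB, hBQ, hBi, htr⟩ := exists_rangeProjection hB
  rw [hrank] at htr
  set η := E * hermForm A (normalizedResidual h dA) with hη'
  have hη : 0 ≤ η := mul_nonneg hE.le (hermForm_nonneg hA _)
  -- The texture power cancels between the clutter power in the output and the limiting trace.
  have hηκ : η * (rb / (hermForm A h * E)) = kappa A h dA * rb := by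
    rw [hη', kappa]; field_simp
  have hQ1 : (1 - Q)ᴴ = 1 - Q := by simp [hQ]
  have hQQ1 : (1 - Q) * (1 - Q) = 1 - Q := by simp [sub_mul, mul_sub, hQQ]
  -- If `(1 - Q) d_B` were zero, `d_B = B (Bi d_B)` would lie in the range of `B`.
  have ht : 0 < (quadForm (1 - Q) dB).re := by
    rw [sqLen_mulVec_of_projection hQ1 hQQ1, Complex.ofReal_re]
    refine sqLen_pos fun h0 => hdB ⟨Bi *ᵥ dB, ?_⟩
    rw [sub_mulVec, one_mulVec, sub_eq_zero] at h0
    rw [mulVec_mulVec, hBi, ← h0]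
  have hρm : ∀ σ > 0, ∀ n, AEMeasurable (ρ σ n) P := fun σ hσ n => by
    have e : ρ σ n = fun ω => sinrLoss α (clutterNoiseCov E (A ⊗ₖ B) σ) h (kronVec dA dB)
        (U σ n ω) := funext (hρ σ n)
    rw [e]
    exact aemeasurable_sinrLoss hA hh hdA dB hα E σ (hU_meas σ hσ n)
  have hint : ∀ σ > 0, ∀ n, Integrable (ρ σ n) P := fun σ hσ n => by
    refine Integrable.of_bound (hρm σ hσ n).aestronglyMeasurable 1 (Eventually.of_forall fun ω => ?_)
    obtain ⟨h0, h1⟩ := sinrLoss_mem_Icc hA hB hh hdA dB hα hE.le hσ (U σ n ω)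
    rw [hρ, Real.norm_of_nonneg h0]
    exact h1
  refine ⟨hint, ?_⟩
  -- measurable versions of the spatially filtered data
  have hτm : ∀ m, AEMeasurable (τ m) P := fun m => (M1.texture_memLp m).1.aemeasurable
  have hcm : ∀ m, AEMeasurable (fun ω => spatialFilter h (c m ω)) P := fun m =>
    ((M1.spatialFilter hA hh).speckle m).aemeasurable
  have hzm : ∀ (σ : ℝ) (m : ℕ), ∃ f : Ω → Fin q → ℂ, Measurable f ∧
      (0 < σ → (fun ω => spatialFilter h (z σ m ω)) =ᵐ[P] f) := fun σ m => by
    by_cases hσ : 0 < σ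
    · have hz := (((hmodel σ hσ).spatialFilter hA hh).noise m).aemeasurable
      exact ⟨hz.mk _, hz.measurable_mk, fun _ => hz.ae_eq_mk⟩
    · exact ⟨0, measurable_zero, fun h => absurd h hσ⟩
  choose z' hz'm hz'e using hzm
  have hτ0 : ∫ ω, ((hτm 0).mk (τ 0)) ω ^ 2 ∂P = E := by
    refine integral_congr_ae ?_
    filter_upwards [(hτm 0).ae_eq_mk] with ω hω
    rw [hω]
  have hmodel' : ∀ σ > 0, IsSIRV (fun m => (hτm m).mk (τ m)) (fun m => (hcm m).mk _) (z' σ)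
      ((hermForm A h : ℂ) • B) σ P := fun σ hσ =>
    ((hmodel σ hσ).spatialFilter hA hh).congr (fun m => (hτm m).ae_eq_mk) (fun m => (hcm m).ae_eq_mk)
      (fun m => hz'e σ m hσ)
  have hVm : ∀ σ > 0, ∀ n k l, AEMeasurable (fun ω => (U σ n ω * (U σ n ω)ᴴ) k l) P := by
    intro σ hσ n k l
    have := hU_meas σ hσ n
    simp only [Matrix.mul_apply, conjTranspose_apply]
    fun_prop
  have hV : ∀ σ > (0 : ℝ), ∀ n, ∀ᵐ ω ∂P, _ := fun σ hσ n => by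
    filter_upwards [hU σ hσ n, ae_all_iff.2 fun m => (hτm m).ae_eq_mk,
      ae_all_iff.2 fun m => (hcm m).ae_eq_mk, ae_all_iff.2 fun m => hz'e σ m hσ] with ω h1 h2 h3 h4
    rw [temporalFit_sampleCov hh] at h1
    simp only [spatialFilter_snapshot, h2, h3, h4] at h1
    exact h1.projection (sampleCov_posSemidef _ _)
  obtain ⟨C, hC, σ₀, hσ₀, θ, hθ, hexp⟩ := exists_integral_lossRatio_expansion
    (fun m => (hτm m).measurable_mk) (fun m => (hcm m).measurable_mk) hz'm hQ hQQ hB hQB hBQ hBi htr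
    ha (by rw [hτ0]; exact hE) hmodel' ht hη hVm hV
  rw [hτ0] at hθ
  set μ : ℝ := if Q *ᵥ dB = 0 then 0 else 1 with hμ
  have hμ0 : 0 ≤ μ := by rw [hμ]; split_ifs <;> simp
  set c₀ := sqLen dB / (quadForm (1 - Q) dB).re with hc₀
  have hc₀0 : 0 ≤ c₀ := div_nonneg (sqLen_nonneg _) ht.le
  -- The assumption covers both statements: orthogonality of the target makes the factor `γ` equal
  -- to `1`, and `η > 0` bounds its deviation from `1` by `O(σ²)`.
  have key : (0 < η ∨ Q *ᵥ dB = 0) → ∃ C', 0 ≤ C' ∧ ∀ σ, 0 < σ → σ < σ₀ → ∀ n : ℕ, 0 < n →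
      |∫ ω, ρ σ n ω ∂P - 1 + η / n * θ σ n| ≤ C' * (σ ^ 2 / n + 1 / n ^ 2) + C' * (μ * σ ^ 2) := by
    intro hor
    obtain ⟨C₁, hC₁, hγ⟩ := sinrLoss_eq_mul (r := rb) hA hB hQ hQQ hBi hBQ hh hdA ht hα hη hor hη'.symm
    refine ⟨C + C₁ * c₀, by positivity, fun σ hσ hlt n hn => ?_⟩
    obtain ⟨γ, hγ0, hγ1, hγμ, hγU⟩ := hγ σ hσ
    obtain ⟨il, hl⟩ := hexp σ hσ hlt n hn
    have e : ∫ ω, ρ σ n ω ∂P = γ * ∫ ω, lossRatio B Q dB η σ (U σ n ω * (U σ n ω)ᴴ) ∂P := by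
      rw [← integral_const_mul]
      refine integral_congr_ae ?_
      filter_upwards [hV σ hσ n] with ω hω
      rw [hρ, hγU _ hω.2.1]; rfl
    set I := ∫ ω, lossRatio B Q dB η σ (U σ n ω * (U σ n ω)ᴴ) ∂P with hI
    have hI0 : 0 ≤ I := integral_nonneg_of_ae (by
      filter_upwards [hV σ hσ n] with ω hω
      exact (lossRatio_mem hB ht hη σ hω.1 hω.2.1).1)
    have hI1 : I ≤ c₀ := by
      refine (integral_mono_ae il (integrable_const c₀) ?_).trans (by simp)
      filter_upwards [hV σ hσ n] with ω hω
      exact (lossRatio_mem hB ht hη σ hω.1 hω.2.1).2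
    -- Replacing `γ` by `1` costs `(1 - γ) I`, and `I` is bounded.
    have e2 : ∫ ω, ρ σ n ω ∂P - 1 + η / n * θ σ n = (I - 1 + η / n * θ σ n) - (1 - γ) * I := by
      rw [e]; ring
    rw [e2]
    refine (abs_sub _ _).trans ?_
    rw [abs_of_nonneg (mul_nonneg (sub_nonneg.2 hγ1) hI0)]
    have h1 : (1 - γ) * I ≤ C₁ * μ * σ ^ 2 * c₀ := mul_le_mul hγμ hI1 hI0 (by positivity)
    have h2 : 0 ≤ C₁ * c₀ * (σ ^ 2 / n + 1 / (n : ℝ) ^ 2) := by positivity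
    linarith
  refine ⟨fun hort => ?_, fun hκ => ?_⟩
  · have hQd : Q *ᵥ dB = 0 := by
      by_contra h0
      refine (sqLen_pos h0).ne' ?_
      have h1 : quadForm Q dB = 0 := by
        have := hort (Bi *ᵥ dB)
        rw [mulVec_mulVec, hBi, ← IsCircularGaussian.star_dotProduct_mulVec_of_projection hQ] at this
        exact this
      rw [sqLen_mulVec_of_projection hQ hQQ] at h1
      exact_mod_cast h1
    obtain ⟨C', hC', hk⟩ := key (Or.inr hQd)
    rw [← hηκ]
    refine tendsto_mul_one_sub_of_expansion (f := fun σ n => ∫ ω, ρ σ n ω ∂P) hσ₀ hθ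
      (C := C') fun σ hσ hlt n hn => ?_
    have := hk σ hσ hlt n hn
    rwa [hμ, if_pos hQd, zero_mul, mul_zero, add_zero] at this
  · have hη0 : 0 < η := by
      refine mul_pos hE ?_
      rw [kappa] at hκ
      have := mul_pos hκ ha
      rwa [div_mul_cancel₀ _ h_pos] at this
    obtain ⟨C', hC', hk⟩ := key (Or.inl hη0)
    have hμ1 : μ ≤ 1 := by rw [hμ]; split_ifs <;> simp
    refine ⟨2 * C', fun ε hε => ?_⟩
    rw [← hηκ]
    refine eventually_abs_sub_le_of_expansion (f := fun σ n => ∫ ω, ρ σ n ω ∂P) hC' hσ₀ hθ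
      (fun σ hσ hlt n hn => (hk σ hσ hlt n hn).trans ?_) hε
    have : C' * (μ * σ ^ 2) ≤ C' * (1 * σ ^ 2) := by gcongr
    linarith

end
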